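/- **Lemma.** *Setting.* Let $(M,\omega)$ be a compact symplectic manifold, $\widetilde M=\mathbb C\times M$ with $\widetilde\omega=dx\wedge dy\oplus\omega$ and projection $\pi:\widetilde M\to\mathbb C$. Hamiltonian vector fields are defined by $\widetilde\omega(X^F,\cdot)=-dF$. A *Lagrangian cobordism* $W\subset\widetilde M$ is a Lagrangian submanifold, compact over $[0,1]\times\mathbb R$, such that for some $\epsilon'>0$ and closed Lagrangians $L_i,L'_j\subset M$ it equals $\bigsqcup_{i=1}^{r}(1-\epsilon',\infty)\times\{i\}\times L_i$ over $\{x>1-\epsilon'\}$ and $\bigsqcup_{j=1}^{s}(-\infty,\epsilon')\times\{j\}\times L'_j$ over $\{x<\epsilon'\}$. Fix a *profile function*: a smooth $h:\mathbb C\to\mathbb R$ supported in $\{x\le-1\}\cup\{x\ge 2\}$, with complete Hamiltonian flow $\phi^h_t$, such that for some $\epsilon\in(0,\frac14)$, with $T_i^-=(-\infty,-1]\times[i-\frac\epsilon2,i+\frac\epsilon2]$ and $T_i^+=[2,\infty)\times[i-\frac\epsilon2,i+\frac\epsilon2]$ for $i\in\mathbb Z$: - $h=h_\pm(x)$ on every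 $T_i^{\pm}$; $h_-$ is affine with positive slope for $x<-2$ and $h_+$ is affine with negative slope for $x>3$; $h_-$ has on $(-\infty,-\frac54]$ the single critical point $-\frac32$, $h_+$ has on $[\frac94,\infty)$ the single critical point $\frac52$, and both are nondegenerate maxima; - $\phi^h_t((-\infty,-1]\times\{i\})\subset T_i^-$ and $\phi^h_t([2,\infty)\times\{i\})\subset T_i^+$ for $t\in[-1,1]$; and $\phi^h_t$ preserves $[-\frac32,\frac52]\times\mathbb R$ for all $t\in\mathbb R$. For a sign $\alpha$, a *Floer datum* $\mathscr D^\alpha_{W,W'}=(H,J)$ is a smooth time-dependent Hamiltonian and $\widetilde\omega$-compatible almost complex structure on $\widetilde M$, $t\in[0,1]$, with $\phi_1^H(W)$ transverse to $W'$, together with a compact set $K_{W,W'}\subset(-\frac54,\frac94)\times\mathbb R$ outside of which (times $M$) $H_t=\alpha h+G_t$ with $G_t:M\to\mathbb R$, and $\pi$ is $(J_t,(\phi^h_{t})_*i)$-holomorphic if $\alpha=+$, $(J_t,(\phi^h_{1-t})_*i)$-holomorphic if $\alpha=-$. Let $\mathcal O(H)$ be the set of time-one Hamiltonian chords of $H$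 from $W$ to $W'$. *Domains.* Let $\mathcal S\to\mathcal R$ be one of: the universal family of $(k+1)$-pointed discs ($k\ge1$; for $k=1$ the single disc $D\setminus\{-1,1\}$), of $(k+1)$-pointed discs with one interior marked point ($k\ge 0$), or of two-pointed open–closed discs with $(m,p)$ punctures ($k=m+p+1$; these are the $(k+1)$-pointed discs with interior marked point $0$ and with $z_{m+1}=-1$, $z_{m+p+2}=1$). The fibres $\mathcal S_r$ are closed discs with clockwise ordered boundary punctures $z_1,\dots,z_{k+1}$ removed; $C_i$ is the boundary arc from $z_i$ clockwise to $z_{i+1}$, and $C_0$ the one from $z_{k+1}$ to $z_1$. Let $\mathcal I\subset\{1,\dots,k+1\}$ be an input set, $\kappa_i=-$ for $i\in\mathcal I$ and $\kappa_i=+$ otherwise. A *universal choice of strip-like ends* is a smooth family of proper holomorphic embeddings $\epsilon_i=\epsilon_i(r,\cdot):Z^{\kappa_i}\to\mathcal S_r$ with disjoint images that miss the marked point, $Z^+=[0,\infty)\times[0,1]$, $Z^-=(-\infty,0]\times[0,1]$, with $\epsilon_i^{-1}(\partial\mathcal S_r)=\{t\in\{0,1\}\}$ and $\epsilon_i(s,t)\to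 z_i$ as $s\to\kappa_i\infty$. For a sign datum $\bar\alpha=(\alpha_1,\dots,\alpha_{k+1})$ put $\tau_i(t)=t$ if $\alpha_i=+$ and $\tau_i(t)=1-t$ if $\alpha_i=-$. A *global transition function* is a smooth $\boldsymbol a:\mathcal S\to[0,1]$, $a_r=\boldsymbol a|_{\mathcal S_r}$, with, for each $i$: $a_r(\epsilon_i(s,t))=\tau_i(t)$ for $|s|\ge1$; $a_r(\epsilon_i(s,t))=0$ if $\tau_i(t)=0$ or $s=0$; and on the side $\tau_i(t)=1$, $\kappa_i\,\partial_s(a_r\circ\epsilon_i)\ge0$ for $|s|\le1$. The pair $(\mathcal I,\bar\alpha)$ is *compatible* if $\alpha_i=\kappa_i$ for some $i$ and $\alpha_{i'}\ne\kappa_{i'}$ for some $i'$. *Perturbation data.* Let $W_0,\dots,W_k$ be Lagrangian cobordisms, $W_{k+1}=W_0$, and fix Floer data $(H_i,J_i)=\mathscr D^{\alpha_i}_{W_{i-1},W_i}$ for $i\in\mathcal I$ and $(H_i,J_i)=\mathscr D^{\alpha_i}_{W_i,W_{i-1}}$ for $i\notin\mathcal I$, with compact sets $K_i$. A *perturbation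 datum* consists of a smooth family of one-forms $\Theta_r\in\Omega^1(\mathcal S_r,C^\infty(\widetilde M))$, a smooth family $J_{r,z}$ ($z\in\mathcal S_r$) of $\widetilde\omega$-compatible almost complex structures, and a compact set $K\subset(-\frac32,\frac52)\times\mathbb R$ independent of $r$, such that: 1. for $|s|\ge1$: $\epsilon_i^*\Theta_r=H_i\,dt$ and $J_{r,\epsilon_i(s,t)}=J_i(t)$; 2. with $(\Theta_0)_r=\Theta_r-da_r\otimes (h\circ\pi)$: $(\Theta_0)_r$ vanishes on tangent vectors to $\partial\mathcal S_r$; $K\supset K_i$ for all $i$; $K\supset[-\frac54,\frac94]\times[-s_W,s_W]$, with $s_W$ the smallest natural number for which $\pi(W_0\cup\dots\cup W_k)\subset\mathbb R\times(-s_W,s_W)$; and $D\pi(X^{(\Theta_0)_r(\xi)})=0$ outside $K\times M$ for all $\xi\in T\mathcal S_r$; 3. outside $K\times M$, $\pi$ is $(J_{r,z},(\phi^h_{a_r(z)})_*i)$-holomorphic. Let $Y_r(\xi)=X^{\Theta_r(\xi)}$, and let $j$ be the complex structure of $\mathcal S_r$. A *solution* is a smooth map $u:\mathcal S_r\to\widetilde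 M$ with $$Du+J_{r,z}(u)\circ Du\circ j=Y_r+J_{r,z}(u)\circ Y_r\circ j,\qquad u(C_i)\subset W_i\quad(0\le i\le k),$$ such that, for each $i$, $u(\epsilon_i(s,\cdot))$ converges uniformly to some chord $\gamma_i\in\mathcal O(H_i)$ as $s\to\kappa_i\infty$. *Statement.* Assume that $(\mathcal I,\bar\alpha)$ is compatible. Given $W_0,\dots,W_k$, the Floer data and the perturbation datum $(\Theta,J,K)$, there is a constant $C>0$ such that, for all strip-like ends $\{\epsilon_i\}$ and transition functions $\boldsymbol a$ for which $(\Theta,J,K)$ is a perturbation datum, all $r\in\mathcal R$ and all solutions $u:\mathcal S_r\to\widetilde M$, $$u(\mathcal S_r)\subset[-\tfrac32,\tfrac52]\times[-C,C]\times M .$$ In particular, $C$ does not depend on $r$, on $u$, on the strip-like ends or on the transition function. -/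

import Mathlib

open scoped Manifold ContDiff Topology
open Set Filter

namespace CobFloer

/-! ## Symplectic manifolds, Lagrangian submanifolds, Hamiltonian vector fields -/

section Symplectic

variable {E : Type*} [NormedAddCommGroup E] [NormedSpace ℝ E]
  {M : Type*} [TopologicalSpace M] [ChartedSpace E M]

variable (E) in
/-- The model with corners of the manifold `ℂ × M`. -/
noncomputable abbrev prodModel : ModelWithCorners ℝ (ℂ × E) (ModelProd ℂ E) := 𝓘(ℝ, ℂ).prod 𝓘(ℝ, E)

variable (E) in
/-- The derivative of the projection `π : ℂ × M → ℂ`. -/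
noncomputable def horiz (p : ℂ × M) : TangentSpace (prodModel E) p →L[ℝ] ℂ := ContinuousLinearMap.fst ℝ ℂ E

variable (E) in
/-- The derivative of the projection `ℂ × M → M`. -/
noncomputable def vert (p : ℂ × M) : TangentSpace (prodModel E) p →L[ℝ] TangentSpace 𝓘(ℝ, E) p.2 :=
  ContinuousLinearMap.snd ℝ ℂ E

theorem horiz_eq_mfderiv (p : ℂ × M) :
    horiz E p = mfderiv (prodModel E) 𝓘(ℝ, ℂ) (Prod.fst : ℂ × M → ℂ) p :=
  mfderiv_fst.symm

theorem vert_eq_mfderiv (p : ℂ × M) :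
    vert E p = mfderiv (prodModel E) 𝓘(ℝ, E) (Prod.snd : ℂ × M → M) p :=
  mfderiv_snd.symm

variable [IsManifold 𝓘(ℝ, E) ∞ M]

variable (E M) in
/-- A symplectic form on `M`: a smooth closed nondegenerate two-form. Closedness is the vanishing
of the exterior derivative, written out in the charts of `M`. -/
structure SymplecticForm where
  form (p : M) : TangentSpace 𝓘(ℝ, E) p →L[ℝ] TangentSpace 𝓘(ℝ, E) p →L[ℝ] ℝ
  smooth : ContMDiff 𝓘(ℝ, E) (𝓘(ℝ, E).prod 𝓘(ℝ, E →L[ℝ] E →L[ℝ] ℝ)) ∞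
    (fun p : M => Bundle.TotalSpace.mk' (E →L[ℝ] E →L[ℝ] ℝ)
      (E := fun p : M => TangentSpace 𝓘(ℝ, E) p →L[ℝ] TangentSpace 𝓘(ℝ, E) p →L[ℝ] ℝ)
      p (form p))
  alternating (p : M) (v : TangentSpace 𝓘(ℝ, E) p) : form p v v = 0
  nondegenerate (p : M) (v : TangentSpace 𝓘(ℝ, E) p) : (∀ w, form p v w = 0) → v = 0
  closed (x : M) : ∀ y ∈ (extChartAt 𝓘(ℝ, E) x).target, ∀ u v w : E,
    let local_form : E → E → E → ℝ := fun b c y' =>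
      form ((extChartAt 𝓘(ℝ, E) x).symm y')
        (mfderiv 𝓘(ℝ, E) 𝓘(ℝ, E) (extChartAt 𝓘(ℝ, E) x).symm y' b)
        (mfderiv 𝓘(ℝ, E) 𝓘(ℝ, E) (extChartAt 𝓘(ℝ, E) x).symm y' c)
    fderiv ℝ (local_form v w) y u + fderiv ℝ (local_form w u) y v
      + fderiv ℝ (local_form u v) y w = 0

/-- The product symplectic form `dx ∧ dy ⊕ Ω` on `ℂ × M`. -/
noncomputable def prodForm (Ω : SymplecticForm E M) (p : ℂ × M) (v w : TangentSpace (prodModel E) p) : ℝ :=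
  (horiz E p v).re * (horiz E p w).im - (horiz E p v).im * (horiz E p w).re
    + Ω.form p.2 (vert E p v) (vert E p w)

/-- The Hamiltonian vector field of a function `F` on `ℂ × M`: the unique vector field `X` with
`Ω̃(X, ·) = -dF`, where `Ω̃ = dx ∧ dy ⊕ Ω`. -/
noncomputable def hamVF (Ω : SymplecticForm E M) (F : ℂ × M → ℝ) (p : ℂ × M) :
    TangentSpace (prodModel E) p :=
  Classical.epsilon fun X => ∀ v : TangentSpace (prodModel E) p,
    prodForm Ω p X v = -(mfderiv (prodModel E) 𝓘(ℝ, ℝ) F p v)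

/-- `J` is an almost complex structure on `ℂ × M` compatible with `dx ∧ dy ⊕ Ω`. -/
structure IsCompatibleACS (Ω : SymplecticForm E M)
    (J : ∀ p : ℂ × M, TangentSpace (prodModel E) p →L[ℝ] TangentSpace (prodModel E) p) :
    Prop where
  sq (p : ℂ × M) (v : TangentSpace (prodModel E) p) : J p (J p v) = -v
  invariant (p : ℂ × M) (v w : TangentSpace (prodModel E) p) :
    prodForm Ω p (J p v) (J p w) = prodForm Ω p v w
  positive (p : ℂ × M) (v : TangentSpace (prodModel E) p) : v ≠ 0 → 0 < prodForm Ω p v (J p v)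

end Symplectic

section Submanifold

variable {F : Type*} [NormedAddCommGroup F] [NormedSpace ℝ F] {H : Type*} [TopologicalSpace H]
  (I : ModelWithCorners ℝ F H) {N : Type*} [TopologicalSpace N] [ChartedSpace H N]

/-- `S` is a smooth embedded submanifold of `N` (without boundary) of codimension `m`: near each of
its points it is the regular zero set of a smooth map to `ℝ^m`. -/
def IsSubmanifold (m : ℕ) (S : Set N) : Prop :=
  ∀ p ∈ S, ∃ U : Set N, IsOpen U ∧ p ∈ U ∧ ∃ f : N → (Fin m → ℝ),
    ContMDiffOn I 𝓘(ℝ, Fin m → ℝ) ∞ f U ∧ S ∩ U = {q ∈ U | f q = 0} ∧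
    Function.Surjective (mfderiv I 𝓘(ℝ, Fin m → ℝ) f p)

/-- The tangent vectors to `S` at `p`: velocities at time `0` of smooth curves in `S` through `p`.
For a submanifold `S` this is its tangent space. -/
def tangentVectors (S : Set N) (p : N) : Set (TangentSpace I p) :=
  {v | ∃ γ : ℝ → N, ContMDiff 𝓘(ℝ, ℝ) I ∞ γ ∧ γ 0 = p ∧ (∀ᶠ t in 𝓝 (0 : ℝ), γ t ∈ S) ∧
    mfderiv 𝓘(ℝ, ℝ) I γ 0 (1 : ℝ) = v}

/-- `S` and `S'` intersect transversely. -/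
def IsTransverse (S S' : Set N) : Prop :=
  ∀ p ∈ S ∩ S', Submodule.span ℝ (tangentVectors I S p) ⊔
    Submodule.span ℝ (tangentVectors I S' p) = ⊤

/-- `S` is a Lagrangian submanifold of `N` for the two-form `B`: its codimension is half the
dimension of `N`, and `B` vanishes on its tangent spaces. -/
def IsLagrangian (B : ∀ p : N, TangentSpace I p → TangentSpace I p → ℝ) (S : Set N) : Prop :=
  (∃ m : ℕ, 2 * m = Module.finrank ℝ F ∧ IsSubmanifold I m S) ∧
    ∀ p ∈ S, ∀ v ∈ tangentVectors I S p, ∀ w ∈ tangentVectors I S p, B p v w = 0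

end Submanifold

section Cobordism

variable {E : Type*} [NormedAddCommGroup E] [NormedSpace ℝ E]
  {M : Type*} [TopologicalSpace M] [ChartedSpace E M] [IsManifold 𝓘(ℝ, E) ∞ M]

/-- `W ⊆ ℂ × M` is a Lagrangian cobordism from `(L_1, …, L_r)` to `(L'_1, …, L'_s)`, seen as a
Lagrangian submanifold of `ℂ × M` by extending its ends trivially: over `[0,1] × ℝ` it is compact,
over `{x > 1 - ε}` it is the union of the `(1-ε, ∞) × {i} × L_i`, and over `{x < ε}` it is the
union of the `(-∞, ε) × {j} × L'_j`, with closed Lagrangian submanifolds `L_i`, `L'_j` of `M`.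
(`Fin r` counts from `0`, whence the height `i + 1`.) -/
def IsLagrangianCobordism (Ω : SymplecticForm E M) (W : Set (ℂ × M)) : Prop :=
  IsLagrangian (prodModel E) (prodForm Ω) W ∧
  IsCompact (W ∩ {p | p.1.re ∈ Icc (0 : ℝ) 1}) ∧
  ∃ (r s : ℕ) (L : Fin r → Set M) (L' : Fin s → Set M) (ε : ℝ), 0 < ε ∧
    (∀ i, IsCompact (L i) ∧ IsLagrangian 𝓘(ℝ, E) (fun p v w => Ω.form p v w) (L i)) ∧
    (∀ j, IsCompact (L' j) ∧ IsLagrangian 𝓘(ℝ, E) (fun p v w => Ω.form p v w) (L' j)) ∧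
    W ∩ {p | 1 - ε < p.1.re} =
      {p | 1 - ε < p.1.re ∧ ∃ i : Fin r, p.1.im = ((i : ℕ) : ℝ) + 1 ∧ p.2 ∈ L i} ∧
    W ∩ {p | p.1.re < ε} =
      {p | p.1.re < ε ∧ ∃ j : Fin s, p.1.im = ((j : ℕ) : ℝ) + 1 ∧ p.2 ∈ L' j}

end Cobordism

/-! ## Profile functions -/

/-- The Hamiltonian vector field of `h : ℂ → ℝ` with respect to `dx ∧ dy`, that is
`-∂_y h ∂_x + ∂_x h ∂_y`; it satisfies `(dx ∧ dy)(X, ·) = -dh`. -/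
noncomputable def planarHamVF (h : ℂ → ℝ) (z : ℂ) : ℂ :=
  ⟨-(fderiv ℝ h z Complex.I), fderiv ℝ h z 1⟩

/-- A profile function `h` together with its (unique) Hamiltonian flow `φ_t`. The strips `T_i^±`
around the half-lines `(-∞,-1] × {i}` and `[2,∞) × {i}`, in which `h = h_±(x)`, have half-width
`ε / 2`.

The support is only required to lie over `x ≤ -1` and `x ≥ 2`, and the maximum of `h_±` is only
required to be the unique critical point on `(-∞, -5/4]`, respectively `[9/4, ∞)`. (If `h` also
vanished outside small strips around the half-lines, and `h_±` had a single critical point on all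
of `(-∞, -1)`, respectively `(2, ∞)`, then the flow could not preserve the strip
`[-3/2, 5/2] × ℝ`: preservation makes `h` constant on the lines `x = -3/2` and `x = 5/2`.) -/
structure ProfileFunction where
  h : ℂ → ℝ
  φ : ℝ → ℂ → ℂ
  ε : ℝ
  hminus : ℝ → ℝ
  hplus : ℝ → ℝ
  smooth : ContDiff ℝ ∞ h
  flow_zero (z : ℂ) : φ 0 z = z
  flow_deriv (z : ℂ) (t : ℝ) : HasDerivAt (fun τ => φ τ z) (planarHamVF h (φ t z)) t
  ε_pos : 0 < ε
  ε_lt : ε < 1 / 4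
  support : tsupport h ⊆ {z | z.re ≤ -1 ∨ 2 ≤ z.re}
  eq_hminus (i : ℤ) (z : ℂ) : z.re ≤ -1 → |z.im - i| ≤ ε / 2 → h z = hminus z.re
  eq_hplus (i : ℤ) (z : ℂ) : 2 ≤ z.re → |z.im - i| ≤ ε / 2 → h z = hplus z.re
  hminus_linear : ∃ c₀ c₁ : ℝ, 0 < c₀ ∧ ∀ x < -2, hminus x = c₀ * x + c₁
  hplus_linear : ∃ c₀ c₁ : ℝ, c₀ < 0 ∧ ∀ x > 3, hplus x = c₀ * x + c₁
  hminus_critical : ∀ x ≤ -(5 / 4), deriv hminus x = 0 ↔ x = -(3 / 2)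
  hplus_critical : ∀ x ≥ 9 / 4, deriv hplus x = 0 ↔ x = 5 / 2
  hminus_max : deriv (deriv hminus) (-(3 / 2)) < 0
  hplus_max : deriv (deriv hplus) (5 / 2) < 0
  flow_minus : ∀ t ∈ Icc (-1 : ℝ) 1, ∀ (i : ℤ) (z : ℂ), z.re ≤ -1 → z.im = i →
    (φ t z).re ≤ -1 ∧ |(φ t z).im - i| ≤ ε / 2
  flow_plus : ∀ t ∈ Icc (-1 : ℝ) 1, ∀ (i : ℤ) (z : ℂ), 2 ≤ z.re → z.im = i →
    2 ≤ (φ t z).re ∧ |(φ t z).im - i| ≤ ε / 2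
  flow_strip (t : ℝ) :
    φ t '' {z | z.re ∈ Icc (-(3 / 2) : ℝ) (5 / 2)} = {z | z.re ∈ Icc (-(3 / 2) : ℝ) (5 / 2)}

/-- The complex structure `(φ_t)_* i` on `ℂ`, at the point `w` (recall `φ_t⁻¹ = φ_{-t}`). -/
noncomputable def ProfileFunction.pushI (h : ProfileFunction) (t : ℝ) (w ζ : ℂ) : ℂ :=
  fderiv ℝ (h.φ t) (h.φ (-t) w) (Complex.I * fderiv ℝ (h.φ (-t)) w ζ)

/-! ## Signs -/

/-- The real number `1` or `-1` of a sign. -/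
def sgn (α : ℤˣ) : ℝ := ((α : ℤ) : ℝ)

/-- The sign `κ_i` of a puncture: `-` for inputs and `+` for outputs. -/
def kappa {k : ℕ} (inputs : Finset (Fin (k + 1))) (i : Fin (k + 1)) : ℤˣ :=
  if i ∈ inputs then -1 else 1

/-- Compatibility of an input set and a sign datum. -/
def Compatible {k : ℕ} (inputs : Finset (Fin (k + 1))) (α : Fin (k + 1) → ℤˣ) : Prop :=
  (∃ i, α i = kappa inputs i) ∧ ∃ i, α i ≠ kappa inputs i

/-- `t` for the sign `+` and `1 - t` for the sign `-`. -/
def orient (α : ℤˣ) (t : ℝ) : ℝ := if α = 1 then t else 1 - t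

/-- The half-strip `[0,∞) × [0,1]` for the sign `+` and `(-∞,0] × [0,1]` for `-`; its points are
written as `s + i t`. -/
def halfStrip (κ : ℤˣ) : Set ℂ := {w | 0 ≤ sgn κ * w.re ∧ w.im ∈ Icc (0 : ℝ) 1}

/-- The filter `s → ∞` for the sign `+` and `s → -∞` for the sign `-`. -/
def endFilter (κ : ℤˣ) : Filter ℝ := if κ = 1 then atTop else atBot

/-! ## Families of pointed discs -/

/-- The families `𝒮 → ℛ` of discs with `k + 1` boundary punctures:
* `pointed`: the universal family `𝒮^{k+1} → ℛ^{k+1}` of `(k+1)`-pointed discs, `k ≥ 1`;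
* `marked`: the universal family `𝒮^{k+1;1} → ℛ^{k+1;1}` of `(k+1)`-pointed discs with one interior
  marked point;
* `openClosed`: the universal family `𝒮^{m,p;1} → ℛ^{m,p;1}` of two-pointed open-closed discs with
  `(m, p)` punctures, `k = m + p + 1`. -/
inductive DiscFamily : ℕ → Type
  | pointed (k : ℕ) (hk : 1 ≤ k) : DiscFamily k
  | marked (k : ℕ) : DiscFamily k
  | openClosed (m p : ℕ) : DiscFamily (m + p + 1)

/-- Boundary punctures and interior marked point. The puncture `z_{i+1}` is the component `i`, and
in families without interior marked point the second component has the dummy value `0`. -/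
abbrev Config (k : ℕ) : Type := (Fin (k + 1) → ℂ) × ℂ

/-- `z_1, …, z_{k+1}` are distinct points of the unit circle in clockwise order. -/
def IsClockwise {k : ℕ} (z : Fin (k + 1) → ℂ) : Prop :=
  ∃ θ : Fin (k + 1) → ℝ, StrictMono θ ∧ θ (Fin.last k) < θ 0 + 2 * Real.pi ∧
    ∀ i, z i = Complex.exp (-(θ i * Complex.I))

/-- The open arc of the unit circle that leads clockwise from `a` to `b`
(the circle without `a` if `a = b`). -/
def clockwiseArc (a b : ℂ) : Set ℂ :=
  {z | ∃ θ₁ θ₂ θ : ℝ, θ₁ < θ ∧ θ < θ₂ ∧ θ₂ ≤ θ₁ + 2 * Real.pi ∧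
    a = Complex.exp (-(θ₁ * Complex.I)) ∧ b = Complex.exp (-(θ₂ * Complex.I)) ∧
    z = Complex.exp (-(θ * Complex.I))}

/-- `g` is a biholomorphism of the unit disc (a Möbius transformation). -/
def IsDiscAut (g : ℂ → ℂ) : Prop :=
  ∃ c b : ℂ, ‖c‖ = 1 ∧ ‖b‖ < 1 ∧
    ∀ z, g z = c * ((z - b) / (1 - (starRingEnd ℂ) b * z))

namespace DiscFamily

/-- Whether the discs of the family carry an interior marked point. -/
def HasMark {k : ℕ} : DiscFamily k → Prop
  | pointed _ _ => False
  | marked _ => True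
  | openClosed _ _ => True

/-- The space of configurations of which `ℛ` is the quotient. For `k = 1` the family of pointed
discs is the single disc `D ∖ {-1, 1}`. -/
def configs {k : ℕ} : DiscFamily k → Set (Config k)
  | pointed k _ => {c | IsClockwise c.1 ∧ c.2 = 0 ∧ (k = 1 → ∀ i, c.1 i = if i = 0 then -1 else 1)}
  | marked _ => {c | IsClockwise c.1 ∧ ‖c.2‖ < 1}
  | openClosed m p => {c | IsClockwise c.1 ∧ c.1 ⟨m, by omega⟩ = -1 ∧
      c.1 (Fin.last (m + p + 1)) = 1 ∧ c.2 = 0}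

/-- The group of maps by which `ℛ = configs / group` and `𝒮` is the quotient of the space of pairs
`(c, z)`: the biholomorphisms of the disc for `ℛ^{k+1}` (`k ≥ 2`) and `ℛ^{k+1;1}`; the trivial group
for `ℛ^2` and for `ℛ^{m,p;1}`, where the configurations are normalized. -/
def symmetries {k : ℕ} : DiscFamily k → Set (ℂ → ℂ)
  | pointed k _ => {g | IsDiscAut g ∧ (k = 1 → g = id)}
  | marked _ => {g | IsDiscAut g}
  | openClosed _ _ => {id}

open Classical in
/-- The action of a biholomorphism of the disc on configurations. -/
noncomputable def act {k : ℕ} (𝒮 : DiscFamily k) (g : ℂ → ℂ) (c : Config k) : Config k :=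
  (fun i => g (c.1 i), if 𝒮.HasMark then g c.2 else c.2)

end DiscFamily

/-- The punctured disc with punctures `c`: this is the fibre `𝒮_r` over the class `r` of `c`. -/
def fibre {k : ℕ} (c : Config k) : Set ℂ := {z | ‖z‖ ≤ 1 ∧ ∀ i, z ≠ c.1 i}

/-- The pairs `(c, z)` with `z` in the fibre over `c`, so that `𝒮 = total / symmetries`. Objects on
`𝒮` are given below as invariant objects on this space. -/
def DiscFamily.total {k : ℕ} (𝒮 : DiscFamily k) : Set (Config k × ℂ) :=
  {q | q.1 ∈ 𝒮.configs ∧ q.2 ∈ fibre q.1}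

/-- `e` is a strip-like end at the puncture number `i` of the disc with configuration `c`, positive
or negative according to `κ`: a proper holomorphic embedding of the half-strip. -/
structure IsStripLikeEnd {k : ℕ} (c : Config k) (κ : ℤˣ) (i : Fin (k + 1)) (e : ℂ → ℂ) :
    Prop where
  mapsTo : MapsTo e (halfStrip κ) (fibre c)
  holomorphic : DifferentiableOn ℂ e (halfStrip κ)
  immersion : ∀ w ∈ halfStrip κ, derivWithin e (halfStrip κ) w ≠ 0
  proper_embedding : Topology.IsClosedEmbedding (mapsTo.restrict e (halfStrip κ) (fibre c))
  boundary : ∀ w ∈ halfStrip κ, ‖e w‖ = 1 ↔ (w.im = 0 ∨ w.im = 1)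
  tendsto : Tendsto (fun q : ℝ × ℝ => e ⟨q.1, q.2⟩) (endFilter κ ×ˢ 𝓟 (Icc 0 1)) (𝓝 (c.1 i))

/-- `e` is a universal choice of strip-like ends for the family `𝒮` and the given inputs. -/
structure IsStripLikeEnds {k : ℕ} (𝒮 : DiscFamily k) (inputs : Finset (Fin (k + 1)))
    (e : Fin (k + 1) → Config k → ℂ → ℂ) : Prop where
  smooth (i : Fin (k + 1)) : ContDiffOn ℝ ∞ (fun q : Config k × ℂ => e i q.1 q.2)
    (𝒮.configs ×ˢ halfStrip (kappa inputs i))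
  invariant (i : Fin (k + 1)) : ∀ c ∈ 𝒮.configs, ∀ g ∈ 𝒮.symmetries,
    ∀ w ∈ halfStrip (kappa inputs i), e i (𝒮.act g c) w = g (e i c w)
  isEnd (i : Fin (k + 1)) : ∀ c ∈ 𝒮.configs, IsStripLikeEnd c (kappa inputs i) i (e i c)
  disjoint : ∀ c ∈ 𝒮.configs, ∀ i j : Fin (k + 1), i ≠ j →
    Disjoint (e i c '' halfStrip (kappa inputs i)) (e j c '' halfStrip (kappa inputs j))
  mark : 𝒮.HasMark → ∀ c ∈ 𝒮.configs, ∀ i, c.2 ∉ e i c '' halfStrip (kappa inputs i)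

/-- `a` is a global transition function on `𝒮` for the given inputs, sign datum `α` and strip-like
ends `e`. On the ends, `orient (α i)` is `t` or `1 - t`. -/
structure IsTransitionFunction {k : ℕ} (𝒮 : DiscFamily k) (inputs : Finset (Fin (k + 1)))
    (α : Fin (k + 1) → ℤˣ) (e : Fin (k + 1) → Config k → ℂ → ℂ) (a : Config k → ℂ → ℝ) :
    Prop where
  smooth : ContDiffOn ℝ ∞ (fun q : Config k × ℂ => a q.1 q.2) 𝒮.total
  invariant : ∀ c ∈ 𝒮.configs, ∀ g ∈ 𝒮.symmetries, ∀ z ∈ fibre c, a (𝒮.act g c) (g z) = a c z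
  range : ∀ c ∈ 𝒮.configs, ∀ z ∈ fibre c, a c z ∈ Icc (0 : ℝ) 1
  far : ∀ c ∈ 𝒮.configs, ∀ i, ∀ w ∈ halfStrip (kappa inputs i),
    1 ≤ sgn (kappa inputs i) * w.re → a c (e i c w) = orient (α i) w.im
  monotone : ∀ c ∈ 𝒮.configs, ∀ i, ∀ t ∈ Icc (0 : ℝ) 1, orient (α i) t = 1 →
    ∀ s : ℝ, sgn (kappa inputs i) * s ∈ Icc (0 : ℝ) 1 →
      0 ≤ sgn (kappa inputs i) * derivWithin (fun σ : ℝ => a c (e i c ⟨σ, t⟩))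
        {σ | 0 ≤ sgn (kappa inputs i) * σ} s
  vanish : ∀ c ∈ 𝒮.configs, ∀ i, ∀ w ∈ halfStrip (kappa inputs i),
    (orient (α i) w.im = 0 ∨ w.re = 0) → a c (e i c w) = 0

/-! ## Floer data, perturbation data, solutions -/

section Floer

variable {E : Type*} [NormedAddCommGroup E] [NormedSpace ℝ E]
  {M : Type*} [TopologicalSpace M] [ChartedSpace E M] [IsManifold 𝓘(ℝ, E) ∞ M]

/-- `γ : [0,1] → ℂ × M` is a trajectory of the flow of the time-dependent Hamiltonian `H`. -/
def IsTrajectory (Ω : SymplecticForm E M) (H : ℝ → ℂ × M → ℝ) (γ : ℝ → ℂ × M) : Prop :=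
  ∀ t ∈ Icc (0 : ℝ) 1, HasMFDerivWithinAt 𝓘(ℝ, ℝ) (prodModel E) γ (Icc 0 1) t
    (ContinuousLinearMap.toSpanSingleton ℝ (hamVF Ω (H t) (γ t)))

/-- The image `φ_1^H(W)` of `W` under the time-one map of `H`. -/
def timeOneImage (Ω : SymplecticForm E M) (H : ℝ → ℂ × M → ℝ) (W : Set (ℂ × M)) :
    Set (ℂ × M) :=
  {q | ∃ γ, IsTrajectory Ω H γ ∧ γ 0 ∈ W ∧ γ 1 = q}

/-- The set `𝒪(H)` of time-one Hamiltonian chords of `H` from `W` to `W'`. -/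
def chords (Ω : SymplecticForm E M) (H : ℝ → ℂ × M → ℝ) (W W' : Set (ℂ × M)) :
    Set (ℝ → ℂ × M) :=
  {γ | IsTrajectory Ω H γ ∧ γ 0 ∈ W ∧ γ 1 ∈ W'}

/-- A Floer datum `(H, J)` of profile sign `α` for the pair `(W, W')`, with its compact set `K`. -/
structure FloerDatum (Ω : SymplecticForm E M) (h : ProfileFunction) (W W' : Set (ℂ × M))
    (α : ℤˣ) where
  H : ℝ → ℂ × M → ℝ
  J (t : ℝ) (p : ℂ × M) : TangentSpace (prodModel E) p →L[ℝ] TangentSpace (prodModel E) p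
  K : Set ℂ
  smooth_H : ContMDiffOn (𝓘(ℝ, ℝ).prod (prodModel E)) 𝓘(ℝ, ℝ) ∞
    (fun q : ℝ × (ℂ × M) => H q.1 q.2) (Icc 0 1 ×ˢ univ)
  smooth_J : ContMDiffOn (𝓘(ℝ, ℝ).prod (prodModel E).tangent) (prodModel E).tangent ∞
    (fun q : ℝ × TangentBundle (prodModel E) (ℂ × M) =>
      (⟨q.2.proj, J q.1 q.2.proj q.2.2⟩ : TangentBundle (prodModel E) (ℂ × M)))
    (Icc 0 1 ×ˢ univ)
  compatible : ∀ t ∈ Icc (0 : ℝ) 1, IsCompatibleACS Ω (J t)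
  transverse : IsTransverse (prodModel E) (timeOneImage Ω H W) W'
  K_compact : IsCompact K
  K_subset : K ⊆ {z | z.re ∈ Ioo (-(5 / 4) : ℝ) (9 / 4)}
  split : ∃ G : ℝ → M → ℝ, ∀ t ∈ Icc (0 : ℝ) 1, ∀ p : ℂ × M, p.1 ∉ K →
    H t p = sgn α * h.h p.1 + G t p.2
  holomorphic : ∀ t ∈ Icc (0 : ℝ) 1, ∀ p : ℂ × M, p.1 ∉ K →
    ∀ v : TangentSpace (prodModel E) p,
      horiz E p (J t p v) = h.pushI (orient α t) p.1 (horiz E p v)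

/-- The cobordism from which the chords at the puncture number `i` (that is, `z_{i+1}`) start:
`W_i` for an input, `W_{i+1}` for an output. Here `i + 1` is cyclic, so `W_{k+1} = W_0`. -/
def startOf {k : ℕ} (W : Fin (k + 1) → Set (ℂ × M)) (inputs : Finset (Fin (k + 1)))
    (i : Fin (k + 1)) : Set (ℂ × M) :=
  if i ∈ inputs then W i else W (i + 1)

/-- The cobordism at which the chords at the puncture number `i` end. -/
def endOf {k : ℕ} (W : Fin (k + 1) → Set (ℂ × M)) (inputs : Finset (Fin (k + 1)))
    (i : Fin (k + 1)) : Set (ℂ × M) :=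
  if i ∈ inputs then W (i + 1) else W i

/-- The smallest natural number `s` with `π(W_0 ∪ ⋯ ∪ W_k) ⊆ ℝ × (-s, s)`. -/
noncomputable def heightBound {k : ℕ} (W : Fin (k + 1) → Set (ℂ × M)) : ℕ :=
  sInf {s : ℕ | ∀ i, ∀ p ∈ W i, |p.1.im| < s}

variable (E M) in
/-- The data `(Θ, J)` on `𝒮` of a perturbation datum, with its compact set `K`: a family of
one-forms `Θ_r` on the fibres with values in functions on `ℂ × M` (`Θ c z p ξ` is the value at `p`
of the function `Θ_r(ξ)`, `ξ ∈ T_z 𝒮_r = ℂ`), and a family of almost complex structures. -/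
structure PerturbationPair (k : ℕ) where
  Θ : Config k → ℂ → ℂ × M → (ℂ →L[ℝ] ℝ)
  J (c : Config k) (z : ℂ) (p : ℂ × M) :
    TangentSpace (prodModel E) p →L[ℝ] TangentSpace (prodModel E) p
  K : Set ℂ

/-- The form `Y_r`: `Y_r(ξ)` is the Hamiltonian vector field of `Θ_r(ξ)`. -/
noncomputable def PerturbationPair.Y {k : ℕ} (D : PerturbationPair E M k) (Ω : SymplecticForm E M)
    (c : Config k) (z ξ : ℂ) (p : ℂ × M) : TangentSpace (prodModel E) p :=
  hamVF Ω (fun q => D.Θ c z q ξ) p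

/-- The form `Θ_0 = Θ - da ⊗ (h ∘ π)`. -/
noncomputable def PerturbationPair.Θ₀ {k : ℕ} (D : PerturbationPair E M k) (h : ProfileFunction)
    (a : Config k → ℂ → ℝ) (c : Config k) (z ξ : ℂ) (p : ℂ × M) : ℝ :=
  D.Θ c z p ξ - fderivWithin ℝ (a c) (fibre c) z ξ * h.h p.1

/-- `D` is a perturbation datum for the cobordisms `W`, the given inputs, the sign datum `α`, the
Floer data `F`, the strip-like ends `e` and the transition function `a`. -/
structure IsPerturbationDatum {k : ℕ} (𝒮 : DiscFamily k) (Ω : SymplecticForm E M)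
    (h : ProfileFunction) (W : Fin (k + 1) → Set (ℂ × M)) (inputs : Finset (Fin (k + 1)))
    (α : Fin (k + 1) → ℤˣ)
    (F : ∀ i, FloerDatum Ω h (startOf W inputs i) (endOf W inputs i) (α i))
    (e : Fin (k + 1) → Config k → ℂ → ℂ) (a : Config k → ℂ → ℝ)
    (D : PerturbationPair E M k) : Prop where
  smooth_Θ : ContMDiffOn (𝓘(ℝ, Config k × ℂ).prod (prodModel E)) 𝓘(ℝ, ℂ →L[ℝ] ℝ) ∞
    (fun q : (Config k × ℂ) × (ℂ × M) => D.Θ q.1.1 q.1.2 q.2) (𝒮.total ×ˢ univ)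
  smooth_J : ContMDiffOn (𝓘(ℝ, Config k × ℂ).prod (prodModel E).tangent) (prodModel E).tangent ∞
    (fun q : (Config k × ℂ) × TangentBundle (prodModel E) (ℂ × M) =>
      (⟨q.2.proj, D.J q.1.1 q.1.2 q.2.proj q.2.2⟩ : TangentBundle (prodModel E) (ℂ × M)))
    (𝒮.total ×ˢ univ)
  invariant_Θ : ∀ c ∈ 𝒮.configs, ∀ g ∈ 𝒮.symmetries, ∀ z ∈ fibre c, ∀ (p : ℂ × M) (ξ : ℂ),
    D.Θ (𝒮.act g c) (g z) p (deriv g z * ξ) = D.Θ c z p ξ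
  invariant_J : ∀ c ∈ 𝒮.configs, ∀ g ∈ 𝒮.symmetries, ∀ z ∈ fibre c, ∀ p : ℂ × M,
    D.J (𝒮.act g c) (g z) p = D.J c z p
  compatible : ∀ c ∈ 𝒮.configs, ∀ z ∈ fibre c, IsCompatibleACS Ω (D.J c z)
  asymptotic_Θ : ∀ c ∈ 𝒮.configs, ∀ i, ∀ w ∈ halfStrip (kappa inputs i),
    1 ≤ sgn (kappa inputs i) * w.re → ∀ (p : ℂ × M) (ξ : ℂ),
      D.Θ c (e i c w) p (derivWithin (e i c) (halfStrip (kappa inputs i)) w * ξ)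
        = (F i).H w.im p * ξ.im
  asymptotic_J : ∀ c ∈ 𝒮.configs, ∀ i, ∀ w ∈ halfStrip (kappa inputs i),
    1 ≤ sgn (kappa inputs i) * w.re → ∀ p : ℂ × M, D.J c (e i c w) p = (F i).J w.im p
  boundary : ∀ c ∈ 𝒮.configs, ∀ z ∈ fibre c, ‖z‖ = 1 →
    ∀ ξ : ℂ, (ξ * (starRingEnd ℂ) z).re = 0 → ∀ p : ℂ × M, D.Θ₀ h a c z ξ p = 0
  K_compact : IsCompact D.K
  K_subset : D.K ⊆ {z | z.re ∈ Ioo (-(3 / 2) : ℝ) (5 / 2)}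
  K_supset (i : Fin (k + 1)) : (F i).K ⊆ D.K
  K_box : {z : ℂ | z.re ∈ Icc (-(5 / 4) : ℝ) (9 / 4) ∧
    z.im ∈ Icc (-(heightBound W : ℝ)) (heightBound W)} ⊆ D.K
  vertical : ∀ c ∈ 𝒮.configs, ∀ z ∈ fibre c, ∀ (ξ : ℂ) (p : ℂ × M), p.1 ∉ D.K →
    horiz E p (hamVF Ω (D.Θ₀ h a c z ξ) p) = 0
  holomorphic : ∀ c ∈ 𝒮.configs, ∀ z ∈ fibre c, ∀ p : ℂ × M, p.1 ∉ D.K →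
    ∀ v : TangentSpace (prodModel E) p,
      horiz E p (D.J c z p v) = h.pushI (a c z) p.1 (horiz E p v)

/-- `u : 𝒮_r → ℂ × M` is a solution of the perturbed Cauchy–Riemann equation
`Du + J(u) ∘ Du ∘ j = Y + J(u) ∘ Y ∘ j` on the disc with configuration `c`, maps the boundary arc
`C_i` (from `z_i` clockwise to `z_{i+1}`) to `W_i`, and approaches a Hamiltonian chord at each
puncture, uniformly in `t ∈ [0,1]`. -/
structure IsSolution {k : ℕ} (Ω : SymplecticForm E M)
    (h : ProfileFunction) (W : Fin (k + 1) → Set (ℂ × M)) (inputs : Finset (Fin (k + 1)))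
    (α : Fin (k + 1) → ℤˣ)
    (F : ∀ i, FloerDatum Ω h (startOf W inputs i) (endOf W inputs i) (α i))
    (e : Fin (k + 1) → Config k → ℂ → ℂ) (D : PerturbationPair E M k)
    (c : Config k) (u : ℂ → ℂ × M) : Prop where
  smooth : ContMDiffOn 𝓘(ℝ, ℂ) (prodModel E) ∞ u (fibre c)
  equation : ∀ z ∈ fibre c, ∀ ξ : ℂ,
    (mfderivWithin 𝓘(ℝ, ℂ) (prodModel E) u (fibre c) z ξ : TangentSpace (prodModel E) (u z))
      + D.J c z (u z)
        (mfderivWithin 𝓘(ℝ, ℂ) (prodModel E) u (fibre c) z (Complex.I * ξ : ℂ))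
    = D.Y Ω c z ξ (u z) + D.J c z (u z) (D.Y Ω c z (Complex.I * ξ) (u z))
  boundary (i : Fin (k + 1)) : ∀ z ∈ clockwiseArc (c.1 (i - 1)) (c.1 i), u z ∈ W i
  asymptotic (i : Fin (k + 1)) :
    ∃ γ ∈ chords Ω (F i).H (startOf W inputs i) (endOf W inputs i), ∀ t₀ ∈ Icc (0 : ℝ) 1,
      Tendsto (fun q : ℝ × ℝ => u (e i c ⟨q.1, q.2⟩))
        (endFilter (kappa inputs i) ×ˢ 𝓝[Icc 0 1] t₀) (𝓝 (γ t₀))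

end Floer

end CobFloer

/-!
Let `u` be a solution on the disc with configuration `c`, and let `a` be the transition function. The
*straightened map* `v z = φ_{-a(z)}(π (u z))` (`straighten`) undoes the flow of the profile function.
Outside of `K` the horizontal part of the perturbation is `da ⊗ X^h`, so that the perturbed
Cauchy–Riemann equation for `u` says that `v` is holomorphic where its value is not in the region
`φ_{[-1,0]}(K)` (`IsSolution.differentiableAt_straighten`). The boundary values of `v` lie on the curves
`φ_{-s}(π W_i)`, `s ∈ [0,1]`, and the limits of `v` at the punctures lie in `φ_{[-1,0]}(K)` or on these
curves too, because a chord outside of the compact set of its Floer datum is a trajectory of `± X^h`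
(`chordLimit_eq_or`).

The image of `v`, completed by the limits at the punctures, is compact. By the open mapping theorem it
cannot meet a connected unbounded open set that is disjoint from `φ_{[-1,0]}(K)`, from the boundary
values and from the limits (`IsHolomorphicOff.notMem_of_unbounded`). This bounds the height of `v` at
once, by half-planes `|y| > R` (`IsHolomorphicOff.abs_im_le`).

For the bound in the horizontal direction, use the outward coordinate `X` at one of the bottlenecks
`x = -3/2`, `x = 5/2`. There the flow of `h` is vertical along the lines `y = j`, so the curves
`φ_{-s}(π W_i)` lie in the wedges `y = j + s F(X)`, `0 ≤ s ≤ 1`, where `F ≥ 0` is small for `X ≥ 0` and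
vanishes at `X = 0`: the wedges are pinched to points at the bottleneck. Between two wedges one can
escape to infinity, so `v` can cross the bottleneck only in the pinching points, and hence by openness
not at all: `v` maps the disc to `X ≤ 0` or the open disc to `X > 0`
(`IsHolomorphicOff.re_nonpos_or_re_pos`). In the second case `v` tends to a pinching point at every
puncture, because all limits in the region `X ≥ 0` are such. At an end with `α_i = κ_i`, turned into a
positive half-strip, the boundary values are `y = j` for `t = 0` and `y = j + F(X) ≥ j` for `t = 1`, and
Cauchy's theorem on rectangles shows that `∫₀¹ X dt` does not decrease along the end. So `X` cannot be
positive and tend to `0` (`exists_le_re_of_im_le`, `IsHolomorphicOff.re_nonpos`,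
`ProfileFunction.IsEnd.outward_nonpos`).

The flow preserves the strip `[-3/2, 5/2] × ℝ` and moves bounded sets by a bounded amount in unit time,
so that the bounds for `v` carry over to `π ∘ u`. Since Mathlib has no differentiability of flows in the
initial point, this is proved first, for complete flows of `C²` vector fields.
-/

namespace CobFloer

/-! ### Differentiability of complete flows -/

section Flow

variable {V : Type*} [NormedAddCommGroup V] [NormedSpace ℝ V]

/-- `φ` is the complete flow of the vector field `X`. -/
structure IsFlow (X : V → V) (φ : ℝ → V → V) : Prop where
  zero (z : V) : φ 0 z = z
  deriv (z : V) (t : ℝ) : HasDerivAt (fun τ => φ τ z) (X (φ t z)) t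

theorem integralCurve_eq {X : V → V} (hX : ContDiff ℝ 1 X) {f g : ℝ → V}
    (hf : ∀ t, HasDerivAt f (X (f t)) t) (hg : ∀ t, HasDerivAt g (X (g t)) t)
    (h0 : f 0 = g 0) : f = g := by
  have hfc : Continuous f := continuous_iff_continuousAt.2 fun t => (hf t).continuousAt
  have hgc : Continuous g := continuous_iff_continuousAt.2 fun t => (hg t).continuousAt
  have hcl : IsClopen {t | f t = g t} := by
    refine ⟨isClosed_eq hfc hgc, isOpen_iff_mem_nhds.2 fun t (ht : f t = g t) => ?_⟩
    obtain ⟨K, s, hs, hK⟩ := hX.locallyLipschitz (f t)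
    refine ODE_solution_unique_of_eventually (v := fun _ => X) (s := fun _ => s)
      (.of_forall fun _ => hK) ?_ ?_ ht
    · filter_upwards [hfc.continuousAt hs] with τ hτ using ⟨hf τ, hτ⟩
    · filter_upwards [hgc.continuousAt (ht ▸ hs)] with τ hτ using ⟨hg τ, hτ⟩
  have := hcl.eq_univ ⟨0, h0⟩
  exact funext fun t => this.ge (mem_univ t)

/-- Uniqueness of integral curves on a compact interval, with one-sided derivatives. -/
theorem integralCurve_eqOn {X : V → V} (hX : ContDiff ℝ 1 X) {f g : ℝ → V} {b : ℝ}
    (hf : ContinuousOn f (Icc 0 b)) (hf' : ∀ t ∈ Ico 0 b, HasDerivWithinAt f (X (f t)) (Ici t) t)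
    (hg : ContinuousOn g (Icc 0 b)) (hg' : ∀ t ∈ Ico 0 b, HasDerivWithinAt g (X (g t)) (Ici t) t)
    (h0 : f 0 = g 0) : EqOn f g (Icc 0 b) := by
  obtain ⟨K, hK⟩ := (hX.locallyLipschitz.locallyLipschitzOn
    (s := f '' Icc 0 b ∪ g '' Icc 0 b)).exists_lipschitzOnWith_of_compact
    ((isCompact_Icc.image_of_continuousOn hf).union (isCompact_Icc.image_of_continuousOn hg))
  exact ODE_solution_unique_of_mem_Icc_right (v := fun _ => X) (fun _ _ => hK) hf hf'
    (fun t ht => .inl ⟨t, Ico_subset_Icc_self ht, rfl⟩) hg hg'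
    (fun t ht => .inr ⟨t, Ico_subset_Icc_self ht, rfl⟩) h0

namespace IsFlow

variable {X : V → V} {φ : ℝ → V → V}

theorem continuous_time (hφ : IsFlow X φ) (z : V) : Continuous fun t => φ t z :=
  continuous_iff_continuousAt.2 fun t => (hφ.deriv z t).continuousAt

theorem add (hφ : IsFlow X φ) (hX : ContDiff ℝ 1 X) (s t : ℝ) (z : V) :
    φ (s + t) z = φ s (φ t z) := by
  have := integralCurve_eq hX (f := fun σ => φ (σ + t) z) (g := fun σ => φ σ (φ t z))
    (fun σ => (hφ.deriv z (σ + t)).comp_add_const σ t) (fun σ => hφ.deriv _ σ)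
    (by simp [hφ.zero])
  exact congrFun this s

theorem neg_cancel (hφ : IsFlow X φ) (hX : ContDiff ℝ 1 X) (t : ℝ) (z : V) :
    φ (-t) (φ t z) = z := by
  rw [← hφ.add hX, neg_add_cancel, hφ.zero]

theorem cancel_neg (hφ : IsFlow X φ) (hX : ContDiff ℝ 1 X) (t : ℝ) (z : V) :
    φ t (φ (-t) z) = z := by
  rw [← hφ.add hX, add_neg_cancel, hφ.zero]

theorem reverse (hφ : IsFlow X φ) : IsFlow (fun z => -X z) fun t => φ (-t) where
  zero z := by simp [hφ.zero]
  deriv z t := by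
    have h := (hφ.deriv z (-t)).scomp t (hasDerivAt_neg t)
    rw [neg_one_smul] at h
    exact h

theorem eq_self_of_eq_zero (hφ : IsFlow X φ) (hX : ContDiff ℝ 1 X) {z : V} (hz : X z = 0)
    (t : ℝ) : φ t z = z := by
  have := integralCurve_eq hX (f := fun σ => φ σ z) (g := fun _ => z)
    (fun σ => hφ.deriv _ σ) (fun σ => by simpa [hz] using hasDerivAt_const σ z) (hφ.zero z)
  exact congrFun this t

end IsFlow

/-- A `C²` map has a quadratic Taylor remainder, uniformly on balls. -/
theorem exists_norm_sub_sub_fderiv_le [ProperSpace V] {X : V → V} (hX : ContDiff ℝ 2 X) (R : ℝ) :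
    ∃ K : ℝ, 0 ≤ K ∧ ∀ x ∈ Metric.closedBall (0 : V) R, ∀ y ∈ Metric.closedBall (0 : V) R,
      ‖X y - X x - fderiv ℝ X x (y - x)‖ ≤ K * ‖y - x‖ ^ 2 := by
  have h1 : ContDiff ℝ 1 (fderiv ℝ X) := hX.fderiv_right (by norm_num)
  obtain ⟨K, hK⟩ := (h1.locallyLipschitz.locallyLipschitzOn
    (s := Metric.closedBall (0 : V) R)).exists_lipschitzOnWith_of_compact
      (isCompact_closedBall 0 R)
  refine ⟨K, K.2, fun x hx y hy => ?_⟩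
  have hseg : segment ℝ x y ⊆ Metric.closedBall (0 : V) R :=
    (convex_closedBall (0 : V) R).segment_subset hx hy
  have := (convex_segment (𝕜 := ℝ) x y).norm_image_sub_le_of_norm_hasFDerivWithin_le'
    (f := X) (φ := fderiv ℝ X x) (C := K * ‖y - x‖) (f' := fderiv ℝ X)
    (fun w _ => (hX.differentiable (by norm_num) w).hasFDerivAt.hasFDerivWithinAt) ?_
    (left_mem_segment ..) (right_mem_segment ..)
  · rw [pow_two, ← mul_assoc]; exact this
  · intro w hw
    refine (hK.norm_sub_le (hseg hw) hx).trans ?_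
    gcongr
    simpa using norm_sub_le_of_mem_segment hw

/-- For short positive times the flow near `p` is differentiable in the initial point. The
derivative solves the linearized equation; it is obtained from the Picard–Lindelöf theorem for the
vector field `(y, A) ↦ (X y, DX(y) ∘ A)`, and Grönwall's inequality bounds the error. -/
theorem IsFlow.exists_local [FiniteDimensional ℝ V] {X : V → V} {φ : ℝ → V → V}
    (hφ : IsFlow X φ) (hX : ContDiff ℝ 2 X) (p : V) :
    ∃ r > 0, ∃ ε > 0, ∃ L : ℝ, ∀ t ∈ Icc 0 ε, ∀ z ∈ Metric.ball p r,
      DifferentiableAt ℝ (φ t) z ∧ ‖φ t z - φ t p‖ ≤ L * ‖z - p‖ := by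
  have hX1 : ContDiff ℝ 1 X := hX.of_le (by norm_num)
  have : ProperSpace V := FiniteDimensional.proper_real V
  have hDX : ContDiff ℝ 1 (fderiv ℝ X) := hX.fderiv_right (by norm_num)
  -- The vector field of the linearized equation is `C¹` because `X` is `C²`.
  let Y : V × (V →L[ℝ] V) → V × (V →L[ℝ] V) := fun q => (X q.1, (fderiv ℝ X q.1).comp q.2)
  have hY : ContDiff ℝ 1 Y :=
    (hX1.comp contDiff_fst).prodMk ((hDX.comp contDiff_fst).clm_comp contDiff_snd)
  obtain ⟨ε, hε, a, r, L₀, K, hr, hpl⟩ := IsPicardLindelof.of_contDiffAt_one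
    (hY.contDiffAt (x := (p, ContinuousLinearMap.id ℝ V)))
  obtain ⟨β, hβ, L, hL⟩ :=
    (hpl 0).exists_forall_mem_closedBall_eq_hasDerivWithinAt_lipschitzOnWith
  simp only [zero_sub, zero_add] at hβ hL
  have hsub : Icc 0 ε ⊆ Icc (-ε) ε := Icc_subset_Icc_left (by linarith)
  have hmem : ∀ z ∈ Metric.closedBall p r, (z, ContinuousLinearMap.id ℝ V) ∈
      Metric.closedBall (p, ContinuousLinearMap.id ℝ V) (r : ℝ) := by
    intro z hz
    simpa [Prod.dist_eq] using hz
  have hβc : ∀ z ∈ Metric.closedBall p r, ContinuousOn (β (z, .id ℝ V)) (Icc 0 ε) :=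
    fun z hz t ht => ((hβ _ (hmem z hz)).2 t (hsub ht)).continuousWithinAt.mono hsub
  have hβd : ∀ z ∈ Metric.closedBall p r, ∀ t ∈ Ico 0 ε,
      HasDerivWithinAt (β (z, .id ℝ V)) (Y (β (z, .id ℝ V) t)) (Ici t) t := by
    intro z hz t ht
    refine ((hβ _ (hmem z hz)).2 t (hsub (Ico_subset_Icc_self ht))).mono_of_mem_nhdsWithin ?_
    exact mem_of_superset (Icc_mem_nhdsGE_of_mem ht) hsub
  have hflow : ∀ z ∈ Metric.closedBall p r, ∀ t ∈ Icc 0 ε, φ t z = (β (z, .id ℝ V) t).1 := by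
    intro z hz
    refine integralCurve_eqOn hX1 (hφ.continuous_time z).continuousOn
      (fun t _ => (hφ.deriv z t).hasDerivWithinAt) (continuous_fst.comp_continuousOn (hβc z hz))
      (fun t ht => ?_) ?_
    · exact (hβd z hz t ht).fst
    · simp [hφ.zero, (hβ _ (hmem z hz)).1]
  have hlip : ∀ t ∈ Icc 0 ε, ∀ z ∈ Metric.closedBall p r, ∀ z' ∈ Metric.closedBall p r,
      ‖φ t z - φ t z'‖ ≤ L * ‖z - z'‖ := by
    intro t ht z hz z' hz'
    have h := (hL t (hsub ht)).norm_sub_le (hmem z hz) (hmem z' hz')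
    rw [hflow z hz t ht, hflow z' hz' t ht]
    refine ((norm_fst_le _).trans h).trans ?_
    simp
  have hp : p ∈ Metric.closedBall p (r : ℝ) := by simp
  obtain ⟨R₀, hR₀⟩ := (isCompact_Icc (a := (0 : ℝ)) (b := ε)).exists_bound_of_continuousOn
    (hφ.continuous_time p).continuousOn
  let R := R₀ + L * r
  have hR : ∀ t ∈ Icc 0 ε, ∀ z ∈ Metric.closedBall p r, φ t z ∈ Metric.closedBall (0 : V) R := by
    intro t ht z hz
    rw [mem_closedBall_zero_iff]
    have h1 := hlip t ht z hz p hp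
    have h2 : L * ‖z - p‖ ≤ L * r := by
      gcongr
      simpa [dist_eq_norm] using hz
    have h3 := hR₀ t ht
    have h4 := norm_sub_norm_le (φ t z) (φ t p)
    simp only [R]; linarith
  obtain ⟨K₂, hK₂, hquad⟩ := exists_norm_sub_sub_fderiv_le hX R
  obtain ⟨M, hM⟩ := (isCompact_closedBall (0 : V) R).exists_bound_of_continuousOn
    (f := fderiv ℝ X) hDX.continuous.continuousOn
  refine ⟨r, hr, ε, hε, L, fun t ht z hz => ⟨?_, hlip t ht z (Metric.ball_subset_closedBall hz) p hp⟩⟩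
  have hz' := Metric.ball_subset_closedBall hz
  let A : ℝ → V →L[ℝ] V := fun t => (β (z, .id ℝ V) t).2
  have hA : ∀ t ∈ Ico 0 ε, HasDerivWithinAt A ((fderiv ℝ X (φ t z)).comp (A t)) (Ici t) t := by
    intro t ht
    rw [hflow z hz' t (Ico_subset_Icc_self ht)]
    exact (hβd z hz' t ht).snd
  have hA0 : A 0 = .id ℝ V := by simp [A, (hβ _ (hmem z hz')).1]
  have hAc : ContinuousOn A (Icc 0 ε) := continuous_snd.comp_continuousOn (hβc z hz')
  suffices h : HasFDerivAt (φ t) (A t) z from h.differentiableAt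
  -- The remainder `ρ` vanishes at time `0` and satisfies `‖ρ'‖ ≤ M' ‖ρ‖ + K₂ (L ‖ζ‖)²`. Adding `1`
  -- makes the constant `M'` positive, so that the Grönwall bound has its generic form.
  let M' := |M| + 1
  have hM' : 0 < M' := by positivity
  let C := K₂ * L ^ 2 / M' * (Real.exp (M' * t) - 1)
  have key : ∀ ζ : V, z + ζ ∈ Metric.ball p r → ‖φ t (z + ζ) - φ t z - A t ζ‖ ≤ C * ‖ζ‖ ^ 2 := by
    intro ζ hζ
    have hζ' := Metric.ball_subset_closedBall hζ
    have hG := norm_le_gronwallBound_of_norm_deriv_right_le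
      (f := fun t => φ t (z + ζ) - φ t z - A t ζ)
      (f' := fun t => X (φ t (z + ζ)) - X (φ t z) - (fderiv ℝ X (φ t z)).comp (A t) ζ)
      (δ := 0) (K := M') (ε := K₂ * (L * ‖ζ‖) ^ 2) (a := 0) (b := ε)
      (((hφ.continuous_time _).sub (hφ.continuous_time _)).continuousOn.sub
        (hAc.clm_apply continuousOn_const))
      (fun s hs => ((hφ.deriv _ s).hasDerivWithinAt.sub (hφ.deriv _ s).hasDerivWithinAt).sub
        (by simpa using (hA s hs).clm_apply (hasDerivWithinAt_const s _ ζ)))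
      (by simp [hφ.zero, hA0]) ?_ t ht
    · rw [gronwallBound_of_K_ne_0 hM'.ne'] at hG
      refine hG.trans_eq ?_
      simp only [C, sub_zero]; ring
    · intro s hs
      have hs' := Ico_subset_Icc_self hs
      have h1 := hquad _ (hR s hs' z hz') _ (hR s hs' (z + ζ) hζ')
      have h2 := hlip s hs' (z + ζ) hζ' z hz'
      rw [add_sub_cancel_left] at h2
      have h3 : ‖fderiv ℝ X (φ s z)‖ ≤ M' := (hM _ (hR s hs' z hz')).trans
        ((le_abs_self M).trans (by simp [M']))
      calc ‖X (φ s (z + ζ)) - X (φ s z) - (fderiv ℝ X (φ s z)).comp (A s) ζ‖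
          = ‖(X (φ s (z + ζ)) - X (φ s z) - fderiv ℝ X (φ s z) (φ s (z + ζ) - φ s z)) +
              fderiv ℝ X (φ s z) (φ s (z + ζ) - φ s z - A s ζ)‖ := by
            congr 1; simp only [map_sub, ContinuousLinearMap.comp_apply]; abel
        _ ≤ K₂ * ‖φ s (z + ζ) - φ s z‖ ^ 2 + M' * ‖φ s (z + ζ) - φ s z - A s ζ‖ :=
            (norm_add_le _ _).trans (add_le_add h1 ((ContinuousLinearMap.le_opNorm _ _).trans
              (by gcongr)))
        _ ≤ M' * ‖φ s (z + ζ) - φ s z - A s ζ‖ + K₂ * (L * ‖ζ‖) ^ 2 := by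
            rw [add_comm]; gcongr
  rw [hasFDerivAt_iff_isLittleO_nhds_zero]
  refine Asymptotics.IsBigO.trans_isLittleO (g := fun ζ : V => ‖ζ‖ ^ 2) ?_
    (Asymptotics.isLittleO_norm_pow_id one_lt_two)
  refine Asymptotics.IsBigO.of_bound C ?_
  have : ∀ᶠ ζ in 𝓝 (0 : V), z + ζ ∈ Metric.ball p r :=
    (continuous_const.add continuous_id).continuousAt.eventually_mem
      (by simpa using Metric.isOpen_ball.mem_nhds hz)
  filter_upwards [this] with ζ hζ
  simpa using key ζ hζ

namespace IsFlow

variable [FiniteDimensional ℝ V] {X : V → V} {φ : ℝ → V → V}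

theorem exists_local_abs (hφ : IsFlow X φ) (hX : ContDiff ℝ 2 X) (p : V) :
    ∃ r > 0, ∃ ε > 0, ∃ L : ℝ, ∀ t ∈ Icc (-ε) ε, ∀ z ∈ Metric.ball p r,
      DifferentiableAt ℝ (φ t) z ∧ ‖φ t z - φ t p‖ ≤ L * ‖z - p‖ := by
  obtain ⟨r, hr, ε, hε, L, h⟩ := hφ.exists_local hX p
  obtain ⟨r', hr', ε', hε', L', h'⟩ := hφ.reverse.exists_local hX.neg p
  refine ⟨min r r', lt_min hr hr', min ε ε', lt_min hε hε', max L L', fun t ht z hz => ?_⟩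
  have hz1 := Metric.ball_subset_ball (min_le_left r r') hz
  have hz2 := Metric.ball_subset_ball (min_le_right r r') hz
  rcases le_total 0 t with h0 | h0
  · obtain ⟨h1, h2⟩ := h t ⟨h0, ht.2.trans (min_le_left ..)⟩ z hz1
    exact ⟨h1, h2.trans (by gcongr; exact le_max_left ..)⟩
  · have ht' : -t ∈ Icc 0 ε' := ⟨by linarith, by linarith [ht.1, min_le_right ε ε']⟩
    obtain ⟨h1, h2⟩ := h' (-t) ht' z hz2
    simp only [neg_neg] at h1 h2
    exact ⟨h1, h2.trans (by gcongr; exact le_max_right ..)⟩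

theorem differentiable (hφ : IsFlow X φ) (hX : ContDiff ℝ 2 X) (t : ℝ) :
    Differentiable ℝ (φ t) := by
  have hX1 : ContDiff ℝ 1 X := hX.of_le (by norm_num)
  intro z
  -- Near each time `s`, differentiability of `φ s'` at `z` is equivalent to that of `φ s`.
  have := PreconnectedSpace.induction₂' (α := ℝ)
    (fun s s' => DifferentiableAt ℝ (φ s) z → DifferentiableAt ℝ (φ s') z)
    (fun s => ?_) ⟨fun a b c hab hbc h => hbc (hab h)⟩ 0 t
  · refine this ?_
    have : φ 0 = id := funext hφ.zero
    rw [this]; exact differentiableAt_id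
  · obtain ⟨r, hr, ε, hε, L, h⟩ := hφ.exists_local_abs hX (φ s z)
    have h1 : ∀ᶠ s' in 𝓝 s, s' ∈ Icc (s - ε) (s + ε) :=
      Icc_mem_nhds (by linarith) (by linarith)
    have h2 : ∀ᶠ s' in 𝓝 s, φ s' z ∈ Metric.ball (φ s z) r :=
      (hφ.continuous_time z).continuousAt (Metric.ball_mem_nhds _ hr)
    filter_upwards [h1, h2] with s' h1 h2
    constructor
    · intro hd
      have : φ s' = φ (s' - s) ∘ φ s := by
        funext w; simp [← hφ.add hX1]
      rw [this]
      exact (h _ ⟨by linarith [h1.1], by linarith [h1.2]⟩ _ (Metric.mem_ball_self hr)).1.comp z hd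
    · intro hd
      have : φ s = φ (s - s') ∘ φ s' := by
        funext w; simp [← hφ.add hX1]
      rw [this]
      exact (h _ ⟨by linarith [h1.2], by linarith [h1.1]⟩ _ h2).1.comp z hd

theorem continuous_uncurry (hφ : IsFlow X φ) (hX : ContDiff ℝ 2 X) :
    Continuous fun q : ℝ × V => φ q.1 q.2 := by
  have hX1 : ContDiff ℝ 1 X := hX.of_le (by norm_num)
  have h0 : ∀ p, ContinuousAt (fun q : ℝ × V => φ q.1 q.2) (0, p) := by
    intro p
    obtain ⟨r, hr, ε, hε, L, h⟩ := hφ.exists_local_abs hX p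
    rw [ContinuousAt, tendsto_iff_norm_sub_tendsto_zero]
    have h1 : Tendsto (fun q : ℝ × V => L * ‖q.2 - p‖ + ‖φ q.1 p - φ 0 p‖) (𝓝 (0, p)) (𝓝 0) := by
      have : Continuous fun q : ℝ × V => L * ‖q.2 - p‖ + ‖φ q.1 p - φ 0 p‖ := by
        have := (hφ.continuous_time p).comp (continuous_fst (X := ℝ) (Y := V))
        exact (continuous_const.mul (continuous_snd.sub continuous_const).norm).add
          (this.sub continuous_const).norm
      simpa using this.tendsto (0, p)
    refine squeeze_zero' (.of_forall fun _ => norm_nonneg _) ?_ h1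
    have : Icc (-ε) ε ×ˢ Metric.ball p r ∈ 𝓝 ((0 : ℝ), p) :=
      prod_mem_nhds (Icc_mem_nhds (by linarith) hε) (Metric.ball_mem_nhds p hr)
    filter_upwards [this] with q hq
    refine (norm_sub_le_norm_sub_add_norm_sub _ (φ q.1 p) _).trans ?_
    gcongr
    exact (h q.1 hq.1 q.2 hq.2).2
  refine continuous_iff_continuousAt.2 fun ⟨t, z⟩ => ?_
  have heq : (fun q : ℝ × V => φ q.1 q.2) =
      (fun q : ℝ × V => φ q.1 q.2) ∘ fun q : ℝ × V => (q.1 - t, φ t q.2) := by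
    funext q; simp [← hφ.add hX1]
  rw [heq]
  refine ContinuousAt.comp ?_ ?_
  · simpa using h0 (φ t z)
  · exact (continuousAt_fst.sub continuousAt_const).prodMk
      (((hφ.differentiable hX t).continuous.continuousAt).comp continuousAt_snd)

/-- The flow preserves its vector field. -/
theorem fderiv_apply_field (hφ : IsFlow X φ) (hX : ContDiff ℝ 2 X) (t : ℝ) (z : V) :
    fderiv ℝ (φ t) z (X z) = X (φ t z) := by
  have hX1 : ContDiff ℝ 1 X := hX.of_le (by norm_num)
  have h1 : HasDerivAt (fun s => φ t (φ s z)) (fderiv ℝ (φ t) z (X z)) 0 := by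
    have hd := (hφ.differentiable hX t (φ 0 z)).hasFDerivAt
    have := hd.comp_hasDerivAt (0 : ℝ) (hφ.deriv z 0)
    simpa [hφ.zero, Function.comp_def] using this
  have h2 : HasDerivAt (fun s => φ t (φ s z)) (X (φ t z)) 0 := by
    have := hφ.deriv (φ t z) 0
    rw [hφ.zero] at this
    refine this.congr_of_eventuallyEq (.of_forall fun s => ?_)
    simp only [← hφ.add hX1, add_comm]
  exact h1.unique h2

/-- The derivative of the flow in time and space. -/
theorem hasFDerivAt_uncurry (hφ : IsFlow X φ) (hX : ContDiff ℝ 2 X) (t : ℝ) (z : V) :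
    HasFDerivAt (fun q : ℝ × V => φ q.1 q.2)
      ((fderiv ℝ (φ t) z).comp (ContinuousLinearMap.snd ℝ ℝ V) +
        (ContinuousLinearMap.fst ℝ ℝ V).smulRight (X (φ t z))) (t, z) := by
  have hX1 : ContDiff ℝ 1 X := hX.of_le (by norm_num)
  have h0 : ∀ p, HasFDerivAt (fun q : ℝ × V => φ q.1 q.2 - q.2)
      ((ContinuousLinearMap.fst ℝ ℝ V).smulRight (X p)) (0, p) := by
    intro p
    rw [hasFDerivAt_iff_isLittleO, Asymptotics.isLittleO_iff]
    intro c hc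
    have hcont : ContinuousAt (fun q : ℝ × V => X (φ q.1 q.2)) (0, p) :=
      (hX.continuous.comp (hφ.continuous_uncurry hX)).continuousAt
    have hnb : ∀ᶠ q in 𝓝 ((0 : ℝ), p), ‖X (φ q.1 q.2) - X p‖ < c := by
      have := Metric.tendsto_nhds.1 hcont c hc
      simpa [dist_eq_norm, hφ.zero] using this
    obtain ⟨δ, hδ, hball⟩ := Metric.eventually_nhds_iff_ball.1 hnb
    filter_upwards [Metric.ball_mem_nhds ((0 : ℝ), p) hδ] with q hq
    obtain ⟨τ, ζ⟩ := q
    simp only [Metric.mem_ball, Prod.dist_eq, max_lt_iff] at hq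
    have hseg : ∀ s ∈ segment ℝ (0 : ℝ) τ, ‖X (φ s ζ) - X p‖ ≤ c := by
      intro s hs
      refine (hball (s, ζ) ?_).le
      simp only [Metric.mem_ball, Prod.dist_eq, max_lt_iff]
      refine ⟨?_, hq.2⟩
      have := norm_sub_le_of_mem_segment hs
      rw [dist_eq_norm]
      refine lt_of_le_of_lt this ?_
      simpa [dist_eq_norm] using hq.1
    have hmv := (convex_segment (𝕜 := ℝ) (0 : ℝ) τ).norm_image_sub_le_of_norm_hasDerivWithin_le
      (f := fun s => φ s ζ - s • X p) (f' := fun s => X (φ s ζ) - X p) (C := c)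
      (fun s _ => by
        have h := ((hφ.deriv ζ s).sub ((hasDerivAt_id s).smul_const (X p))).hasDerivWithinAt
          (s := segment ℝ (0 : ℝ) τ)
        rw [one_smul] at h
        exact h)
      hseg (left_mem_segment ..) (right_mem_segment ..)
    simp only [hφ.zero, zero_smul, sub_zero] at hmv
    calc _ = ‖φ τ ζ - τ • X p - ζ‖ := by
          congr 1
          simp [hφ.zero]; abel
      _ ≤ c * ‖τ‖ := hmv
      _ ≤ c * ‖(τ, ζ) - ((0 : ℝ), p)‖ := by
          gcongr
          simp
  have hd0 : HasFDerivAt (fun q : ℝ × V => φ q.1 q.2)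
      ((ContinuousLinearMap.fst ℝ ℝ V).smulRight (X (φ t z)) + ContinuousLinearMap.snd ℝ ℝ V)
      (0, φ t z) := by
    refine ((h0 (φ t z)).add (hasFDerivAt_snd (p := ((0 : ℝ), φ t z)))).congr_of_eventuallyEq
      (.of_forall fun q => ?_)
    simp
  have hin : HasFDerivAt (fun q : ℝ × V => (q.1 - t, φ t q.2))
      ((ContinuousLinearMap.fst ℝ ℝ V).prod
        ((fderiv ℝ (φ t) z).comp (ContinuousLinearMap.snd ℝ ℝ V))) (t, z) := by
    refine HasFDerivAt.prodMk ?_ ?_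
    · exact hasFDerivAt_fst.sub_const t
    · exact ((hφ.differentiable hX t z).hasFDerivAt).comp (t, z) hasFDerivAt_snd
  have heq : (fun q : ℝ × V => φ q.1 q.2) =
      (fun q : ℝ × V => φ q.1 q.2) ∘ fun q : ℝ × V => (q.1 - t, φ t q.2) := by
    funext q; simp [← hφ.add hX1]
  rw [heq]
  have hd0' : HasFDerivAt (fun q : ℝ × V => φ q.1 q.2)
      ((ContinuousLinearMap.fst ℝ ℝ V).smulRight (X (φ t z)) + ContinuousLinearMap.snd ℝ ℝ V)
      ((fun q : ℝ × V => (q.1 - t, φ t q.2)) (t, z)) := by simpa using hd0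
  refine (hd0'.comp (t, z) hin).congr_fderiv (ContinuousLinearMap.ext fun q => ?_)
  simp [add_comm]

/-- Pulling a curve or map `x` back by the flow for the varying time `τ` subtracts `dτ ⊗ X`. -/
theorem hasFDerivWithinAt_pullback {W : Type*} [NormedAddCommGroup W] [NormedSpace ℝ W]
    (hφ : IsFlow X φ) (hX : ContDiff ℝ 2 X) {x : W → V} {τ : W → ℝ} {x' : W →L[ℝ] V}
    {τ' : W →L[ℝ] ℝ} {s : Set W} {q : W} (hx : HasFDerivWithinAt x x' s q)
    (hτ : HasFDerivWithinAt τ τ' s q) :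
    HasFDerivWithinAt (fun y => φ (-(τ y)) (x y))
      ((fderiv ℝ (φ (-(τ q))) (x q)).comp (x' - τ'.smulRight (X (x q)))) s q := by
  have h := (hφ.hasFDerivAt_uncurry hX (-(τ q)) (x q)).comp_hasFDerivWithinAt q
    (hτ.neg.prodMk hx)
  refine HasFDerivWithinAt.congr_fderiv (f := fun y => φ (-(τ y)) (x y)) h
    (ContinuousLinearMap.ext fun w => ?_)
  simp [hφ.fderiv_apply_field hX, sub_eq_add_neg]

/-- The differential of `φ_t` at `φ_{-t}(w)` inverts that of `φ_{-t}` at `w`. -/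
theorem fderiv_neg_fderiv (hφ : IsFlow X φ) (hX : ContDiff ℝ 2 X) (t : ℝ) (w ζ : V) :
    fderiv ℝ (φ (-t)) w (fderiv ℝ (φ t) (φ (-t) w) ζ) = ζ := by
  have hX1 : ContDiff ℝ 1 X := hX.of_le (by norm_num)
  have h1 := (hφ.differentiable hX (-t) (φ t (φ (-t) w))).hasFDerivAt.comp (φ (-t) w)
    (hφ.differentiable hX t (φ (-t) w)).hasFDerivAt
  have h2 : φ (-t) ∘ φ t = id := funext fun z => hφ.neg_cancel hX1 t z
  rw [h2, hφ.cancel_neg hX1] at h1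
  have := h1.unique (hasFDerivAt_id _)
  exact DFunLike.congr_fun this ζ

end IsFlow

end Flow

/-! ### Holomorphic maps on punctured discs -/

section Disc

variable {k : ℕ} {c : Config k}

theorem convex_reProdIm {s t : Set ℝ} (hs : Convex ℝ s) (ht : Convex ℝ t) : Convex ℝ (s ×ℂ t) :=
  (hs.linear_preimage Complex.reLm).inter (ht.linear_preimage Complex.imLm)

theorem ball_subset_fibre (hc : ∀ i, ‖c.1 i‖ = 1) : Metric.ball (0 : ℂ) 1 ⊆ fibre c := by
  intro z hz
  rw [mem_ball_zero_iff] at hz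
  exact ⟨hz.le, fun i h => by rw [h, hc i] at hz; exact lt_irrefl _ hz⟩

theorem fibre_subset_closure_ball : fibre c ⊆ closure (Metric.ball (0 : ℂ) 1) := by
  intro z hz
  rw [closure_ball _ one_ne_zero, mem_closedBall_zero_iff]
  exact hz.1

theorem exists_mem_fibre_norm_eq_one : ∃ z ∈ fibre c, ‖z‖ = 1 := by
  have hinf : (Metric.sphere (0 : ℂ) 1).Infinite :=
    (isPreconnected_sphere (by rw [Complex.rank_real_complex]; norm_num) _ _).infinite_of_nontrivial
      ⟨1, by simp, -1, by simp, by norm_num⟩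
  obtain ⟨z, hz, hz'⟩ := (hinf.sdiff (finite_range c.1)).nonempty
  have h1 : ‖z‖ = 1 := by simpa using hz
  exact ⟨z, ⟨h1.le, fun i h => hz' ⟨i, h.symm⟩⟩, h1⟩

/-- A continuous map `v` on the punctured disc `fibre c` that approaches the compact set `Λ i` at the
puncture number `i` and is holomorphic at the interior points that it maps to the complement of the
closed set `B`. -/
structure IsHolomorphicOff (c : Config k) (v : ℂ → ℂ) (B : Set ℂ) (Λ : Fin (k + 1) → Set ℂ) :
    Prop where
  norm_puncture (i : Fin (k + 1)) : ‖c.1 i‖ = 1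
  continuousOn : ContinuousOn v (fibre c)
  isClosed : IsClosed B
  differentiableAt (z : ℂ) : ‖z‖ < 1 → v z ∉ B → DifferentiableAt ℂ v z
  isCompact (i : Fin (k + 1)) : IsCompact (Λ i)
  tendsto (i : Fin (k + 1)) : Tendsto v (𝓝[fibre c] (c.1 i)) (𝓝ˢ (Λ i))

namespace IsHolomorphicOff

variable {v : ℂ → ℂ} {B : Set ℂ} {Λ : Fin (k + 1) → Set ℂ}

theorem isCompact_image_union (hv : IsHolomorphicOff c v B Λ) :
    IsCompact (v '' fibre c ∪ ⋃ i, Λ i) := by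
  rw [isCompact_iff_ultrafilter_le_nhds]
  intro f hf
  rw [le_principal_iff, Ultrafilter.mem_coe, Ultrafilter.union_mem_iff] at hf
  rcases hf with hf | hf
  -- An ultrafilter on the image of `v` comes from one on the punctured disc, which converges either
  -- to a point of the punctured disc or to a puncture.
  · set g := Ultrafilter.ofComapInfPrincipal hf
    have hg : fibre c ∈ g := Ultrafilter.ofComapInfPrincipal_mem hf
    have hgf : g.map v = f := Ultrafilter.ofComapInfPrincipal_eq_of_map hf
    have hgf' : Filter.map v g = f := by rw [← hgf]; rfl
    obtain ⟨z, hz, hgz⟩ := (isCompact_closedBall (0 : ℂ) 1).ultrafilter_le_nhds g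
      (le_principal_iff.2 (mem_of_superset hg fun z hz => mem_closedBall_zero_iff.2 hz.1))
    have hgz' : (g : Filter ℂ) ≤ 𝓝[fibre c] z := le_inf hgz (le_principal_iff.2 hg)
    by_cases hzS : z ∈ fibre c
    · refine ⟨v z, .inl ⟨z, hzS, rfl⟩, ?_⟩
      rw [← hgf']
      exact (hv.continuousOn z hzS).mono_left hgz'
    · have : ∃ i, z = c.1 i := by
        by_contra! h
        exact hzS ⟨mem_closedBall_zero_iff.1 hz, h⟩
      obtain ⟨i, rfl⟩ := this
      have hle : (f : Filter ℂ) ≤ 𝓝ˢ (Λ i) := by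
        rw [← hgf']; exact (hv.tendsto i).mono_left hgz'
      have hnd : ¬ Disjoint (𝓝ˢ (Λ i)) (f : Filter ℂ) := fun h => by
        have := h.mono_left hle
        rw [disjoint_self] at this
        exact f.neBot.ne this
      rw [(hv.isCompact i).disjoint_nhdsSet_left] at hnd
      push Not at hnd
      obtain ⟨x, hx, hxf⟩ := hnd
      refine ⟨x, .inr (mem_iUnion.2 ⟨i, hx⟩), ?_⟩
      exact Ultrafilter.le_of_inf_neBot' f (neBot_iff.2 fun h => hxf (disjoint_iff.2 h))
  · obtain ⟨x, hx, h⟩ := (isCompact_iUnion hv.isCompact).ultrafilter_le_nhds f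
      (le_principal_iff.2 hf)
    exact ⟨x, .inr hx, h⟩

theorem continuousAt (hv : IsHolomorphicOff c v B Λ) {z : ℂ} (hz : ‖z‖ < 1) :
    ContinuousAt v z :=
  hv.continuousOn.continuousAt (mem_of_superset
    (Metric.isOpen_ball.mem_nhds (mem_ball_zero_iff.2 hz)) (ball_subset_fibre hv.norm_puncture))

theorem analyticAt (hv : IsHolomorphicOff c v B Λ) {z : ℂ} (hz : ‖z‖ < 1) (hB : v z ∉ B) :
    AnalyticAt ℂ v z := by
  rw [Complex.analyticAt_iff_eventually_differentiableAt]
  filter_upwards [Metric.isOpen_ball.mem_nhds (mem_ball_zero_iff.2 hz),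
    (hv.continuousAt hz).eventually_mem (hv.isClosed.isOpen_compl.mem_nhds hB)] with w h1 h2
  exact hv.differentiableAt w (mem_ball_zero_iff.1 h1) h2

theorem mem_closure_image (hv : IsHolomorphicOff c v B Λ) {z : ℂ} (hz : z ∈ fibre c) :
    v z ∈ closure (v '' Metric.ball 0 1) :=
  ((hv.continuousOn z hz).mono (ball_subset_fibre hv.norm_puncture)).mem_closure_image
    (fibre_subset_closure_ball hz)

/-- Identity theorem. The set where `v` is locally equal to the constant `v z₀` is closed in the open
disc, since by continuity a limit point of it is mapped to `v z₀ ∉ B`, so that `v` is analytic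
there. -/
theorem eq_of_eventually_eq (hv : IsHolomorphicOff c v B Λ) {z₀ : ℂ} (h0 : ‖z₀‖ < 1)
    (hB : v z₀ ∉ B) (hconst : ∀ᶠ z in 𝓝 z₀, v z = v z₀) : ∀ z ∈ fibre c, v z = v z₀ := by
  have hsub : Metric.ball (0 : ℂ) 1 ⊆ {z | ∀ᶠ z' in 𝓝 z, v z' = v z₀} := by
    refine (convex_ball (0 : ℂ) 1).isPreconnected.subset_of_closure_inter_subset
      (isOpen_setOfPred_eventually_nhds) ⟨z₀, mem_ball_zero_iff.2 h0, hconst⟩ ?_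
    rintro z ⟨hz, hzb⟩
    by_contra hzu
    have hzb' := mem_ball_zero_iff.1 hzb
    have hfr : ∃ᶠ z' in 𝓝[≠] z, v z' = v z₀ := by
      have h1 : ∃ᶠ z' in 𝓝 z, z' ∈ {z | ∀ᶠ z' in 𝓝 z, v z' = v z₀} :=
        mem_closure_iff_frequently.1 hz
      rw [frequently_nhdsWithin_iff]
      refine h1.mono fun z' hz' => ⟨Eventually.self_of_nhds (p := fun y => v y = v z₀) hz', ?_⟩
      rintro rfl
      exact hzu hz'
    have hvz : v z = v z₀ := by
      by_contra hne
      have : ∀ᶠ z' in 𝓝 z, v z' ≠ v z₀ := (hv.continuousAt hzb').eventually_ne hne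
      exact (hfr.and_eventually (nhdsWithin_le_nhds this)).exists.elim fun w hw => hw.2 hw.1
    exact hzu (((hv.analyticAt hzb' (hvz ▸ hB)).frequently_eq_iff_eventually_eq
      analyticAt_const).1 hfr)
  intro z hz
  have := hv.mem_closure_image hz
  have himg : v '' Metric.ball 0 1 ⊆ {v z₀} := by
    rintro _ ⟨w, hw, rfl⟩
    exact Eventually.self_of_nhds (p := fun y => v y = v z₀) (hsub hw)
  simpa using closure_mono himg this

/-- By the open mapping theorem the image of `v` cannot meet a connected unbounded open set which
contains no boundary values, no limits at punctures, and over which `v` is holomorphic: otherwise it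
would contain this set. -/
theorem notMem_of_unbounded (hv : IsHolomorphicOff c v B Λ) {G : Set ℂ} (hG : IsOpen G)
    (hGc : IsPreconnected G) (hGu : ¬ Bornology.IsBounded G) (hGB : Disjoint G B)
    (hbd : ∀ z ∈ fibre c, ‖z‖ = 1 → v z ∉ G) (hΛ : ∀ i, Disjoint G (Λ i)) :
    ∀ z ∈ fibre c, v z ∉ G := by
  intro z₁ hz₁ hmem
  have hcomp := hv.isCompact_image_union
  have hbs := ball_subset_fibre hv.norm_puncture
  -- `G` is connected, and its intersection with the image of the open disc is open by the open mapping
  -- theorem and relatively closed, since all limit values other than those inside lie outside of `G`.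
  have hopen : IsOpen (G ∩ v '' Metric.ball 0 1) := by
    rw [isOpen_iff_mem_nhds]
    rintro _ ⟨hpG, z, hz, rfl⟩
    have hz' := mem_ball_zero_iff.1 hz
    have hB := disjoint_left.1 hGB hpG
    refine inter_mem (hG.mem_nhds hpG) ?_
    rcases (hv.analyticAt hz' hB).eventually_constant_or_nhds_le_map_nhds with h | h
    · exfalso
      obtain ⟨w, hw, hw1⟩ := exists_mem_fibre_norm_eq_one (c := c)
      exact hbd w hw hw1 (by rwa [hv.eq_of_eventually_eq hz' hB h w hw])
    · exact h (image_mem_map (Metric.isOpen_ball.mem_nhds hz))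
  have hsub : G ⊆ G ∩ v '' Metric.ball 0 1 := by
    refine hGc.subset_of_closure_inter_subset hopen ?_ ?_
    · obtain ⟨w, hw⟩ := mem_closure_iff.1 (hv.mem_closure_image hz₁) G hG hmem
      exact ⟨w, hw.1, hw⟩
    · rintro p ⟨hp, hpG⟩
      have hp' : p ∈ v '' fibre c ∪ ⋃ i, Λ i :=
        closure_minimal (fun q hq => .inl (image_mono hbs hq.2)) hcomp.isClosed hp
      rcases hp' with ⟨z, hz, rfl⟩ | hp'
      · refine ⟨hpG, z, ?_, rfl⟩
        rw [mem_ball_zero_iff]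
        exact lt_of_le_of_ne hz.1 fun h => hbd z hz h hpG
      · obtain ⟨i, hi⟩ := mem_iUnion.1 hp'
        exact (disjoint_left.1 (hΛ i) hpG hi).elim
  exact hGu (hcomp.isBounded.subset fun p hp => .inl (image_mono hbs (hsub hp).2))

end IsHolomorphicOff

/-- The union of thin wedges around the horizontal lines at integer heights that are bounded by these
lines and by the graphs of `x ↦ j + F x`. -/
def wedges (F : ℝ → ℝ) : Set ℂ :=
  {p | ∃ j : ℤ, ∃ s ∈ Icc (0 : ℝ) 1, p.im = j + s * F p.re}

/-- The wedges are pinched to points over `x = 0`, where `F` vanishes. The complement of the wedges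
reaches infinity on the side `x > 0`, so that `v` can meet `x = 0` only in the pinching points, and by
the open mapping theorem only at boundary points or if `v` is constant. -/
theorem IsHolomorphicOff.re_nonpos_or_re_pos {v : ℂ → ℂ} {B : Set ℂ} {Λ : Fin (k + 1) → Set ℂ}
    (hv : IsHolomorphicOff c v B Λ) {F : ℝ → ℝ} {η : ℝ} (hη : 0 < η) (hF : ContinuousAt F 0)
    (hF0 : F 0 = 0) (hF1 : ∀ x > -η, |F x| ≤ 1 / 8) (hB : ∀ p ∈ B, p.re ≤ -η)
    (hbd : ∀ z ∈ fibre c, ‖z‖ = 1 → -η < (v z).re → v z ∈ wedges F)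
    (hΛ : ∀ i, ∀ p ∈ Λ i, -η < p.re → p ∈ wedges F) :
    (∀ z ∈ fibre c, (v z).re ≤ 0) ∨ ∀ z, ‖z‖ < 1 → 0 < (v z).re := by
  have hbs := ball_subset_fibre hv.norm_puncture
  have step : ∀ z ∈ fibre c, (v z).re = 0 → ∃ j : ℤ, (v z).im = j := by
    intro z hz hre
    by_contra! hne
    set y := (v z).im
    set j := ⌊y⌋
    have hj1 : (j : ℝ) < y := lt_of_le_of_ne (Int.floor_le y) (hne j).symm
    have hj2 : y < j + 1 := Int.lt_floor_add_one y
    obtain ⟨δ, hδ0, hδ⟩ : ∃ δ > 0, δ < min (1 / 8) (min (y - j) (j + 1 - y)) :=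
      exists_between (by simp only [lt_min_iff]; exact ⟨by norm_num, by linarith, by linarith⟩)
    simp only [lt_min_iff] at hδ
    obtain ⟨δ₀, hδ₀, hFδ⟩ := Metric.continuousAt_iff.1 hF δ hδ0
    simp only [Real.dist_eq, sub_zero, hF0] at hFδ
    set m := min δ₀ η
    have hm : 0 < m := lt_min hδ₀ hη
    -- A rectangle `A` around the point avoids the wedges, which are thin near `x = 0`, and overlaps with
    -- the half-infinite strip `A'` between two wedges.
    let A : Set ℂ := Ioo (-m) m ×ℂ Ioo (j + δ) (j + 1 - δ)
    let A' : Set ℂ := Ioi (-m) ×ℂ Ioo ((j : ℝ) + 1 / 4) (j + 3 / 4)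
    have hA : IsPreconnected A := (convex_reProdIm (convex_Ioo _ _) (convex_Ioo _ _)).isPreconnected
    have hA' : IsPreconnected A' := (convex_reProdIm (convex_Ioi _) (convex_Ioo _ _)).isPreconnected
    have hmA : (⟨0, j + 1 / 2⟩ : ℂ) ∈ A :=
      ⟨⟨by simpa using hm, hm⟩, by constructor <;> simp only <;> linarith [hδ.1]⟩
    have hmA' : ∀ n : ℕ, (⟨n, j + 1 / 2⟩ : ℂ) ∈ A' := fun n =>
      ⟨show -m < (n : ℝ) by have : (0 : ℝ) ≤ n := n.cast_nonneg; linarith,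
        by constructor <;> simp only <;> linarith⟩
    have hdisj : ∀ p ∈ wedges F, p ∉ A ∪ A' := by
      rintro p ⟨j', s, hs, hp⟩ (⟨h1, h2⟩ | ⟨h1, h2⟩)
      · have h1' : -m < p.re ∧ p.re < m := h1
        have h2' : j + δ < p.im ∧ p.im < j + 1 - δ := h2
        have hlt : |F p.re| < δ := hFδ (by
          rw [abs_lt]; constructor <;> linarith [h1'.1, h1'.2, min_le_left δ₀ η])
        have hs' : |s * F p.re| < δ := by
          rw [abs_mul, abs_of_nonneg hs.1]
          exact lt_of_le_of_lt (mul_le_of_le_one_left (abs_nonneg _) hs.2) hlt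
        rw [abs_lt] at hs'
        have h3 : (j : ℝ) < j' := by linarith [h2'.1, hs'.2]
        have h4 : (j' : ℝ) < (j + 1 : ℤ) := by push_cast; linarith [h2'.2, hs'.1]
        have h3' : j < j' := by exact_mod_cast h3
        have h4' : j' < j + 1 := by exact_mod_cast h4
        omega
      · have h1' : -m < p.re := h1
        have h2' : (j : ℝ) + 1 / 4 < p.im ∧ p.im < j + 3 / 4 := h2
        have hlt : |F p.re| ≤ 1 / 8 := hF1 _ (by linarith [min_le_right δ₀ η])
        have hs' : |s * F p.re| ≤ 1 / 8 := by
          rw [abs_mul, abs_of_nonneg hs.1]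
          exact (mul_le_of_le_one_left (abs_nonneg _) hs.2).trans hlt
        rw [abs_le] at hs'
        have h3 : (j : ℝ) < j' := by linarith [h2'.1, hs'.2]
        have h4 : (j' : ℝ) < (j + 1 : ℤ) := by push_cast; linarith [h2'.2, hs'.1]
        have h3' : j < j' := by exact_mod_cast h3
        have h4' : j' < j + 1 := by exact_mod_cast h4
        omega
    have hre' : ∀ p ∈ A ∪ A', -η < p.re := by
      rintro p (⟨h1, -⟩ | ⟨h1, -⟩)
      · have h1' : -m < p.re := h1.1
        linarith [min_le_right δ₀ η]
      · have h1' : -m < p.re := h1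
        linarith [min_le_right δ₀ η]
    refine hv.notMem_of_unbounded (G := A ∪ A')
      ((isOpen_Ioo.reProdIm isOpen_Ioo).union (isOpen_Ioi.reProdIm isOpen_Ioo))
      (hA.union _ hmA (by simpa using hmA' 0) hA') ?_ ?_ ?_ ?_ z hz ?_
    · intro hb
      obtain ⟨R, hR⟩ := hb.exists_norm_le
      obtain ⟨n, hn⟩ := exists_nat_gt R
      have h1 := hR _ (.inr (hmA' n))
      have h2 := (Complex.re_le_norm (⟨n, j + 1 / 2⟩ : ℂ)).trans h1
      simp only at h2
      linarith
    · exact disjoint_left.2 fun p hp hpB => absurd (hB p hpB) (not_le.2 (hre' p hp))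
    · exact fun z hz h1 hG => hdisj _ (hbd z hz h1 (hre' _ hG)) hG
    · exact fun i => disjoint_left.2 fun p hp hpΛ => hdisj p (hΛ i p hpΛ (hre' p hp)) hp
    · refine .inl ⟨?_, ?_⟩
      · change -m < (v z).re ∧ (v z).re < m
        rw [hre]; exact ⟨by linarith, hm⟩
      · change j + δ < y ∧ y < j + 1 - δ
        constructor <;> linarith [hδ.2.1, hδ.2.2]
  by_cases hint : ∃ z, ‖z‖ < 1 ∧ (v z).re = 0
  · left
    obtain ⟨z, hz, hre⟩ := hint
    have hzS := hbs (mem_ball_zero_iff.2 hz)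
    have hzB : v z ∉ B := fun h => by linarith [hB _ h]
    rcases (hv.analyticAt hz hzB).eventually_constant_or_nhds_le_map_nhds with h | h
    · intro w hw
      rw [hv.eq_of_eventually_eq hz hzB h w hw, hre]
    · exfalso
      obtain ⟨j, hj⟩ := step z hzS hre
      have h1 : v '' Metric.ball 0 1 ∈ 𝓝 (v z) :=
        h (image_mem_map (Metric.isOpen_ball.mem_nhds (mem_ball_zero_iff.2 hz)))
      obtain ⟨r, hr, hrsub⟩ := Metric.mem_nhds_iff.1 h1
      -- An open image would contain a point on `x = 0` slightly above height `j`.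
      let τ := min (r / 2) (1 / 2)
      have hτ : 0 < τ := lt_min (by linarith) (by norm_num)
      have hmem : v z + τ * Complex.I ∈ Metric.ball (v z) r := by
        rw [mem_ball_iff_norm, add_sub_cancel_left, norm_mul, Complex.norm_I, mul_one,
          Complex.norm_real, Real.norm_of_nonneg hτ.le]
        exact lt_of_le_of_lt (min_le_left _ _) (by linarith)
      obtain ⟨w, hw, hwv⟩ := hrsub hmem
      obtain ⟨j', hj'⟩ := step w (hbs hw) (by rw [hwv]; simp [hre])
      rw [hwv] at hj'
      simp only [Complex.add_im, Complex.mul_im, Complex.ofReal_re, Complex.I_im, mul_one,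
        Complex.ofReal_im, Complex.I_re, mul_zero, add_zero, hj] at hj'
      have h3 : (j : ℝ) < j' := by linarith
      have h4 : (j' : ℝ) < (j + 1 : ℤ) := by push_cast; linarith [min_le_right (r / 2) (1 / 2 : ℝ)]
      have h3' : j < j' := by exact_mod_cast h3
      have h4' : j' < j + 1 := by exact_mod_cast h4
      omega
  · push Not at hint
    by_cases hpos : ∀ z, ‖z‖ < 1 → 0 < (v z).re
    · exact .inr hpos
    left
    push Not at hpos
    obtain ⟨z₁, hz₁, hneg⟩ := hpos
    have hball : ∀ z ∈ Metric.ball (0 : ℂ) 1, (v z).re ≤ 0 := by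
      intro z hz
      by_contra! hp
      obtain ⟨w, hw, hw0⟩ := (convex_ball (0 : ℂ) 1).isPreconnected.intermediate_value
        (mem_ball_zero_iff.2 hz₁) hz (f := fun z => (v z).re)
        (Complex.continuous_re.comp_continuousOn (hv.continuousOn.mono hbs)) ⟨hneg, hp.le⟩
      exact hint w (mem_ball_zero_iff.1 hw) hw0
    intro z hz
    have : closure (v '' Metric.ball 0 1) ⊆ {p | p.re ≤ 0} :=
      closure_minimal (by rintro _ ⟨w, hw, rfl⟩; exact hball w hw)
        (isClosed_le Complex.continuous_re continuous_const)
    exact this (hv.mem_closure_image hz)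

end Disc

/-! ### Strip-like ends -/

section Ends

/-- By Cauchy's theorem the integral of `Re q` over the segments `{s} × [0,1]` does not decrease with
`s` if `Im q` is at least as large on the upper boundary line as on the lower one. So a holomorphic
function `q` with positive real part cannot have the limit `0` in a positive half-strip. -/
theorem exists_le_re_of_im_le {q : ℂ → ℂ} {s₀ : ℝ}
    (hc : ContinuousOn q {w | s₀ ≤ w.re ∧ w.im ∈ Icc (0 : ℝ) 1})
    (hd : DifferentiableOn ℂ q {w | s₀ < w.re ∧ w.im ∈ Ioo (0 : ℝ) 1})
    (hpos : ∀ w : ℂ, s₀ ≤ w.re → w.im ∈ Ioo (0 : ℝ) 1 → 0 < (q w).re)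
    (him : ∀ s ≥ s₀, (q ⟨s, 0⟩).im ≤ (q ⟨s, 1⟩).im) :
    ∃ δ > 0, ∀ s ≥ s₀, ∃ t ∈ Icc (0 : ℝ) 1, δ ≤ (q ⟨s, t⟩).re := by
  have hcv : ∀ s ≥ s₀, ContinuousOn (fun t : ℝ => q (s + t * Complex.I)) (Icc 0 1) := by
    intro s hs
    refine hc.comp (by fun_prop) fun t ht => ?_
    simp only [mem_ofPred_eq]
    simpa using ⟨hs, ht⟩
  have hch : ∀ t ∈ Icc (0 : ℝ) 1, ContinuousOn (fun s : ℝ => q (s + t * Complex.I)) (Ici s₀) := by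
    intro t ht
    refine hc.comp (by fun_prop) fun s hs => ?_
    simp only [mem_ofPred_eq]
    simpa using ⟨hs, ht⟩
  have hiv : ∀ s ≥ s₀, IntervalIntegrable (fun t : ℝ => q (s + t * Complex.I))
      MeasureTheory.volume 0 1 := fun s hs =>
    ContinuousOn.intervalIntegrable (by rw [uIcc_of_le zero_le_one]; exact hcv s hs)
  let Q : ℝ → ℝ := fun s => ∫ t in (0 : ℝ)..1, (q (s + t * Complex.I)).re
  have hmono : ∀ s ≥ s₀, Q s₀ ≤ Q s := by
    intro s hs
    have hih : ∀ t ∈ Icc (0 : ℝ) 1, IntervalIntegrable (fun x : ℝ => q (x + t * Complex.I))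
        MeasureTheory.volume s₀ s := fun t ht =>
      ContinuousOn.intervalIntegrable (by
        rw [uIcc_of_le hs]; exact (hch t ht).mono Icc_subset_Ici_self)
    have h := Complex.integral_boundary_rect_eq_zero_of_continuousOn_of_differentiableOn q
      (⟨s₀, 0⟩ : ℂ) (⟨s, 1⟩ : ℂ) ?_ ?_
    · have h' := congrArg Complex.imCLM h
      simp only [map_sub, map_add, map_zero, smul_eq_mul, Complex.imCLM_apply, Complex.mul_im,
        Complex.I_re, Complex.I_im, zero_mul, one_mul, zero_add] at h'
      have i0 := Complex.imCLM.intervalIntegral_comp_comm (hih 0 (by simp))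
      have i1 := Complex.imCLM.intervalIntegral_comp_comm (hih 1 (by simp))
      have i2 := Complex.reCLM.intervalIntegral_comp_comm (hiv s hs)
      have i3 := Complex.reCLM.intervalIntegral_comp_comm (hiv s₀ le_rfl)
      simp only [Complex.imCLM_apply, Complex.reCLM_apply] at i0 i1 i2 i3
      rw [← i0, ← i1, ← i2, ← i3] at h'
      have hle : ∫ x in s₀..s, (q (x + (0 : ℝ) * Complex.I)).im ≤
          ∫ x in s₀..s, (q (x + (1 : ℝ) * Complex.I)).im := by
        refine intervalIntegral.integral_mono_on hs ?_ ?_ fun x hx => ?_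
        · exact ⟨Complex.imCLM.integrable_comp (hih 0 (by simp)).1,
            Complex.imCLM.integrable_comp (hih 0 (by simp)).2⟩
        · exact ⟨Complex.imCLM.integrable_comp (hih 1 (by simp)).1,
            Complex.imCLM.integrable_comp (hih 1 (by simp)).2⟩
        · have := him x hx.1
          rw [Complex.mk_eq_add_mul_I, Complex.mk_eq_add_mul_I] at this
          exact this
      simp only [Q]
      linarith
    · refine hc.mono fun w hw => ?_
      rw [Complex.mem_reProdIm, uIcc_of_le hs, uIcc_of_le (zero_le_one' ℝ)] at hw
      exact ⟨hw.1.1, hw.2⟩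
    · refine hd.mono fun w hw => ?_
      rw [Complex.mem_reProdIm] at hw
      simp only [min_eq_left hs, max_eq_right hs, min_eq_left (zero_le_one' ℝ),
        max_eq_right (zero_le_one' ℝ)] at hw
      exact ⟨hw.1.1, hw.2⟩
  have hQ0 : 0 < Q s₀ := by
    refine intervalIntegral.intervalIntegral_pos_of_pos_on ?_ (fun t ht => ?_) zero_lt_one
    · exact ⟨Complex.reCLM.integrable_comp (hiv s₀ le_rfl).1,
        Complex.reCLM.integrable_comp (hiv s₀ le_rfl).2⟩
    · exact hpos _ (by simp) (by simpa using ht)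
  refine ⟨Q s₀, hQ0, fun s hs => ?_⟩
  by_contra! hlt
  have : Q s < ∫ _ in (0 : ℝ)..1, Q s₀ := by
    refine intervalIntegral.integral_lt_integral_of_continuousOn_of_le_of_exists_lt zero_lt_one
      (Complex.continuous_re.comp_continuousOn (hcv s hs)) continuousOn_const
      (fun t ht => ?_) ⟨0, by simp, ?_⟩
    · have := hlt t (Ioc_subset_Icc_self ht)
      rw [Complex.mk_eq_add_mul_I] at this
      exact this.le
    · have := hlt 0 (by simp)
      rw [Complex.mk_eq_add_mul_I] at this
      exact this
  have h1 := hmono s hs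
  simp at this
  linarith

end Ends

section StripLikeEnds

variable {k : ℕ} {c : Config k} {κ : ℤˣ} {i : Fin (k + 1)} {e : ℂ → ℂ}

theorem eventually_endFilter {P : ℝ → Prop} :
    (∀ᶠ s in endFilter κ, P s) ↔ ∃ s₀ : ℝ, ∀ s, s₀ ≤ sgn κ * s → P s := by
  rcases Int.units_eq_one_or κ with rfl | rfl
  · simp [endFilter, sgn, eventually_atTop]
  · simp only [endFilter, sgn, eventually_atBot, show (-1 : ℤˣ) ≠ 1 by decide, if_false]
    constructor
    · rintro ⟨a, h⟩
      exact ⟨-a, fun s hs => h s (by simp at hs; linarith)⟩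
    · rintro ⟨a, h⟩
      exact ⟨-a, fun s hs => h s (by simp; linarith)⟩

instance endFilter_neBot : (endFilter κ).NeBot := by
  rcases Int.units_eq_one_or κ with rfl | rfl
  · simp only [endFilter, if_true]; infer_instance
  · simp only [endFilter, show (-1 : ℤˣ) ≠ 1 by decide, if_false]; infer_instance

theorem sgn_mul_self (κ : ℤˣ) : sgn κ * sgn κ = 1 := by
  rcases Int.units_eq_one_or κ with rfl | rfl <;> simp [sgn]

theorem orient_mem {t : ℝ} (ht : t ∈ Icc (0 : ℝ) 1) : orient κ t ∈ Icc (0 : ℝ) 1 := by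
  unfold orient
  split_ifs
  · exact ht
  · exact ⟨by linarith [ht.2], by linarith [ht.1]⟩

theorem orient_orient (t : ℝ) : orient κ (orient κ t) = t := by
  unfold orient
  split_ifs <;> ring

theorem continuous_orient : Continuous (orient κ) := by
  unfold orient
  split_ifs <;> fun_prop

/-- The identification of the standard positive half-strip with the half-strip of sign `κ`: the
identity for `+` and the half-turn `w ↦ i - w` for `-`. -/
noncomputable def stripMap (κ : ℤˣ) (w : ℂ) : ℂ := if κ = 1 then w else Complex.I - w

theorem stripMap_re (w : ℂ) : (stripMap κ w).re = sgn κ * w.re := by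
  rcases Int.units_eq_one_or κ with rfl | rfl <;> simp [stripMap, sgn]

theorem stripMap_im (w : ℂ) : (stripMap κ w).im = orient κ w.im := by
  rcases Int.units_eq_one_or κ with rfl | rfl <;> simp [stripMap, orient]

theorem stripMap_mem {w : ℂ} (h0 : 0 ≤ w.re) (h1 : w.im ∈ Icc (0 : ℝ) 1) :
    stripMap κ w ∈ halfStrip κ := by
  refine ⟨?_, ?_⟩
  · rwa [stripMap_re, ← mul_assoc, sgn_mul_self, one_mul]
  · rw [stripMap_im]; exact orient_mem h1

theorem differentiable_stripMap : Differentiable ℂ (stripMap κ) := by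
  unfold stripMap
  split_ifs <;> fun_prop

theorem isOpen_strip (κ : ℤˣ) (s : ℝ) :
    IsOpen {w : ℂ | s < sgn κ * w.re ∧ w.im ∈ Ioo (0 : ℝ) 1} :=
  (isOpen_lt continuous_const (continuous_const.mul Complex.continuous_re)).inter
    (isOpen_Ioo.preimage Complex.continuous_im)

theorem halfStrip_mem_nhds {w : ℂ} (h0 : 0 < sgn κ * w.re) (h1 : w.im ∈ Ioo (0 : ℝ) 1) :
    halfStrip κ ∈ 𝓝 w :=
  mem_of_superset ((isOpen_strip κ 0).mem_nhds ⟨h0, h1⟩)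
    fun _ h => ⟨h.1.le, Ioo_subset_Icc_self h.2⟩

theorem IsStripLikeEnd.norm_lt_one (he : IsStripLikeEnd c κ i e) {w : ℂ} (hw : w ∈ halfStrip κ)
    (h1 : w.im ∈ Ioo (0 : ℝ) 1) : ‖e w‖ < 1 := by
  refine lt_of_le_of_ne (he.mapsTo hw).1 fun h => ?_
  rcases (he.boundary w hw).1 h with h | h
  · exact h1.1.ne' h
  · exact h1.2.ne h

/-- A strip-like end covers a punctured neighbourhood of its puncture, even if only the part beyond
`|s| = s₀` is taken: near the puncture the open disc is convex and avoids the arc `|s| = s₀`, and the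
image of the end is open and closed in it. -/
theorem IsStripLikeEnd.eventually_mem_image (he : IsStripLikeEnd c κ i e)
    (hc : ∀ i, ‖c.1 i‖ = 1) (s₀ : ℝ) :
    ∀ᶠ z in 𝓝[fibre c] (c.1 i), ∃ w ∈ halfStrip κ, s₀ ≤ sgn κ * w.re ∧ e w = z := by
  set s₁ := max s₀ 0
  let A : Set ℂ := {w | s₁ ≤ sgn κ * w.re ∧ w.im ∈ Icc (0 : ℝ) 1}
  let A₀ : Set ℂ := {w | s₁ < sgn κ * w.re ∧ w.im ∈ Ioo (0 : ℝ) 1}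
  let Γ : Set ℂ := {w | sgn κ * w.re = s₁ ∧ w.im ∈ Icc (0 : ℝ) 1}
  have hAH : A ⊆ halfStrip κ := fun w hw => ⟨(le_max_right _ _).trans hw.1, hw.2⟩
  have hΓA : Γ ⊆ A := fun w hw => ⟨hw.1.ge, hw.2⟩
  have hA₀A : A₀ ⊆ A := fun w hw => ⟨hw.1.le, Ioo_subset_Icc_self hw.2⟩
  have hbs := ball_subset_fibre hc
  have hAcl : IsClosed A := (isClosed_le continuous_const
    (continuous_const.mul Complex.continuous_re)).inter
    (isClosed_Icc.preimage Complex.continuous_im)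
  -- The image of `A` is closed in the punctured disc.
  obtain ⟨Z, hZ, hAZ⟩ : ∃ Z : Set ℂ, IsClosed Z ∧ e '' A = Z ∩ fibre c := by
    have h1 := he.proper_embedding.isClosedMap _ (hAcl.preimage continuous_subtype_val)
    obtain ⟨Z, hZ, hZA⟩ := isClosed_induced_iff.1 h1
    refine ⟨Z, hZ, ?_⟩
    ext z
    constructor
    · rintro ⟨w, hw, rfl⟩
      refine ⟨?_, he.mapsTo (hAH hw)⟩
      have : (⟨e w, he.mapsTo (hAH hw)⟩ : fibre c) ∈ Subtype.val ⁻¹' Z := by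
        rw [hZA]; exact ⟨⟨w, hAH hw⟩, hw, rfl⟩
      exact this
    · rintro ⟨hz, hzf⟩
      have : (⟨z, hzf⟩ : fibre c) ∈ Subtype.val ⁻¹' Z := hz
      rw [hZA] at this
      obtain ⟨w, hw, hwz⟩ := this
      exact ⟨w, hw, congrArg Subtype.val hwz⟩
  have hΓc : IsCompact (e '' Γ) := by
    refine IsCompact.image_of_continuousOn ?_ (he.holomorphic.continuousOn.mono (hΓA.trans hAH))
    have : Γ = ({sgn κ * s₁} : Set ℝ) ×ℂ Icc 0 1 := by
      ext w
      refine and_congr_left fun _ => ?_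
      change sgn κ * w.re = s₁ ↔ w.re = sgn κ * s₁
      constructor
      · rintro h; rw [← h, ← mul_assoc, sgn_mul_self, one_mul]
      · rintro h; rw [h, ← mul_assoc, sgn_mul_self, one_mul]
    rw [this]
    exact isCompact_singleton.reProdIm isCompact_Icc
  have hci : c.1 i ∈ (e '' Γ)ᶜ := by
    rintro ⟨w, hw, h⟩
    exact (he.mapsTo (hAH (hΓA hw))).2 i h
  obtain ⟨ρ, hρ, hball⟩ := Metric.isOpen_iff.1 hΓc.isClosed.isOpen_compl _ hci
  let N : Set ℂ := Metric.ball 0 1 ∩ Metric.ball (c.1 i) ρ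
  have hN : IsPreconnected N := ((convex_ball _ _).inter (convex_ball _ _)).isPreconnected
  have hA₀o : IsOpen A₀ := isOpen_strip κ s₁
  have hUo : IsOpen (e '' A₀) := by
    rw [isOpen_iff_mem_nhds]
    rintro _ ⟨w, hw, rfl⟩
    have hnh : ∀ w' ∈ A₀, halfStrip κ ∈ 𝓝 w' := fun w' hw' =>
      halfStrip_mem_nhds (lt_of_le_of_lt (le_max_right _ _) hw'.1) hw'.2
    have hd : DifferentiableOn ℂ e A₀ := he.holomorphic.mono (hA₀A.trans hAH)
    have han : AnalyticAt ℂ e w := hd.analyticAt (hA₀o.mem_nhds hw)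
    have hne : deriv e w ≠ 0 := by
      rw [← derivWithin_of_mem_nhds (hnh w hw)]
      exact he.immersion w (hAH (hA₀A hw))
    rw [← han.hasStrictDerivAt.map_nhds_eq hne]
    exact image_mem_map (hA₀o.mem_nhds hw)
  have hNU : N ⊆ e '' A₀ := by
    refine hN.subset_of_closure_inter_subset hUo ?_ ?_
    · have h1 := he.tendsto (Metric.ball_mem_nhds _ hρ)
      have h2 : ∀ᶠ s in endFilter κ, e ⟨s, 1 / 2⟩ ∈ Metric.ball (c.1 i) ρ := by
        have := eventually_prod_principal_iff.1 (h1 : ∀ᶠ q in endFilter κ ×ˢ 𝓟 (Icc (0:ℝ) 1),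
          e ⟨q.1, q.2⟩ ∈ Metric.ball (c.1 i) ρ)
        filter_upwards [this] with s hs using hs (1 / 2) ⟨by norm_num, by norm_num⟩
      obtain ⟨s₂, h2⟩ := eventually_endFilter.1 h2
      let s := sgn κ * (max s₁ s₂ + 1)
      have hs : sgn κ * s = max s₁ s₂ + 1 := by
        simp only [s]; rw [← mul_assoc, sgn_mul_self, one_mul]
      have hw : (⟨s, 1 / 2⟩ : ℂ) ∈ A₀ := by
        refine ⟨?_, by norm_num, by norm_num⟩
        change s₁ < sgn κ * s
        rw [hs]; linarith [le_max_left s₁ s₂]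
      refine ⟨e ⟨s, 1 / 2⟩, ⟨?_, h2 s (by rw [hs]; linarith [le_max_right s₁ s₂])⟩, _, hw, rfl⟩
      exact mem_ball_zero_iff.2 (he.norm_lt_one (hAH (hA₀A hw)) hw.2)
    · rintro z ⟨hzc, hz1, hz2⟩
      have hzZ : z ∈ Z := closure_minimal
        (fun y hy => (hAZ.subset (image_mono hA₀A hy)).1) hZ hzc
      obtain ⟨w, hw, rfl⟩ : z ∈ e '' A := hAZ ▸ ⟨hzZ, hbs hz1⟩
      refine ⟨w, ⟨lt_of_le_of_ne hw.1 fun h => hball hz2 ⟨w, ⟨h.symm, hw.2⟩, rfl⟩, ?_⟩, rfl⟩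
      have hn : ¬ (w.im = 0 ∨ w.im = 1) := fun h =>
        (mem_ball_zero_iff.1 hz1).ne ((he.boundary w (hAH hw)).2 h)
      push Not at hn
      exact ⟨lt_of_le_of_ne hw.2.1 hn.1.symm, lt_of_le_of_ne hw.2.2 hn.2⟩
  filter_upwards [self_mem_nhdsWithin, nhdsWithin_le_nhds (Metric.ball_mem_nhds _ hρ)] with z hz hzb
  have hzN : z ∈ closure N := by
    have := Metric.isOpen_ball.inter_closure (t := Metric.ball (0 : ℂ) 1)
      ⟨hzb, fibre_subset_closure_ball hz⟩
    rwa [inter_comm] at this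
  have hzZ : z ∈ Z := closure_minimal
    (fun y hy => (hAZ.subset (image_mono hA₀A (hNU hy))).1) hZ hzN
  obtain ⟨w, hw, rfl⟩ : z ∈ e '' A := hAZ ▸ ⟨hzZ, hz⟩
  exact ⟨w, hAH hw, (le_max_left _ _).trans hw.1, rfl⟩

/-- Locally uniform convergence on the segment `[0,1]` is uniform. -/
theorem exists_forall_mem_of_tendsto {v : ℂ → ℂ} {ℓ : ℝ → ℂ}
    (hℓ : ∀ t₀ ∈ Icc (0 : ℝ) 1, Tendsto (fun q : ℝ × ℝ => v (e ⟨q.1, q.2⟩))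
      (endFilter κ ×ˢ 𝓝[Icc 0 1] t₀) (𝓝 (ℓ t₀)))
    {O : Set ℂ} (hO : O ∈ 𝓝ˢ (ℓ '' Icc 0 1)) :
    ∃ s₀ : ℝ, ∀ w : ℂ, s₀ ≤ sgn κ * w.re → w.im ∈ Icc (0 : ℝ) 1 → v (e w) ∈ O := by
  have h : ∀ᶠ s in endFilter κ, ∀ t ∈ Icc (0 : ℝ) 1, v (e ⟨s, t⟩) ∈ O := by
    refine isCompact_Icc.induction_on (p := fun A => ∀ᶠ s in endFilter κ, ∀ t ∈ A, v (e ⟨s, t⟩) ∈ O)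
      (by simp) (fun A A' hA h => h.mono fun s hs t ht => hs t (hA ht)) ?_ ?_
    · intro A A' h h'
      filter_upwards [h, h'] with s hs hs' t ht
      exact ht.elim (hs t) (hs' t)
    · intro t₀ ht₀
      have hO' : O ∈ 𝓝 (ℓ t₀) := mem_nhdsSet_iff_forall.1 hO _ ⟨t₀, ht₀, rfl⟩
      obtain ⟨A, hA, A', hA', hAA⟩ := mem_prod_iff.1 (hℓ t₀ ht₀ hO')
      refine ⟨A', hA', ?_⟩
      filter_upwards [hA] with s hs t ht
      exact hAA (mk_mem_prod hs ht)
  obtain ⟨s₀, hs₀⟩ := eventually_endFilter.1 h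
  exact ⟨s₀, fun w hw ht => hs₀ w.re hw w.im ht⟩

theorem IsStripLikeEnd.tendsto_nhdsSet (he : IsStripLikeEnd c κ i e)
    (hc : ∀ i, ‖c.1 i‖ = 1) {v : ℂ → ℂ} {ℓ : ℝ → ℂ}
    (hℓ : ∀ t₀ ∈ Icc (0 : ℝ) 1, Tendsto (fun q : ℝ × ℝ => v (e ⟨q.1, q.2⟩))
      (endFilter κ ×ˢ 𝓝[Icc 0 1] t₀) (𝓝 (ℓ t₀))) :
    Tendsto v (𝓝[fibre c] (c.1 i)) (𝓝ˢ (ℓ '' Icc 0 1)) := by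
  intro O hO
  obtain ⟨s₀, hs₀⟩ := exists_forall_mem_of_tendsto hℓ hO
  rw [mem_map]
  filter_upwards [he.eventually_mem_image hc s₀] with z hz
  obtain ⟨w, hw, hws, rfl⟩ := hz
  exact hs₀ w hws hw.2

/-- If the sign datum agrees with the sign of one end, then `v` stays in the half-plane `x ≤ 0`:
otherwise it would map the open disc to `x > 0` and tend to a pinching point along this end. By `hend`
its imaginary part there is at least as large on the boundary line where the transition function is
`1` as on the one where it is `0`, which `exists_le_re_of_im_le` excludes. -/
theorem IsHolomorphicOff.re_nonpos {v : ℂ → ℂ} {B : Set ℂ} {Λ : Fin (k + 1) → Set ℂ}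
    (hv : IsHolomorphicOff c v B Λ) {F : ℝ → ℝ} {η : ℝ} (hη : 0 < η) (hF : ContinuousAt F 0)
    (hF0 : F 0 = 0) (hF1 : ∀ x > -η, |F x| ≤ 1 / 8) (hFpos : ∀ x ≥ 0, 0 ≤ F x)
    (hB : ∀ p ∈ B, p.re ≤ -η)
    (hbd : ∀ z ∈ fibre c, ‖z‖ = 1 → -η < (v z).re → v z ∈ wedges F)
    (hΛ : ∀ i, ∀ p ∈ Λ i, -η < p.re → p ∈ wedges F)
    (he : IsStripLikeEnd c κ i e) {ℓ : ℝ → ℂ}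
    (hℓ : ∀ t₀ ∈ Icc (0 : ℝ) 1, Tendsto (fun q : ℝ × ℝ => v (e ⟨q.1, q.2⟩))
      (endFilter κ ×ˢ 𝓝[Icc 0 1] t₀) (𝓝 (ℓ t₀)))
    (hpinch : (∀ t ∈ Icc (0 : ℝ) 1, 0 ≤ (ℓ t).re) →
      ∃ j : ℤ, ∀ t ∈ Icc (0 : ℝ) 1, ℓ t = j * Complex.I)
    (hend : ∀ w ∈ halfStrip κ, 1 ≤ sgn κ * w.re → (w.im = 0 ∨ w.im = 1) → -η < (v (e w)).re →
      ∃ j : ℤ, (v (e w)).im = j + orient κ w.im * F (v (e w)).re) :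
    ∀ z ∈ fibre c, (v z).re ≤ 0 := by
  rcases hv.re_nonpos_or_re_pos hη hF hF0 hF1 hB hbd hΛ with h | hpos
  · exact h
  exfalso
  have hnn : ∀ z ∈ fibre c, 0 ≤ (v z).re := by
    intro z hz
    have : closure (v '' Metric.ball 0 1) ⊆ {p | 0 ≤ p.re} :=
      closure_minimal (by rintro _ ⟨w, hw, rfl⟩; exact (hpos w (mem_ball_zero_iff.1 hw)).le)
        (isClosed_le continuous_const Complex.continuous_re)
    exact this (hv.mem_closure_image hz)
  have hℓ0 : ∀ t ∈ Icc (0 : ℝ) 1, 0 ≤ (ℓ t).re := by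
    intro t ht
    have : (𝓝[Icc 0 1] t).NeBot := mem_closure_iff_nhdsWithin_neBot.1 (subset_closure ht)
    refine ge_of_tendsto ((Complex.continuous_re.tendsto _).comp (hℓ t ht)) ?_
    have h1 : ∀ᶠ s in endFilter κ, 0 ≤ sgn κ * s := eventually_endFilter.2 ⟨0, fun s hs => hs⟩
    filter_upwards [prod_mem_prod h1 self_mem_nhdsWithin] with q hq
    exact hnn _ (he.mapsTo ⟨hq.1, hq.2⟩)
  obtain ⟨j, hj⟩ := hpinch hℓ0
  have himg : ℓ '' Icc 0 1 = {(j : ℂ) * Complex.I} := by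
    ext p
    constructor
    · rintro ⟨t, ht, rfl⟩; exact hj t ht
    · rintro rfl; exact ⟨0, by simp, hj 0 (by simp)⟩
  have hunif : ∀ r > 0, ∃ s₀ : ℝ, ∀ w : ℂ, s₀ ≤ sgn κ * w.re → w.im ∈ Icc (0 : ℝ) 1 →
      ‖v (e w) - j * Complex.I‖ < r := by
    intro r hr
    obtain ⟨s₀, h⟩ := exists_forall_mem_of_tendsto hℓ (O := Metric.ball ((j : ℂ) * Complex.I) r)
      (by rw [himg, nhdsSet_singleton]; exact Metric.ball_mem_nhds _ hr)
    exact ⟨s₀, fun w h1 h2 => mem_ball_iff_norm.1 (h w h1 h2)⟩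
  obtain ⟨s₁, hs₁⟩ := hunif (1 / 2) (by norm_num)
  set s₀ := max s₁ 1
  have hre : ∀ w : ℂ, sgn κ * (stripMap κ w).re = w.re := fun w => by
    rw [stripMap_re, ← mul_assoc, sgn_mul_self, one_mul]
  have hs₀ : (0 : ℝ) < s₀ := lt_of_lt_of_le one_pos (le_max_right _ _)
  have hcont : ContinuousOn (fun w => v (e (stripMap κ w)))
      {w | s₀ ≤ w.re ∧ w.im ∈ Icc (0 : ℝ) 1} := by
    refine hv.continuousOn.comp (he.holomorphic.continuousOn.comp
      differentiable_stripMap.continuous.continuousOn ?_) ?_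
    · exact fun w hw => stripMap_mem (hs₀.le.trans hw.1) hw.2
    · exact fun w hw => he.mapsTo (stripMap_mem (hs₀.le.trans hw.1) hw.2)
  have hint : ∀ w : ℂ, 0 < w.re → w.im ∈ Ioo (0 : ℝ) 1 →
      0 < sgn κ * (stripMap κ w).re ∧ (stripMap κ w).im ∈ Ioo (0 : ℝ) 1 := by
    intro w h0 h1
    rw [hre, stripMap_im]
    refine ⟨h0, ?_⟩
    unfold orient
    split_ifs
    · exact h1
    · exact ⟨by linarith [h1.2], by linarith [h1.1]⟩
  have hlt : ∀ w : ℂ, 0 < w.re → w.im ∈ Ioo (0 : ℝ) 1 → ‖e (stripMap κ w)‖ < 1 := fun w h0 h1 =>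
    he.norm_lt_one (stripMap_mem h0.le (Ioo_subset_Icc_self h1)) (hint w h0 h1).2
  -- The half-turn `stripMap` reduces inputs to outputs; it exchanges the two boundary lines.
  have key : ∃ δ > 0, ∀ s ≥ s₀, ∃ t ∈ Icc (0 : ℝ) 1, δ ≤ (v (e (stripMap κ ⟨s, t⟩))).re := by
    refine exists_le_re_of_im_le (q := fun w => v (e (stripMap κ w))) hcont ?_ ?_ ?_
    · intro w hw
      obtain ⟨hi1, hi2⟩ := hint w (hs₀.trans hw.1) hw.2
      have hn := hlt w (hs₀.trans hw.1) hw.2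
      have hd1 : DifferentiableAt ℂ v (e (stripMap κ w)) :=
        hv.differentiableAt _ hn fun h => by linarith [hB _ h, hpos _ hn]
      have hd2 : DifferentiableAt ℂ e (stripMap κ w) :=
        he.holomorphic.differentiableAt (halfStrip_mem_nhds hi1 hi2)
      exact (hd1.comp w (hd2.comp w (differentiable_stripMap w))).differentiableWithinAt
    · exact fun w h0 h1 => hpos _ (hlt w (hs₀.trans_le h0) h1)
    · intro s hs
      have hval : ∀ t : ℝ, (t = 0 ∨ t = 1) →
          (v (e (stripMap κ ⟨s, t⟩))).im = j + t * F (v (e (stripMap κ ⟨s, t⟩))).re ∧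
          0 ≤ F (v (e (stripMap κ ⟨s, t⟩))).re := by
        intro t ht
        have htI : t ∈ Icc (0 : ℝ) 1 := by rcases ht with rfl | rfl <;> simp
        have hmem : stripMap κ ⟨s, t⟩ ∈ halfStrip κ := stripMap_mem (hs₀.le.trans hs) htI
        have hX := hnn _ (he.mapsTo hmem)
        have hcl := hs₁ (stripMap κ ⟨s, t⟩) (by rw [hre]; exact (le_max_left _ _).trans hs) hmem.2
        -- Close to the limit point the height `j'` of the wedge must be `j`.
        obtain ⟨j', hj'⟩ := hend _ hmem (by rw [hre]; exact (le_max_right _ _).trans hs)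
          (by
            rw [stripMap_im]
            rcases Int.units_eq_one_or κ with rfl | rfl <;> rcases ht with rfl | rfl <;>
              simp [orient])
          (by linarith)
        rw [stripMap_im, orient_orient] at hj'
        have hF8 := hF1 (v (e (stripMap κ ⟨s, t⟩))).re (by linarith)
        have hFp := hFpos _ hX
        refine ⟨?_, hFp⟩
        have h2 := (Complex.abs_im_le_norm _).trans_lt hcl
        simp only [Complex.sub_im, Complex.mul_im, Complex.intCast_re, Complex.I_im, mul_one,
          Complex.intCast_im, Complex.I_re, mul_zero, add_zero, hj'] at h2
        have h3 : |t * F (v (e (stripMap κ ⟨s, t⟩))).re| ≤ 1 / 8 := by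
          rw [abs_mul, abs_of_nonneg htI.1]
          exact (mul_le_of_le_one_left (abs_nonneg _) htI.2).trans hF8
        rw [abs_lt] at h2
        rw [abs_le] at h3
        have h4 : (j' : ℝ) < (j + 1 : ℤ) := by push_cast; linarith
        have h5 : (j : ℝ) < (j' + 1 : ℤ) := by push_cast; linarith
        have h4' : j' < j + 1 := by exact_mod_cast h4
        have h5' : j < j' + 1 := by exact_mod_cast h5
        obtain rfl : j' = j := by omega
        exact hj'
      obtain ⟨h0, -⟩ := hval 0 (.inl rfl)
      obtain ⟨h1, h1'⟩ := hval 1 (.inr rfl)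
      change (v (e (stripMap κ ⟨s, 0⟩))).im ≤ (v (e (stripMap κ ⟨s, 1⟩))).im
      rw [h0, h1]
      linarith
  obtain ⟨δ, hδ, hlow⟩ := key
  obtain ⟨s₂, hs₂⟩ := hunif δ hδ
  obtain ⟨t, ht, hle⟩ := hlow (max s₀ s₂) (le_max_left _ _)
  have h1 := hs₂ (stripMap κ ⟨max s₀ s₂, t⟩) (by rw [hre]; exact le_max_right _ _)
    (by rw [stripMap_im]; exact orient_mem ht)
  have h2 := (Complex.re_le_norm (v (e (stripMap κ ⟨max s₀ s₂, t⟩)) - j * Complex.I)).trans_lt h1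
  simp at h2
  linarith

end StripLikeEnds

/-! ### Boundary arcs of the disc -/

section Arcs

variable {k : ℕ} {c : Config k}

theorem IsClockwise.norm_eq_one {z : Fin (k + 1) → ℂ} (hz : IsClockwise z) (i : Fin (k + 1)) :
    ‖z i‖ = 1 := by
  obtain ⟨θ, -, -, h⟩ := hz
  rw [h i, ← neg_mul, ← Complex.ofReal_neg, Complex.norm_exp_ofReal_mul_I]

/-- The boundary of a punctured disc is the union of the arcs between consecutive punctures. -/
theorem IsClockwise.exists_mem_clockwiseArc (hc : IsClockwise c.1) {z : ℂ} (hz : z ∈ fibre c)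
    (h1 : ‖z‖ = 1) : ∃ i, z ∈ clockwiseArc (c.1 (i - 1)) (c.1 i) := by
  obtain ⟨θ, hmono, hlast, hθ⟩ := hc
  obtain ⟨t, ht, htz⟩ : ∃ t ∈ Ico (θ 0) (θ 0 + 2 * Real.pi), z = Complex.exp (-(t * Complex.I)) := by
    refine ⟨toIcoMod Real.two_pi_pos (θ 0) (-z.arg), toIcoMod_mem_Ico _ _ _, ?_⟩
    have h2 : z = Complex.exp (z.arg * Complex.I) := by
      conv_lhs => rw [← Complex.norm_mul_exp_arg_mul_I z, h1]
      simp
    conv_lhs => rw [h2]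
    rw [Complex.exp_eq_exp_iff_exists_int]
    refine ⟨-toIcoDiv Real.two_pi_pos (θ 0) (-z.arg), ?_⟩
    rw [toIcoMod]
    push_cast
    simp
    ring
  have hne : ∀ i, t ≠ θ i := fun i h => hz.2 i (by rw [hθ i, htz, h])
  have h0 : θ 0 < t := lt_of_le_of_ne ht.1 (hne 0).symm
  -- In the order of the angles, `i` is the last puncture before `z`.
  let T : Finset (Fin (k + 1)) := Finset.univ.filter fun i => θ i < t
  have hT : T.Nonempty := ⟨0, by simpa [T] using h0⟩
  set i := T.max' hT
  have hi : θ i < t := (Finset.mem_filter.1 (T.max'_mem hT)).2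
  have hmax : ∀ i', θ i' < t → i' ≤ i := fun i' h => T.le_max' i' (by simpa [T] using h)
  refine ⟨i + 1, ?_⟩
  rw [add_sub_cancel_right]
  by_cases hil : i = Fin.last k
  · refine ⟨θ i, θ 0 + 2 * Real.pi, t, hi, ht.2, ?_, hθ i, ?_, htz⟩
    · have := hmono.monotone (Fin.zero_le i); linarith
    · rw [hil, Fin.last_add_one, hθ 0, Complex.exp_eq_exp_iff_exists_int]
      refine ⟨1, ?_⟩
      push_cast
      ring
  · have hlt : i < i + 1 := by
      rw [Fin.lt_add_one_iff]; exact lt_of_le_of_ne (Fin.le_last i) hil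
    refine ⟨θ i, θ (i + 1), t, hi, ?_, ?_, hθ i, hθ _, htz⟩
    · refine lt_of_not_ge fun h => ?_
      exact absurd (hmax _ (lt_of_le_of_ne h (hne _).symm)) (not_le.2 hlt)
    · have h3 := hmono.monotone (Fin.le_last (i + 1))
      have h4 := hmono.monotone (Fin.zero_le i)
      linarith

theorem DiscFamily.isClockwise {𝒮 : DiscFamily k} (hc : c ∈ 𝒮.configs) : IsClockwise c.1 := by
  cases 𝒮 <;> exact hc.1

end Arcs

/-! ### Horizontal parts of Hamiltonian vector fields -/

section Hamiltonian

variable {E : Type*} [NormedAddCommGroup E] [NormedSpace ℝ E]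
  {M : Type*} [TopologicalSpace M] [ChartedSpace E M] [IsManifold 𝓘(ℝ, E) ∞ M]

/-- By nondegeneracy the equation that defines `hamVF` has a solution, so that the choice made in
`hamVF` is one. -/
theorem prodForm_hamVF [FiniteDimensional ℝ E] (Ω : SymplecticForm E M) (F : ℂ × M → ℝ) (p : ℂ × M)
    (v : TangentSpace (prodModel E) p) :
    prodForm Ω p (hamVF Ω F p) v = -(mfderiv (prodModel E) 𝓘(ℝ, ℝ) F p v) := by
  have hex : ∃ X : TangentSpace (prodModel E) p, ∀ v : TangentSpace (prodModel E) p,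
      prodForm Ω p X v = -(mfderiv (prodModel E) 𝓘(ℝ, ℝ) F p v) := by
    let Ωp : E →L[ℝ] E →L[ℝ] ℝ := Ω.form p.2
    let B : (ℂ × E) →ₗ[ℝ] Module.Dual ℝ (ℂ × E) := LinearMap.mk₂ ℝ
      (fun X v => X.1.re * v.1.im - X.1.im * v.1.re + Ωp X.2 v.2)
      (fun X X' v => by simp; ring) (fun a X v => by simp; ring)
      (fun X v v' => by simp; ring) (fun a X v => by simp; ring)
    have hinj : Function.Injective B := by
      rw [injective_iff_map_eq_zero]
      intro X hX
      have hX' : ∀ v : ℂ × E, X.1.re * v.1.im - X.1.im * v.1.re + Ωp X.2 v.2 = 0 := fun v =>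
        LinearMap.congr_fun hX v
      have h1 := hX' (1, 0)
      have h2 := hX' (Complex.I, 0)
      simp at h1 h2
      refine Prod.ext (Complex.ext h2 h1) (Ω.nondegenerate p.2 X.2 fun w => ?_)
      have h3 := hX' (0, w)
      simp only [Complex.zero_re, Complex.zero_im, mul_zero, sub_zero, zero_add] at h3
      exact h3
    have hsurj : Function.Surjective B :=
      (LinearMap.injective_iff_surjective_of_finrank_eq_finrank
        Subspace.dual_finrank_eq.symm).1 hinj
    let ℓ : (ℂ × E) →L[ℝ] ℝ := mfderiv (prodModel E) 𝓘(ℝ, ℝ) F p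
    obtain ⟨X, hX⟩ := hsurj (-ℓ.toLinearMap)
    exact ⟨X, fun v => LinearMap.congr_fun hX v⟩
  exact Classical.epsilon_spec hex v

/-- The horizontal part of a Hamiltonian vector field is the Hamiltonian vector field of the
restriction of the function to the horizontal slice. -/
theorem horiz_hamVF [FiniteDimensional ℝ E] (Ω : SymplecticForm E M) {F : ℂ × M → ℝ} {p : ℂ × M}
    (hF : MDifferentiableAt (prodModel E) 𝓘(ℝ, ℝ) F p) :
    DifferentiableAt ℝ (fun w => F (w, p.2)) p.1 ∧
      horiz E p (hamVF Ω F p) = planarHamVF (fun w => F (w, p.2)) p.1 := by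
  let ℓ : (ℂ × E) →L[ℝ] ℝ := mfderiv (prodModel E) 𝓘(ℝ, ℝ) F p
  have hslice : HasMFDerivAt 𝓘(ℝ, ℂ) (prodModel E) (fun w : ℂ => ((w, p.2) : ℂ × M)) p.1
      (ContinuousLinearMap.inl ℝ ℂ E) := by
    have h1 : MDifferentiableAt 𝓘(ℝ, ℂ) (prodModel E) (fun w : ℂ => ((w, p.2) : ℂ × M)) p.1 :=
      mdifferentiableAt_id.prodMk mdifferentiableAt_const
    have h2 : mfderiv 𝓘(ℝ, ℂ) (prodModel E) (fun w : ℂ => ((w, p.2) : ℂ × M)) p.1 =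
        ContinuousLinearMap.inl ℝ ℂ E := mfderiv_prod_left
    rw [← h2]
    exact h1.hasMFDerivAt
  have hd : HasFDerivAt (fun w => F (w, p.2)) (ℓ.comp (ContinuousLinearMap.inl ℝ ℂ E)) p.1 :=
    hasMFDerivAt_iff_hasFDerivAt.1 (HasMFDerivAt.comp p.1 (g := F) hF.hasMFDerivAt hslice)
  refine ⟨hd.differentiableAt, ?_⟩
  have h : ∀ ζ : ℂ, (horiz E p (hamVF Ω F p)).re * ζ.im - (horiz E p (hamVF Ω F p)).im * ζ.re =
      -(ℓ (ζ, 0)) := by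
    intro ζ
    have h1 := prodForm_hamVF Ω F p ((ζ, 0) : ℂ × E)
    have h2 : prodForm Ω p (hamVF Ω F p) ((ζ, 0) : ℂ × E) =
        (horiz E p (hamVF Ω F p)).re * ζ.im - (horiz E p (hamVF Ω F p)).im * ζ.re +
          Ω.form p.2 (vert E p (hamVF Ω F p)) (0 : E) := rfl
    have h3 : Ω.form p.2 (vert E p (hamVF Ω F p)) (0 : E) = 0 := map_zero _
    rw [h2, h3, add_zero] at h1
    exact h1
  have e1 := h 1
  have eI := h Complex.I
  simp only [Complex.one_re, Complex.one_im, Complex.I_re, Complex.I_im] at e1 eI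
  unfold planarHamVF
  rw [hd.fderiv]
  refine Complex.ext ?_ ?_
  · change _ = -(ℓ (Complex.I, 0))
    linarith
  · change _ = ℓ (1, 0)
    linarith

theorem planarHamVF_congr {f g : ℂ → ℝ} {w : ℂ} (h : f =ᶠ[𝓝 w] g) :
    planarHamVF f w = planarHamVF g w := by
  unfold planarHamVF
  rw [h.fderiv_eq]

theorem planarHamVF_add_const_mul {f g : ℂ → ℝ} {w : ℂ} (hf : DifferentiableAt ℝ f w)
    (hg : DifferentiableAt ℝ g w) (b : ℝ) :
    planarHamVF (fun w => f w + b * g w) w = planarHamVF f w + b • planarHamVF g w := by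
  unfold planarHamVF
  have hd : HasFDerivAt (fun w => f w + b * g w) (fderiv ℝ f w + b • fderiv ℝ g w) w :=
    hf.hasFDerivAt.add (hg.hasFDerivAt.const_mul b)
  rw [hd.fderiv]
  refine Complex.ext ?_ ?_ <;> simp [add_comm]

theorem planarHamVF_const_mul_add_const {g : ℂ → ℝ} {w : ℂ} (hg : DifferentiableAt ℝ g w)
    (b d : ℝ) : planarHamVF (fun w => b * g w + d) w = b • planarHamVF g w := by
  unfold planarHamVF
  rw [((hg.hasFDerivAt.const_mul b).add_const d).fderiv]
  refine Complex.ext ?_ ?_ <;> simp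

theorem contDiff_planarHamVF {h : ℂ → ℝ} (hh : ContDiff ℝ ∞ h) : ContDiff ℝ ∞ (planarHamVF h) := by
  have hd : ContDiff ℝ ∞ (fderiv ℝ h) := hh.fderiv_right (by simp)
  have : planarHamVF h = fun z => (-(fderiv ℝ h z Complex.I) : ℝ) • (1 : ℂ) +
      (fderiv ℝ h z 1) • Complex.I := by
    funext z
    refine Complex.ext ?_ ?_ <;> simp [planarHamVF]
  rw [this]
  exact (((hd.clm_apply contDiff_const).neg).smul contDiff_const).add
    ((hd.clm_apply contDiff_const).smul contDiff_const)

end Hamiltonian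

namespace ProfileFunction

variable (h : ProfileFunction)

theorem isFlow : IsFlow (planarHamVF h.h) h.φ := ⟨h.flow_zero, h.flow_deriv⟩

theorem contDiff_field : ContDiff ℝ 2 (planarHamVF h.h) :=
  (contDiff_planarHamVF h.smooth).of_le (by norm_cast)

theorem contDiff_field_one : ContDiff ℝ 1 (planarHamVF h.h) := h.contDiff_field.of_le (by norm_num)

theorem differentiableAt_h (w : ℂ) : DifferentiableAt ℝ h.h w :=
  h.smooth.differentiable (by simp) w

end ProfileFunction

/-! ### The holomorphic map associated with a solution -/

section Solution

variable {E : Type*} [NormedAddCommGroup E] [NormedSpace ℝ E]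
  {M : Type*} [TopologicalSpace M] [ChartedSpace E M] [IsManifold 𝓘(ℝ, E) ∞ M]
  {Ω : SymplecticForm E M} {h : ProfileFunction} {k : ℕ} {𝒮 : DiscFamily k}
  {W : Fin (k + 1) → Set (ℂ × M)} {inputs : Finset (Fin (k + 1))} {α : Fin (k + 1) → ℤˣ}
  {F : ∀ i, FloerDatum Ω h (startOf W inputs i) (endOf W inputs i) (α i)}
  {e : Fin (k + 1) → Config k → ℂ → ℂ} {a : Config k → ℂ → ℝ} {D : PerturbationPair E M k}
  {c : Config k} {u : ℂ → ℂ × M}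

/-- The projection of `u` to `ℂ`, pulled back at the point `z` by the flow of the profile function
for the time `a z`. -/
noncomputable def straighten (h : ProfileFunction) (a : ℂ → ℝ) (u : ℂ → ℂ × M) (z : ℂ) : ℂ :=
  h.φ (-(a z)) (u z).1

theorem flow_straighten {N : Type*} (a : ℂ → ℝ) (u : ℂ → ℂ × N) (z : ℂ) :
    h.φ (a z) (straighten h a u z) = (u z).1 :=
  h.isFlow.cancel_neg h.contDiff_field_one _ _

theorem IsTransitionFunction.contDiffOn_fibre (ha : IsTransitionFunction 𝒮 inputs α e a)
    (hc : c ∈ 𝒮.configs) : ContDiffOn ℝ ∞ (a c) (fibre c) :=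
  ha.smooth.comp (contDiff_const.prodMk contDiff_id).contDiffOn fun _ hz => ⟨hc, hz⟩

theorem IsPerturbationDatum.horiz_Y [FiniteDimensional ℝ E]
    (hD : IsPerturbationDatum 𝒮 Ω h W inputs α F e a D) (hc : c ∈ 𝒮.configs) {z : ℂ}
    (hz : z ∈ fibre c) (ξ : ℂ) {p : ℂ × M} (hp : p.1 ∉ D.K) :
    horiz E p (D.Y Ω c z ξ p) =
      fderivWithin ℝ (a c) (fibre c) z ξ • planarHamVF h.h p.1 := by
  have hΘ : ContMDiff (prodModel E) 𝓘(ℝ, ℝ) ∞ (fun q => D.Θ c z q ξ) := by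
    have h1 : ContMDiffOn (prodModel E) (𝓘(ℝ, Config k × ℂ).prod (prodModel E)) ∞
        (fun q : ℂ × M => (((c, z), q) : (Config k × ℂ) × (ℂ × M))) univ :=
      (contMDiff_const.prodMk contMDiff_id).contMDiffOn
    have h2 := hD.smooth_Θ.comp h1 (fun q _ => ⟨⟨hc, hz⟩, mem_univ _⟩)
    exact (ContinuousLinearMap.apply ℝ ℝ ξ).contMDiff.comp (contMDiffOn_univ.1 h2)
  have hΘd := fun q => (hΘ q).mdifferentiableAt (by simp)
  have hh : MDifferentiableAt (prodModel E) 𝓘(ℝ, ℝ) (fun q : ℂ × M => h.h q.1) p :=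
    MDifferentiableAt.comp p (h.differentiableAt_h p.1).mdifferentiableAt mdifferentiableAt_fst
  set b := fderivWithin ℝ (a c) (fibre c) z ξ
  have hΘ₀ : MDifferentiableAt (prodModel E) 𝓘(ℝ, ℝ) (D.Θ₀ h a c z ξ) p :=
    (hΘd p).sub (MDifferentiableAt.comp p (g := fun x : ℝ => b * x)
      (differentiableAt_id.const_mul b).mdifferentiableAt hh)
  have h1 := horiz_hamVF Ω (hΘd p)
  have h2 := horiz_hamVF Ω hΘ₀
  have h3 := hD.vertical c hc z hz ξ p hp
  have h4 := planarHamVF_add_const_mul h2.1 (h.differentiableAt_h p.1) b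
  rw [← h2.2, h3, zero_add] at h4
  have h5 : (fun w => D.Θ c z (w, p.2) ξ) =
      fun w => D.Θ₀ h a c z ξ (w, p.2) + b * h.h w := by
    funext w
    simp [PerturbationPair.Θ₀, b]
  rw [← h4, ← h5]
  exact h1.2

theorem IsSolution.hasFDerivWithinAt_fst (hu : IsSolution Ω h W inputs α F e D c u) {z : ℂ}
    (hz : z ∈ fibre c) :
    HasFDerivWithinAt (fun z => (u z).1) ((ContinuousLinearMap.fst ℝ ℂ E).comp
      (mfderivWithin 𝓘(ℝ, ℂ) (prodModel E) u (fibre c) z : ℂ →L[ℝ] ℂ × E)) (fibre c) z := by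
  have h1 := ((hu.smooth z hz).mdifferentiableWithinAt (by simp)).hasMFDerivWithinAt
  have h2 : HasMFDerivAt (prodModel E) 𝓘(ℝ, ℂ) (Prod.fst : ℂ × M → ℂ) (u z)
      (ContinuousLinearMap.fst ℝ ℂ E) := hasMFDerivAt_fst (I := 𝓘(ℝ, ℂ)) (I' := 𝓘(ℝ, E)) (u z)
  exact hasMFDerivWithinAt_iff_hasFDerivWithinAt.1 (h2.comp_hasMFDerivWithinAt z h1)

theorem IsSolution.continuousOn_straighten (hu : IsSolution Ω h W inputs α F e D c u)
    (ha : ContinuousOn (a c) (fibre c)) : ContinuousOn (straighten h (a c) u) (fibre c) :=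
  (h.isFlow.continuous_uncurry h.contDiff_field).comp_continuousOn
    (ha.neg.prodMk (continuous_fst.comp_continuousOn hu.smooth.continuousOn))

/-- Where the projection of `u` lies outside `K`, the perturbed Cauchy–Riemann equation for `u` is
the Cauchy–Riemann equation for the straightened map. -/
theorem IsSolution.differentiableAt_straighten [FiniteDimensional ℝ E]
    (hu : IsSolution Ω h W inputs α F e D c u)
    (hD : IsPerturbationDatum 𝒮 Ω h W inputs α F e a D)
    (ha : IsTransitionFunction 𝒮 inputs α e a) (hc : c ∈ 𝒮.configs) {z : ℂ} (hz : ‖z‖ < 1)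
    (hK : (u z).1 ∉ D.K) : DifferentiableAt ℂ (straighten h (a c) u) z := by
  have hcn := (DiscFamily.isClockwise hc).norm_eq_one
  have hzf : z ∈ fibre c := ball_subset_fibre hcn (mem_ball_zero_iff.2 hz)
  have hnh : fibre c ∈ 𝓝 z := mem_of_superset
    (Metric.isOpen_ball.mem_nhds (mem_ball_zero_iff.2 hz)) (ball_subset_fibre hcn)
  set L : ℂ →L[ℝ] ℂ × E := mfderivWithin 𝓘(ℝ, ℂ) (prodModel E) u (fibre c) z with hL
  set A : ℂ →L[ℝ] ℝ := fderivWithin ℝ (a c) (fibre c) z with hA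
  set X : ℂ := planarHamVF h.h (u z).1
  set t := a c z
  have hder := (h.isFlow.hasFDerivWithinAt_pullback h.contDiff_field (hu.hasFDerivWithinAt_fst hzf)
    (((ha.contDiffOn_fibre hc).differentiableOn (by simp) z hzf).hasFDerivWithinAt)).hasFDerivAt hnh
  rw [← hL, ← hA] at hder
  -- The horizontal part of the equation, evaluated on the tangent vector `1`.
  have heq := congrArg (horiz E (u z)) (hu.equation z hzf 1)
  rw [map_add, map_add, hD.holomorphic c hc z hzf _ hK, hD.holomorphic c hc z hzf _ hK,
    hD.horiz_Y hc hzf _ hK, hD.horiz_Y hc hzf _ hK, mul_one] at heq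
  have heq' : (L 1).1 + h.pushI t (u z).1 (L Complex.I).1 =
      A 1 • X + h.pushI t (u z).1 (A Complex.I • X) := heq
  -- The differential of `φ_{-t}` turns `(φ_t)_* i` into `i`.
  have happ := congrArg (fderiv ℝ (h.φ (-t)) (u z).1) heq'
  simp only [ProfileFunction.pushI, map_add,
    h.isFlow.fderiv_neg_fderiv h.contDiff_field] at happ
  refine differentiableAt_complex_iff_differentiableAt_real.2 ⟨hder.differentiableAt, ?_⟩
  have hder' : fderiv ℝ (straighten h (a c) u) z = (fderiv ℝ (h.φ (-t)) (u z).1).comp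
      ((ContinuousLinearMap.fst ℝ ℂ E).comp L - A.smulRight X) := hder.fderiv
  rw [hder']
  simp only [ContinuousLinearMap.comp_apply, sub_apply, map_sub,
    ContinuousLinearMap.coe_fst', ContinuousLinearMap.smulRight_apply, smul_eq_mul]
  linear_combination (-Complex.I) * happ + ((fderiv ℝ (h.φ (-t)) (u z).1) (L Complex.I).1 -
    (fderiv ℝ (h.φ (-t)) (u z).1) (A Complex.I • X)) * Complex.I_sq

/-! ### Limits at the punctures -/

/-- The limits at a puncture of the straightened map, for a solution that approaches the chord `γ`:
far out on an end the transition function is `orient α t`. -/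
noncomputable def chordLimit (h : ProfileFunction) (α : ℤˣ) (γ : ℝ → ℂ × M) (t : ℝ) : ℂ :=
  h.φ (-(orient α t)) (γ t).1

theorem tendsto_straighten {i : Fin (k + 1)} (ha : IsTransitionFunction 𝒮 inputs α e a)
    (hc : c ∈ 𝒮.configs) {γ : ℝ → ℂ × M} {t₀ : ℝ}
    (hγ : Tendsto (fun q : ℝ × ℝ => u (e i c ⟨q.1, q.2⟩))
      (endFilter (kappa inputs i) ×ˢ 𝓝[Icc 0 1] t₀) (𝓝 (γ t₀))) :
    Tendsto (fun q : ℝ × ℝ => straighten h (a c) u (e i c ⟨q.1, q.2⟩))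
      (endFilter (kappa inputs i) ×ˢ 𝓝[Icc 0 1] t₀) (𝓝 (chordLimit h (α i) γ t₀)) := by
  have h1 : Tendsto (fun q : ℝ × ℝ => (-(orient (α i) q.2), (u (e i c ⟨q.1, q.2⟩)).1))
      (endFilter (kappa inputs i) ×ˢ 𝓝[Icc 0 1] t₀) (𝓝 (-(orient (α i) t₀), (γ t₀).1)) := by
    refine Tendsto.prodMk_nhds ?_ ((continuous_fst.tendsto _).comp hγ)
    exact ((continuous_orient.neg.tendsto t₀).comp
      (tendsto_nhdsWithin_iff.1 tendsto_snd).1)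
  refine (((h.isFlow.continuous_uncurry h.contDiff_field).tendsto _).comp h1).congr' ?_
  have h2 : ∀ᶠ s in endFilter (kappa inputs i), 1 ≤ sgn (kappa inputs i) * s :=
    eventually_endFilter.2 ⟨1, fun s hs => hs⟩
  filter_upwards [prod_mem_prod h2 self_mem_nhdsWithin] with q hq
  have hq1 : 1 ≤ sgn (kappa inputs i) * q.1 := hq.1
  have := ha.far c hc i ⟨q.1, q.2⟩ ⟨zero_le_one.trans hq1, hq.2⟩ hq1
  simp only [Function.comp_apply, straighten, this]

theorem IsTrajectory.hasDerivWithinAt_fst {H : ℝ → ℂ × M → ℝ} {γ : ℝ → ℂ × M}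
    (hγ : IsTrajectory Ω H γ) {t : ℝ} (ht : t ∈ Icc (0 : ℝ) 1) :
    HasFDerivWithinAt (fun t => (γ t).1)
      (ContinuousLinearMap.toSpanSingleton ℝ (horiz E (γ t) (hamVF Ω (H t) (γ t)))) (Icc 0 1) t := by
  have h2 : HasMFDerivAt (prodModel E) 𝓘(ℝ, ℂ) (Prod.fst : ℂ × M → ℂ) (γ t)
      (ContinuousLinearMap.fst ℝ ℂ E) := hasMFDerivAt_fst (I := 𝓘(ℝ, ℂ)) (I' := 𝓘(ℝ, E)) (γ t)
  have h3 := hasMFDerivWithinAt_iff_hasFDerivWithinAt.1 (h2.comp_hasMFDerivWithinAt t (hγ t ht))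
  refine HasFDerivWithinAt.congr_fderiv (f := fun t => (γ t).1) h3
    (ContinuousLinearMap.ext fun x => ?_)
  change ContinuousLinearMap.fst ℝ ℂ E ((show ℝ from x) • (show ℂ × E from hamVF Ω (H t) (γ t))) =
    (show ℝ from x) • (ContinuousLinearMap.fst ℝ ℂ E (show ℂ × E from hamVF Ω (H t) (γ t)))
  exact map_smul _ _ _

theorem IsTrajectory.continuousOn_fst {H : ℝ → ℂ × M → ℝ} {γ : ℝ → ℂ × M}
    (hγ : IsTrajectory Ω H γ) : ContinuousOn (fun t => (γ t).1) (Icc 0 1) :=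
  fun _ ht => (hγ.hasDerivWithinAt_fst ht).continuousWithinAt

theorem continuousOn_chordLimit {H : ℝ → ℂ × M → ℝ} {γ : ℝ → ℂ × M} (hγ : IsTrajectory Ω H γ)
    (α : ℤˣ) : ContinuousOn (chordLimit h α γ) (Icc 0 1) :=
  (h.isFlow.continuous_uncurry h.contDiff_field).comp_continuousOn
    (continuous_orient.neg.continuousOn.prodMk hγ.continuousOn_fst)

theorem FloerDatum.horiz_hamVF [FiniteDimensional ℝ E] {L L' : Set (ℂ × M)} {α : ℤˣ}
    (F : FloerDatum Ω h L L' α) {t : ℝ} (ht : t ∈ Icc (0 : ℝ) 1) {p : ℂ × M} (hp : p.1 ∉ F.K) :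
    horiz E p (hamVF Ω (F.H t) p) = sgn α • planarHamVF h.h p.1 := by
  have hH : ContMDiff (prodModel E) 𝓘(ℝ, ℝ) ∞ (F.H t) := by
    have h1 : ContMDiffOn (prodModel E) (𝓘(ℝ, ℝ).prod (prodModel E)) ∞
        (fun q : ℂ × M => ((t, q) : ℝ × (ℂ × M))) univ :=
      (contMDiff_const.prodMk contMDiff_id).contMDiffOn
    exact contMDiffOn_univ.1 (F.smooth_H.comp h1 (fun q _ => ⟨ht, mem_univ _⟩))
  obtain ⟨G, hG⟩ := F.split
  rw [(CobFloer.horiz_hamVF Ω ((hH p).mdifferentiableAt (by simp))).2,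
    ← planarHamVF_const_mul_add_const (h.differentiableAt_h p.1) (sgn α) (G t p.2)]
  refine planarHamVF_congr ?_
  filter_upwards [F.K_compact.isClosed.isOpen_compl.mem_nhds hp] with w hw
  exact hG t ht (w, p.2) hw

theorem hasDerivAt_orient (α : ℤˣ) (t : ℝ) : HasDerivAt (orient α) (sgn α) t := by
  rcases Int.units_eq_one_or α with rfl | rfl
  · have : orient 1 = id := by funext x; simp [orient]
    rw [this]; simpa [sgn] using hasDerivAt_id t
  · have : orient (-1) = fun x => 1 - x := by funext x; simp [orient]
    rw [this]; simpa [sgn] using (hasDerivAt_id t).const_sub 1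

/-- As long as a chord stays outside the compact set of the Floer datum, its straightened projection
is constant. -/
theorem chordLimit_eq [FiniteDimensional ℝ E] {L L' : Set (ℂ × M)} {α : ℤˣ}
    (F : FloerDatum Ω h L L' α) {γ : ℝ → ℂ × M} (hγ : IsTrajectory Ω F.H γ) {t t' : ℝ}
    (h0 : 0 ≤ t) (ht : t ≤ t') (h1 : t' ≤ 1) (hK : ∀ s ∈ Ico t t', (γ s).1 ∉ F.K) :
    chordLimit h α γ t' = chordLimit h α γ t := by
  refine constant_of_has_deriv_right_zero ((continuousOn_chordLimit hγ α).mono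
    (Icc_subset_Icc h0 h1)) (fun s hs => ?_) t' ⟨ht, le_rfl⟩
  have hs' : s ∈ Ico (0 : ℝ) 1 := ⟨h0.trans hs.1, hs.2.trans_le h1⟩
  have hsI := Ico_subset_Icc_self hs'
  have hp := (h.isFlow.hasFDerivWithinAt_pullback h.contDiff_field (hγ.hasDerivWithinAt_fst hsI)
    (hasDerivAt_orient α s).hasFDerivAt.hasFDerivWithinAt).hasDerivWithinAt
  rw [F.horiz_hamVF hsI (hK s hs)] at hp
  refine (hp.congr_deriv ?_).mono_of_mem_nhdsWithin (Icc_mem_nhdsGE_of_mem hs')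
  simp

/-- The straightened projection of a chord can be followed forward until the chord meets the compact
set of the Floer datum or ends. -/
theorem chordLimit_eq_or [FiniteDimensional ℝ E] {L L' : Set (ℂ × M)} {α : ℤˣ}
    (F : FloerDatum Ω h L L' α) {γ : ℝ → ℂ × M} (hγ : IsTrajectory Ω F.H γ) {t : ℝ}
    (ht : t ∈ Icc (0 : ℝ) 1) :
    (∃ t' ∈ Icc (0 : ℝ) 1, (γ t').1 ∈ F.K ∧ chordLimit h α γ t = chordLimit h α γ t') ∨
      chordLimit h α γ t = chordLimit h α γ 1 := by
  have hsub : Icc t 1 ⊆ Icc 0 1 := Icc_subset_Icc_left ht.1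
  by_cases hex : ∃ t' ∈ Icc t 1, (γ t').1 ∈ F.K
  · left
    have hcpt : IsCompact (Icc t 1 ∩ (fun t => (γ t).1) ⁻¹' F.K) :=
      isCompact_Icc.of_isClosed_subset ((hγ.continuousOn_fst.mono hsub).preimage_isClosed_of_isClosed
        isClosed_Icc F.K_compact.isClosed) inter_subset_left
    obtain ⟨t', ⟨ht', hK'⟩, hmin⟩ := hcpt.exists_isLeast (by
      obtain ⟨t', h1, h2⟩ := hex; exact ⟨t', h1, h2⟩)
    refine ⟨t', hsub ht', hK', (chordLimit_eq F hγ ht.1 ht'.1 ht'.2 fun s hs hsK => ?_).symm⟩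
    exact absurd (hmin ⟨⟨hs.1, hs.2.le.trans ht'.2⟩, hsK⟩) (not_le.2 hs.2)
  · right
    push Not at hex
    exact (chordLimit_eq F hγ ht.1 ht.2 le_rfl fun s hs => hex s (Ico_subset_Icc_self hs)).symm

end Solution

/-! ### The flow of a profile function along horizontal lines -/

namespace ProfileFunction

variable (h : ProfileFunction)

theorem planarHamVF_eq_zero {z : ℂ} (hz : z.re ∈ Icc (-1 : ℝ) 2) : planarHamVF h.h z = 0 := by
  have hcl : IsClosed {z : ℂ | planarHamVF h.h z = 0} :=
    isClosed_eq h.contDiff_field.continuous continuous_const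
  have hsub : Ioo (-1 : ℝ) 2 ×ℂ univ ⊆ {z : ℂ | planarHamVF h.h z = 0} := by
    rintro w ⟨hw, -⟩
    have hw' : w ∉ tsupport h.h := fun hmem => by
      rcases h.support hmem with h1 | h1
      · exact absurd hw.1 (not_lt.2 h1)
      · exact absurd hw.2 (not_lt.2 h1)
    have h0 : h.h =ᶠ[𝓝 w] fun _ => 0 := notMem_tsupport_iff_eventuallyEq.1 hw'
    change planarHamVF h.h w = 0
    rw [planarHamVF_congr h0]
    refine Complex.ext ?_ ?_ <;> simp [planarHamVF]
  have := closure_minimal hsub hcl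
  rw [Complex.closure_reProdIm, closure_Ioo (by norm_num), closure_univ] at this
  exact this ⟨hz, mem_univ _⟩

theorem flow_eq_self {z : ℂ} (hz : z.re ∈ Icc (-1 : ℝ) 2) (t : ℝ) : h.φ t z = z :=
  h.isFlow.eq_self_of_eq_zero h.contDiff_field_one (h.planarHamVF_eq_zero hz) t

/-- The inequality stays strict since the points with real part `-1` are fixed by the flow. -/
theorem re_flow_lt {z : ℂ} {i : ℤ} {t : ℝ} (ht : t ∈ Icc (-1 : ℝ) 1) (hz : z.re < -1)
    (hi : z.im = i) : (h.φ t z).re < -1 := by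
  refine lt_of_le_of_ne (h.flow_minus t ht i z hz.le hi).1 fun heq => ?_
  have h1 := h.flow_eq_self (z := h.φ t z) ⟨heq.ge, by rw [heq]; norm_num⟩ (-t)
  rw [h.isFlow.neg_cancel h.contDiff_field_one] at h1
  rw [← h1] at heq
  exact hz.ne heq

theorem lt_re_flow {z : ℂ} {i : ℤ} {t : ℝ} (ht : t ∈ Icc (-1 : ℝ) 1) (hz : 2 < z.re)
    (hi : z.im = i) : 2 < (h.φ t z).re := by
  refine lt_of_le_of_ne (h.flow_plus t ht i z hz.le hi).1 fun heq => ?_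
  have h1 := h.flow_eq_self (z := h.φ t z) ⟨by rw [← heq]; norm_num, heq.ge⟩ (-t)
  rw [h.isFlow.neg_cancel h.contDiff_field_one] at h1
  rw [← h1] at heq
  exact hz.ne heq

/-- What the two ends of a profile function have in common. The half-line `S` is the projection of
the end, `H` is the function `h_±`, and `X ↦ x₀ + σ X` with `σ = ±1` is the outward coordinate
centred at the bottleneck `x₀`. -/
structure IsEnd (σ x₀ : ℝ) (S : Set ℝ) (H : ℝ → ℝ) : Prop where
  sign : σ = 1 ∨ σ = -1
  isOpen : IsOpen S
  eq_on (j : ℤ) (z : ℂ) : z.re ∈ S → |z.im - j| ≤ h.ε / 2 → h.h z = H z.re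
  stay (t : ℝ) (j : ℤ) (z : ℂ) : t ∈ Icc (-1 : ℝ) 1 → z.re ∈ S → z.im = j →
    (h.φ t z).re ∈ S ∧ |(h.φ t z).im - j| ≤ h.ε / 2
  mem (X : ℝ) : -(1 / 4) < X → x₀ + σ * X ∈ S
  notMem (x : ℝ) : x ∈ S → x ∉ Icc (-1 : ℝ) 2
  mem_of_flow_mem (t : ℝ) (j : ℤ) (z : ℂ) : t ∈ Icc (-1 : ℝ) 1 → z.re < -1 ∨ 2 < z.re → z.im = j →
    (h.φ t z).re ∈ S → z.re ∈ S
  critical (X : ℝ) : 0 ≤ X → (deriv H (x₀ + σ * X) = 0 ↔ X = 0)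
  far : ∃ X > 0, 0 < -σ * deriv H (x₀ + σ * X)

theorem isEnd_minus : h.IsEnd (-1) (-(3 / 2)) (Iio (-1)) h.hminus where
  sign := .inr rfl
  isOpen := isOpen_Iio
  eq_on j z hz := h.eq_hminus j z (le_of_lt hz)
  stay t j z ht hz hj := ⟨h.re_flow_lt ht hz hj, (h.flow_minus t ht j z (le_of_lt hz) hj).2⟩
  mem X hX := mem_Iio.2 (by linarith)
  notMem x hx hx' := absurd hx (not_lt.2 hx'.1)
  mem_of_flow_mem t j z ht hz hj hm := by
    rcases hz with hz | hz
    · exact hz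
    · have h1 := h.lt_re_flow ht hz hj
      have h2 : (h.φ t z).re < -1 := hm
      linarith
  critical X hX := by
    rw [h.hminus_critical _ (by linarith)]
    constructor <;> intro h1 <;> linarith
  far := by
    obtain ⟨c₀, c₁, hc, heq⟩ := h.hminus_linear
    refine ⟨3 / 2, by norm_num, ?_⟩
    have h1 : h.hminus =ᶠ[𝓝 (-3)] fun x => c₀ * x + c₁ := by
      filter_upwards [Iio_mem_nhds (show (-3 : ℝ) < -2 by norm_num)] with x hx using heq x hx
    have h2 : -(3 / 2) + -1 * (3 / 2) = (-3 : ℝ) := by norm_num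
    rw [h2, h1.deriv_eq]
    simpa using hc

theorem isEnd_plus : h.IsEnd 1 (5 / 2) (Ioi 2) h.hplus where
  sign := .inl rfl
  isOpen := isOpen_Ioi
  eq_on j z hz := h.eq_hplus j z (le_of_lt hz)
  stay t j z ht hz hj := ⟨h.lt_re_flow ht hz hj, (h.flow_plus t ht j z (le_of_lt hz) hj).2⟩
  mem X hX := mem_Ioi.2 (by linarith)
  notMem x hx hx' := absurd hx (not_lt.2 hx'.2)
  mem_of_flow_mem t j z ht hz hj hm := by
    rcases hz with hz | hz
    · have h1 := h.re_flow_lt ht hz hj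
      have h2 : 2 < (h.φ t z).re := hm
      linarith
    · exact hz
  critical X hX := by
    rw [h.hplus_critical _ (by linarith)]
    constructor <;> intro h1 <;> linarith
  far := by
    obtain ⟨c₀, c₁, hc, heq⟩ := h.hplus_linear
    refine ⟨3 / 2, by norm_num, ?_⟩
    have h1 : h.hplus =ᶠ[𝓝 4] fun x => c₀ * x + c₁ := by
      filter_upwards [Ioi_mem_nhds (show (3 : ℝ) < 4 by norm_num)] with x hx using heq x hx
    have h2 : 5 / 2 + 1 * (3 / 2) = (4 : ℝ) := by norm_num
    rw [h2, h1.deriv_eq]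
    simpa using hc

namespace IsEnd

variable {h} {σ x₀ : ℝ} {S : Set ℝ} {H : ℝ → ℝ}

theorem sq (hs : h.IsEnd σ x₀ S H) : σ * σ = 1 := by
  rcases hs.sign with rfl | rfl <;> norm_num

theorem hasDerivAt (hs : h.IsEnd σ x₀ S H) {x : ℝ} (hx : x ∈ S) :
    HasDerivAt H (fderiv ℝ h.h x 1) x := by
  have h1 : HasDerivAt (fun y : ℝ => h.h y) (fderiv ℝ h.h x 1) x :=
    (h.differentiableAt_h (x : ℂ)).hasFDerivAt.comp_hasDerivAt x Complex.ofRealCLM.hasDerivAt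
  refine h1.congr_of_eventuallyEq ?_
  filter_upwards [hs.isOpen.mem_nhds hx] with y hy
  have := hs.eq_on 0 y hy (by simpa using (half_pos h.ε_pos).le)
  exact this.symm

theorem continuousOn_deriv (hs : h.IsEnd σ x₀ S H) : ContinuousOn (deriv H) S := by
  have h1 : Continuous fun x : ℝ => fderiv ℝ h.h x 1 :=
    ((h.smooth.continuous_fderiv (by simp)).comp Complex.continuous_ofReal).clm_apply
      continuous_const
  exact h1.continuousOn.congr fun x hx => (hs.hasDerivAt hx).deriv

theorem planarHamVF_eq (hs : h.IsEnd σ x₀ S H) {z : ℂ} {j : ℤ} (hz : z.re ∈ S)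
    (hj : |z.im - j| ≤ h.ε / 2) : planarHamVF h.h z = ⟨0, deriv H z.re⟩ := by
  have hε := h.ε_pos
  have key : EqOn (fun y : ℝ => planarHamVF h.h ⟨z.re, y⟩) (fun _ => ⟨0, deriv H z.re⟩)
      (Ioo (j - h.ε / 2) (j + h.ε / 2)) := by
    intro y hy
    have h1 : h.h =ᶠ[𝓝 ⟨z.re, y⟩] fun w => H w.re := by
      have h2 : S ×ℂ Ioo (j - h.ε / 2) (j + h.ε / 2) ∈ 𝓝 (⟨z.re, y⟩ : ℂ) :=
        (hs.isOpen.reProdIm isOpen_Ioo).mem_nhds ⟨hz, hy⟩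
      filter_upwards [h2] with w hw
      refine hs.eq_on j w hw.1 ?_
      have hw2 : w.im ∈ Ioo (j - h.ε / 2) (j + h.ε / 2) := hw.2
      rw [abs_le]; constructor <;> linarith [hw2.1, hw2.2]
    have h3 : HasFDerivAt (fun w : ℂ => H w.re) (deriv H z.re • Complex.reCLM) ⟨z.re, y⟩ :=
      (hs.hasDerivAt hz).differentiableAt.hasDerivAt.comp_hasFDerivAt (⟨z.re, y⟩ : ℂ)
        Complex.reCLM.hasFDerivAt
    simp only
    rw [planarHamVF_congr h1]
    unfold planarHamVF
    rw [h3.fderiv]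
    simp
  have hcont : Continuous fun y : ℝ => planarHamVF h.h ⟨z.re, y⟩ := by
    refine h.contDiff_field.continuous.comp ?_
    have : (fun y : ℝ => (⟨z.re, y⟩ : ℂ)) = fun y : ℝ => (z.re : ℂ) + y * Complex.I :=
      funext fun y => Complex.mk_eq_add_mul_I _ _
    change Continuous fun y : ℝ => (⟨z.re, y⟩ : ℂ)
    rw [this]; fun_prop
  have := key.closure hcont continuous_const
  rw [closure_Ioo (by linarith)] at this
  rw [abs_le] at hj
  exact this ⟨by linarith [hj.1], by linarith [hj.2]⟩

/-- On the horizontal lines at integer heights the flow of the profile function is explicit. -/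
theorem flow_eq (hs : h.IsEnd σ x₀ S H) {z : ℂ} {j : ℤ} (hz : z.re ∈ S) (hj : z.im = j) {t : ℝ}
    (ht : t ∈ Icc (-1 : ℝ) 1) : h.φ t z = ⟨z.re, j + t * deriv H z.re⟩ := by
  have hX : ∀ s ∈ Icc (-1 : ℝ) 1, HasDerivWithinAt (fun s => h.φ s z)
      ⟨0, deriv H (h.φ s z).re⟩ (Icc (-1) 1) s := by
    intro s hsI
    obtain ⟨h1, h2⟩ := hs.stay s j z hsI hz hj
    rw [← hs.planarHamVF_eq h1 h2]
    exact (h.flow_deriv z s).hasDerivWithinAt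
  have h0 : (0 : ℝ) ∈ Icc (-1 : ℝ) 1 := by norm_num
  have hre : ∀ s ∈ Icc (-1 : ℝ) 1, (h.φ s z).re = z.re := by
    intro s hsI
    have := (convex_Icc (-1 : ℝ) 1).norm_image_sub_le_of_norm_hasDerivWithin_le
      (f := fun s => (h.φ s z).re) (f' := fun _ => 0) (C := 0)
      (fun r hr => Complex.reCLM.hasFDerivAt.comp_hasDerivWithinAt r (hX r hr)) (by simp) h0 hsI
    rw [zero_mul, norm_le_zero_iff, sub_eq_zero, h.flow_zero] at this
    exact this
  have him := (convex_Icc (-1 : ℝ) 1).norm_image_sub_le_of_norm_hasDerivWithin_le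
    (f := fun s => (h.φ s z).im - s * deriv H z.re) (f' := fun _ => 0) (C := 0)
    (fun r hr => by
      have h1 := Complex.imCLM.hasFDerivAt.comp_hasDerivWithinAt r (hX r hr)
      have h2 := h1.sub ((hasDerivWithinAt_id r _).mul_const (deriv H z.re))
      refine HasDerivWithinAt.congr_deriv (f := fun s => (h.φ s z).im - s * deriv H z.re) h2 ?_
      simp [hre r hr]) (by simp) h0 ht
  have him' := norm_le_zero_iff.1 (him.trans_eq (zero_mul _))
  simp only [sub_eq_zero, h.flow_zero, zero_mul, sub_zero, hj] at him'
  refine Complex.ext (hre t ht) ?_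
  linarith

/-- The flow moves the points of the horizontal lines by at most `ε / 2` in unit time. -/
theorem abs_deriv_le (hs : h.IsEnd σ x₀ S H) {x : ℝ} (hx : x ∈ S) : |deriv H x| ≤ 1 / 8 := by
  have h1 := hs.stay 1 0 x (by norm_num) hx (by simp)
  rw [hs.flow_eq hx (j := 0) (by simp) (by norm_num)] at h1
  have h2 := h1.2
  simp at h2
  linarith [h.ε_lt]

/-- Beyond the bottleneck `H` has no critical point, and far out it decreases in the outward
direction. -/
theorem deriv_nonneg (hs : h.IsEnd σ x₀ S H) {X : ℝ} (hX : 0 ≤ X) :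
    0 ≤ -σ * deriv H (x₀ + σ * X) := by
  have hσ : σ ≠ 0 := by rcases hs.sign with rfl | rfl <;> norm_num
  obtain ⟨X₁, hX₁, hpos⟩ := hs.far
  rcases hX.eq_or_lt with rfl | hX
  · rw [(hs.critical 0 le_rfl).2 rfl, mul_zero]
  by_contra! hneg
  have hc : ContinuousOn (fun X => -σ * deriv H (x₀ + σ * X)) (Ioi 0) :=
    continuousOn_const.mul (hs.continuousOn_deriv.comp (by fun_prop) fun Y hY => hs.mem Y (by
      have : (0 : ℝ) < Y := hY
      linarith))
  obtain ⟨Y, hY, hY0⟩ := isPreconnected_Ioi.intermediate_value (show X ∈ Ioi 0 from hX)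
    (show X₁ ∈ Ioi 0 from hX₁) hc ⟨hneg.le, hpos.le⟩
  have hY' : (0 : ℝ) < Y := hY
  have : deriv H (x₀ + σ * Y) = 0 := by
    rcases mul_eq_zero.1 hY0 with h1 | h1
    · exact absurd (neg_eq_zero.1 h1) hσ
    · exact h1
  exact hY'.ne' ((hs.critical Y hY'.le).1 this)

end IsEnd

end ProfileFunction

/-- The shape of the projection to `ℂ` of a Lagrangian cobordism outside of `[-1,2] × ℝ`. -/
def IsCylindrical (P : Set ℂ) : Prop :=
  ∀ w ∈ P, w.re ∈ Icc (-1 : ℝ) 2 ∨ ((w.re < -1 ∨ 2 < w.re) ∧ ∃ j : ℤ, w.im = j)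

namespace ProfileFunction.IsEnd

variable {h : ProfileFunction} {σ x₀ : ℝ} {S : Set ℝ} {H : ℝ → ℝ} {P : Set ℂ}

/-- Boundary values of a straightened map lie on displaced horizontal lines over the end. -/
theorem exists_flow_eq (hs : h.IsEnd σ x₀ S H) (hP : IsCylindrical P) {w : ℂ} (hw : w ∈ P) {s : ℝ}
    (hsI : s ∈ Icc (0 : ℝ) 1) (hre : (h.φ (-s) w).re ∈ S) :
    ∃ j : ℤ, (h.φ (-s) w).im = j - s * deriv H (h.φ (-s) w).re := by
  have hs' : -s ∈ Icc (-1 : ℝ) 1 := ⟨by linarith [hsI.2], by linarith [hsI.1]⟩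
  rcases hP w hw with hr | ⟨hr, j, hj⟩
  · rw [h.flow_eq_self hr] at hre
    exact absurd hr (hs.notMem _ hre)
  · have hwS := hs.mem_of_flow_mem (-s) j w hs' hr hj hre
    refine ⟨j, ?_⟩
    rw [hs.flow_eq hwS hj hs']
    ring

variable {k : ℕ} {c : Config k} {κ : ℤˣ} {i : Fin (k + 1)} {e : ℂ → ℂ} {v : ℂ → ℂ} {B : Set ℂ}
  {Λ : Fin (k + 1) → Set ℂ}

/-- A map with the properties of the straightened map of a solution does not cross the bottleneck at
`x₀`. In the outward coordinate its boundary values lie in the wedges of the function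
`F X = -σ H'(x₀ + σ X)`, since the backward flow for time `s` moves a horizontal line vertically by
`-s H'`. -/
theorem outward_nonpos (hs : h.IsEnd σ x₀ S H) (hP : IsCylindrical P)
    (hv : IsHolomorphicOff c v B Λ) {η : ℝ} (hη : 0 < η) (hη4 : η ≤ 1 / 4)
    (hB : ∀ p ∈ B, σ * (p.re - x₀) ≤ -η) {a : ℂ → ℝ} (ha : ∀ z ∈ fibre c, a z ∈ Icc (0 : ℝ) 1)
    (hbd : ∀ z ∈ fibre c, ‖z‖ = 1 → ∃ w ∈ P, v z = h.φ (-(a z)) w)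
    (hΛ : ∀ i, ∀ p ∈ Λ i, p ∈ B ∨ ∃ w ∈ P, ∃ s ∈ Icc (0 : ℝ) 1, p = h.φ (-s) w)
    (he : IsStripLikeEnd c κ i e)
    (hae : ∀ w ∈ halfStrip κ, 1 ≤ sgn κ * w.re → a (e w) = orient κ w.im) {ℓ : ℝ → ℂ}
    (hℓ : ∀ t₀ ∈ Icc (0 : ℝ) 1, Tendsto (fun q : ℝ × ℝ => v (e ⟨q.1, q.2⟩))
      (endFilter κ ×ˢ 𝓝[Icc 0 1] t₀) (𝓝 (ℓ t₀)))
    (hpinch : (∀ t ∈ Icc (0 : ℝ) 1, ℓ t ∉ B) → ∃ p : ℂ, (∀ t ∈ Icc (0 : ℝ) 1, ℓ t = p) ∧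
      (∃ w ∈ P, p = h.φ (-0) w) ∧ ∃ w ∈ P, p = h.φ (-1) w) :
    ∀ z ∈ fibre c, σ * ((v z).re - x₀) ≤ 0 := by
  let T : ℂ → ℂ := fun p => σ * (p - x₀)
  have hTc : Continuous T := by fun_prop
  have hTre : ∀ p, (T p).re = σ * (p.re - x₀) := fun p => by simp [T]
  have hTim : ∀ p, (T p).im = σ * p.im := fun p => by simp [T]
  have hx : ∀ p : ℂ, p.re = x₀ + σ * (σ * (p.re - x₀)) := fun p => by
    rw [← mul_assoc, hs.sq]; ring
  have hmemS : ∀ p : ℂ, -η < σ * (p.re - x₀) → p.re ∈ S := fun p hp => by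
    rw [hx p]; exact hs.mem _ (by linarith)
  have hσj : ∀ j : ℤ, ∃ j' : ℤ, (j' : ℝ) = σ * j := fun j => by
    rcases hs.sign with rfl | rfl
    · exact ⟨j, by simp⟩
    · exact ⟨-j, by simp⟩
  let F : ℝ → ℝ := fun X => -σ * deriv H (x₀ + σ * X)
  have hTB : ∀ p ∈ T '' B, p.re ≤ -η := by
    rintro _ ⟨p, hp, rfl⟩
    rw [hTre]; exact hB p hp
  have hwedge : ∀ w ∈ P, ∀ s ∈ Icc (0 : ℝ) 1, -η < (T (h.φ (-s) w)).re →
      ∃ j : ℤ, (T (h.φ (-s) w)).im = j + s * F (T (h.φ (-s) w)).re := by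
    intro w hw s hsI hr
    rw [hTre] at hr
    obtain ⟨j, hj⟩ := hs.exists_flow_eq hP hw hsI (hmemS _ hr)
    obtain ⟨j', hj'⟩ := hσj j
    refine ⟨j', ?_⟩
    rw [hTim, hTre, hj', hj]
    simp only [F]
    rw [← hx]
    ring
  have hF0 : F 0 = 0 := by
    simp only [F]; rw [(hs.critical 0 le_rfl).2 rfl, mul_zero]
  have hFc : ContinuousAt F 0 := by
    have h1 : ContinuousAt (deriv H) (x₀ + σ * 0) :=
      hs.continuousOn_deriv.continuousAt (hs.isOpen.mem_nhds (hs.mem 0 (by norm_num)))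
    exact continuousAt_const.mul (ContinuousAt.comp (f := fun X => x₀ + σ * X) h1 (by fun_prop))
  have hF1 : ∀ X > -η, |F X| ≤ 1 / 8 := by
    intro X hX
    have h1 : |σ| = 1 := by rcases hs.sign with rfl | rfl <;> simp
    simp only [F]
    rw [abs_mul, abs_neg, h1, one_mul]
    exact hs.abs_deriv_le (hs.mem X (by linarith))
  have hTinj : ∀ p, (σ : ℂ) * T p + x₀ = p := fun p => by
    have : (σ : ℂ) * σ = 1 := by exact_mod_cast hs.sq
    simp only [T]
    rw [← mul_assoc, this]; ring
  have hg : IsHolomorphicOff c (fun z => T (v z)) (T '' B) (fun i => T '' Λ i) :=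
    { norm_puncture := hv.norm_puncture
      continuousOn := hTc.comp_continuousOn hv.continuousOn
      isClosed := by
        have : T '' B = (fun p : ℂ => (σ : ℂ) * p + x₀) ⁻¹' B := by
          ext p
          constructor
          · rintro ⟨q, hq, rfl⟩
            simpa [hTinj q] using hq
          · intro hp
            refine ⟨_, hp, ?_⟩
            have : (σ : ℂ) * σ = 1 := by exact_mod_cast hs.sq
            simp only [T, add_sub_cancel_right]
            rw [← mul_assoc, this, one_mul]
        rw [this]
        exact hv.isClosed.preimage (by fun_prop)
      differentiableAt := fun z hz hB =>
        ((hv.differentiableAt z hz fun h => hB ⟨_, h, rfl⟩).sub_const _).const_mul _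
      isCompact := fun i => (hv.isCompact i).image hTc
      tendsto := fun i =>
        (hTc.tendsto_nhdsSet (mapsTo_image T (Λ i))).comp (hv.tendsto i) }
  have main := hg.re_nonpos (F := F) (ℓ := fun t => T (ℓ t)) hη hFc hF0 hF1
    (fun X hX => hs.deriv_nonneg hX) hTB ?_ ?_ he
    (fun t₀ ht₀ => (hTc.tendsto _).comp (hℓ t₀ ht₀)) ?_ ?_
  · intro z hz
    have := main z hz
    rwa [hTre] at this
  · intro z hz h1 hr
    obtain ⟨w, hw, hwz⟩ := hbd z hz h1
    rw [hwz] at hr ⊢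
    obtain ⟨j, hj⟩ := hwedge w hw _ (ha z hz) hr
    exact ⟨j, _, ha z hz, hj⟩
  · rintro i _ ⟨p, hp, rfl⟩ hr
    rcases hΛ i p hp with hpB | ⟨w, hw, s, hsI, rfl⟩
    · exact absurd (hTB _ ⟨p, hpB, rfl⟩) (not_le.2 hr)
    · obtain ⟨j, hj⟩ := hwedge w hw s hsI hr
      exact ⟨j, s, hsI, hj⟩
  · intro hnn
    obtain ⟨p, hp, ⟨w₀, hw₀, hp₀⟩, w₁, hw₁, hp₁⟩ := hpinch fun t ht hB' => by
      have h1 := hTB _ ⟨_, hB', rfl⟩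
      have h2 := hnn t ht
      linarith
    have hX : 0 ≤ σ * (p.re - x₀) := by
      have := hnn 0 (by simp)
      rwa [hp 0 (by simp), hTre] at this
    have hpS := hmemS p (by linarith)
    obtain ⟨j₀, hj₀⟩ := hs.exists_flow_eq hP hw₀ (s := 0) (by simp) (by rw [← hp₀]; exact hpS)
    obtain ⟨j₁, hj₁⟩ := hs.exists_flow_eq hP hw₁ (s := 1) (by simp) (by rw [← hp₁]; exact hpS)
    rw [← hp₀, zero_mul, sub_zero] at hj₀
    rw [← hp₁, one_mul] at hj₁
    -- `deriv H` is small and equal to the integer `j₁ - j₀`, hence zero.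
    have hd := hs.abs_deriv_le hpS
    rw [abs_le] at hd
    have h4 : (j₁ : ℝ) < (j₀ + 1 : ℤ) := by push_cast; linarith [hd.2]
    have h5 : (j₀ : ℝ) < (j₁ + 1 : ℤ) := by push_cast; linarith [hd.1]
    have h4' : j₁ < j₀ + 1 := by exact_mod_cast h4
    have h5' : j₀ < j₁ + 1 := by exact_mod_cast h5
    obtain rfl : j₁ = j₀ := by omega
    have hd0 : deriv H (x₀ + σ * (σ * (p.re - x₀))) = 0 := by rw [← hx]; linarith
    have hX0 := (hs.critical _ hX).1 hd0
    obtain ⟨j', hj'⟩ := hσj j₁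
    refine ⟨j', fun t ht => ?_⟩
    rw [hp t ht]
    refine Complex.ext ?_ ?_
    · rw [hTre, hX0]; simp
    · rw [hTim, hj₀, ← hj']; simp
  · intro w hw hw1 _ hr
    have hmem := he.mapsTo hw
    have hn : ‖e w‖ = 1 := (he.boundary w hw).2 ‹_›
    obtain ⟨y, hy, hyz⟩ := hbd _ hmem hn
    rw [← hae w hw hw1]
    rw [hyz] at hr ⊢
    exact hwedge y hy _ (ha _ hmem) hr

end ProfileFunction.IsEnd

/-! ### Projections of Lagrangian cobordisms -/

section Cobordism

variable {E : Type*} [NormedAddCommGroup E] [NormedSpace ℝ E]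
  {M : Type*} [TopologicalSpace M] [ChartedSpace E M] [IsManifold 𝓘(ℝ, E) ∞ M]
  {Ω : SymplecticForm E M} {W : Set (ℂ × M)}

theorem IsLagrangianCobordism.isCylindrical (hW : IsLagrangianCobordism Ω W) :
    IsCylindrical (Prod.fst '' W) := by
  obtain ⟨-, -, r, s, L, L', ε, hε, -, -, hr, hl⟩ := hW
  rintro _ ⟨p, hp, rfl⟩
  rcases lt_or_ge p.1.re (-1) with h1 | h1
  · have : p ∈ W ∩ {p | p.1.re < ε} := ⟨hp, by change p.1.re < ε; linarith⟩
    rw [hl] at this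
    obtain ⟨-, j, hj, -⟩ := this
    exact .inr ⟨.inl h1, (j : ℕ) + 1, by rw [hj]; push_cast; rfl⟩
  rcases lt_or_ge 2 p.1.re with h2 | h2
  · have : p ∈ W ∩ {p | 1 - ε < p.1.re} := ⟨hp, by change 1 - ε < p.1.re; linarith⟩
    rw [hr] at this
    obtain ⟨-, j, hj, -⟩ := this
    exact .inr ⟨.inr h2, (j : ℕ) + 1, by rw [hj]; push_cast; rfl⟩
  · exact .inl ⟨h1, h2⟩

theorem IsLagrangianCobordism.exists_abs_im_le (hW : IsLagrangianCobordism Ω W) :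
    ∃ R : ℝ, ∀ p ∈ W, |p.1.im| ≤ R := by
  obtain ⟨-, hK, r, s, L, L', ε, hε, -, -, hr, hl⟩ := hW
  obtain ⟨R, hR⟩ := (hK.image (continuous_abs.comp
    (Complex.continuous_im.comp (continuous_fst (X := ℂ) (Y := M))))).bddAbove
  have key : ∀ n : ℕ, ∀ j : Fin n, |((j : ℕ) : ℝ) + 1| ≤ n := fun n j => by
    rw [abs_of_nonneg (by positivity)]
    exact_mod_cast j.2
  refine ⟨max R (max r s), fun p hp => ?_⟩
  by_cases h1 : p.1.re < ε
  · have : p ∈ W ∩ {p | p.1.re < ε} := ⟨hp, h1⟩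
    rw [hl] at this
    obtain ⟨-, j, hj, -⟩ := this
    rw [hj]
    exact (key s j).trans ((le_max_right _ _).trans (le_max_right _ _))
  by_cases h2 : 1 - ε < p.1.re
  · have : p ∈ W ∩ {p | 1 - ε < p.1.re} := ⟨hp, h2⟩
    rw [hr] at this
    obtain ⟨-, j, hj, -⟩ := this
    rw [hj]
    exact (key r j).trans ((le_max_left _ _).trans (le_max_right _ _))
  · exact (hR ⟨p, ⟨hp, by linarith, by linarith⟩, rfl⟩).trans (le_max_left _ _)

end Cobordism

/-! ### The region swept out by the flow -/

namespace ProfileFunction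

variable (h : ProfileFunction)

theorem flow_re_mem {z : ℂ} (t : ℝ) (hz : z.re ∈ Icc (-(3 / 2) : ℝ) (5 / 2)) :
    (h.φ t z).re ∈ Icc (-(3 / 2) : ℝ) (5 / 2) := by
  have : h.φ t z ∈ h.φ t '' {z | z.re ∈ Icc (-(3 / 2) : ℝ) (5 / 2)} := ⟨z, hz, rfl⟩
  rwa [h.flow_strip] at this

/-- The flow consists of homeomorphisms that preserve the closed strip, hence its interior. -/
theorem flow_re_mem_Ioo {z : ℂ} (t : ℝ) (hz : z.re ∈ Ioo (-(3 / 2) : ℝ) (5 / 2)) :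
    (h.φ t z).re ∈ Ioo (-(3 / 2) : ℝ) (5 / 2) := by
  have hc : Continuous fun w => h.φ (-t) w :=
    (h.isFlow.continuous_uncurry h.contDiff_field).comp (by fun_prop : Continuous fun w : ℂ => (-t, w))
  let U : Set ℂ := {w | (h.φ (-t) w).re ∈ Ioo (-(3 / 2) : ℝ) (5 / 2)}
  have hU : IsOpen U := isOpen_Ioo.preimage (Complex.continuous_re.comp hc)
  have hsub : U ⊆ Complex.re ⁻¹' Icc (-(3 / 2) : ℝ) (5 / 2) := fun w hw => by
    have := h.flow_re_mem t (Ioo_subset_Icc_self hw)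
    rwa [h.isFlow.cancel_neg h.contDiff_field_one] at this
  have hmem : h.φ t z ∈ U := by
    change (h.φ (-t) (h.φ t z)).re ∈ Ioo (-(3 / 2) : ℝ) (5 / 2)
    rwa [h.isFlow.neg_cancel h.contDiff_field_one]
  have := interior_maximal hsub hU hmem
  rwa [Complex.interior_preimage_re, interior_Icc] at this

/-- The region swept out by `K` under the backward flow during unit time. The straightened map of
a solution can fail to be holomorphic only where its value lies in this region. -/
def backward (K : Set ℂ) : Set ℂ := (fun q : ℝ × ℂ => h.φ (-q.1) q.2) '' (Icc 0 1 ×ˢ K)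

variable {h} {K : Set ℂ}

theorem mem_backward {s : ℝ} (hs : s ∈ Icc (0 : ℝ) 1) {p : ℂ} (hp : p ∈ K) :
    h.φ (-s) p ∈ h.backward K := ⟨(s, p), ⟨hs, hp⟩, rfl⟩

theorem isCompact_backward (hK : IsCompact K) : IsCompact (h.backward K) :=
  (isCompact_Icc.prod hK).image ((h.isFlow.continuous_uncurry h.contDiff_field).comp
    (by fun_prop : Continuous fun q : ℝ × ℂ => (-q.1, q.2)))

theorem exists_margin (hK : IsCompact K) (hsub : K ⊆ {z | z.re ∈ Ioo (-(3 / 2) : ℝ) (5 / 2)}) :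
    ∃ η > 0, η ≤ (1 / 4 : ℝ) ∧ ∀ p ∈ h.backward K, -(3 / 2) + η ≤ p.re ∧ p.re ≤ 5 / 2 - η := by
  have hd : ∀ p ∈ h.backward K, 0 < min (p.re + 3 / 2) (5 / 2 - p.re) := by
    rintro _ ⟨⟨s, p⟩, ⟨-, hp⟩, rfl⟩
    obtain ⟨h1, h2⟩ := h.flow_re_mem_Ioo (-s) (hsub hp)
    exact lt_min (by simp only; linarith) (by simp only; linarith)
  have hc : Continuous fun p : ℂ => min (p.re + 3 / 2) (5 / 2 - p.re) := by fun_prop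
  obtain ⟨η, hη, hle⟩ := (isCompact_backward hK).exists_forall_le' hc.continuousOn hd
  refine ⟨min η (1 / 4), lt_min hη (by norm_num), min_le_right _ _, fun p hp => ?_⟩
  have h1 := hle p hp
  have h2 := min_le_left η (1 / 4)
  rw [le_min_iff] at h1
  exact ⟨by linarith [h1.1], by linarith [h1.2]⟩

theorem abs_im_flow_le {P : Set ℂ} (hP : IsCylindrical P) {w : ℂ} (hw : w ∈ P) {s : ℝ}
    (hs : s ∈ Icc (0 : ℝ) 1) : |(h.φ (-s) w).im| ≤ |w.im| + 1 := by
  have hs' : -s ∈ Icc (-1 : ℝ) 1 := ⟨by linarith [hs.2], by linarith [hs.1]⟩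
  have hε := h.ε_lt
  rcases hP w hw with hr | ⟨hr | hr, j, hj⟩
  · rw [h.flow_eq_self hr]; linarith
  · have h1 := (h.flow_minus (-s) hs' j w hr.le hj).2
    rw [hj]
    linarith [abs_sub_abs_le_abs_sub (h.φ (-s) w).im j]
  · have h1 := (h.flow_plus (-s) hs' j w hr.le hj).2
    rw [hj]
    linarith [abs_sub_abs_le_abs_sub (h.φ (-s) w).im j]

end ProfileFunction

/-! ### Confinement of solutions -/

theorem startOf_subset {M : Type*} {k : ℕ} {W : Fin (k + 1) → Set (ℂ × M)} {inputs : Finset (Fin (k + 1))}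
    (i : Fin (k + 1)) : startOf W inputs i ⊆ ⋃ i, W i := by
  unfold startOf
  split_ifs <;> exact subset_iUnion W _

theorem endOf_subset {M : Type*} {k : ℕ} {W : Fin (k + 1) → Set (ℂ × M)} {inputs : Finset (Fin (k + 1))}
    (i : Fin (k + 1)) : endOf W inputs i ⊆ ⋃ i, W i := by
  unfold endOf
  split_ifs <;> exact subset_iUnion W _

section Confinement

variable {E : Type*} [NormedAddCommGroup E] [NormedSpace ℝ E]
  {M : Type*} [TopologicalSpace M] [ChartedSpace E M] [IsManifold 𝓘(ℝ, E) ∞ M]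
  {Ω : SymplecticForm E M} {h : ProfileFunction} {k : ℕ} {𝒮 : DiscFamily k}
  {W : Fin (k + 1) → Set (ℂ × M)} {inputs : Finset (Fin (k + 1))} {α : Fin (k + 1) → ℤˣ}
  {F : ∀ i, FloerDatum Ω h (startOf W inputs i) (endOf W inputs i) (α i)}
  {e : Fin (k + 1) → Config k → ℂ → ℂ} {a : Config k → ℂ → ℝ} {D : PerturbationPair E M k}
  {c : Config k} {u : ℂ → ℂ × M} {γ : Fin (k + 1) → ℝ → ℂ × M}

theorem IsSolution.isHolomorphicOff [FiniteDimensional ℝ E]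
    (hu : IsSolution Ω h W inputs α F e D c u) (he : IsStripLikeEnds 𝒮 inputs e)
    (ha : IsTransitionFunction 𝒮 inputs α e a)
    (hD : IsPerturbationDatum 𝒮 Ω h W inputs α F e a D) (hc : c ∈ 𝒮.configs)
    (hγ : ∀ i, γ i ∈ chords Ω (F i).H (startOf W inputs i) (endOf W inputs i))
    (hlim : ∀ i, ∀ t₀ ∈ Icc (0 : ℝ) 1, Tendsto (fun q : ℝ × ℝ => u (e i c ⟨q.1, q.2⟩))
      (endFilter (kappa inputs i) ×ˢ 𝓝[Icc 0 1] t₀) (𝓝 (γ i t₀))) :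
    IsHolomorphicOff c (straighten h (a c) u) (h.backward D.K)
      fun i => chordLimit h (α i) (γ i) '' Icc 0 1 where
  norm_puncture := (DiscFamily.isClockwise hc).norm_eq_one
  continuousOn := hu.continuousOn_straighten (ha.contDiffOn_fibre hc).continuousOn
  isClosed := (ProfileFunction.isCompact_backward hD.K_compact).isClosed
  differentiableAt z hz hB := by
    refine hu.differentiableAt_straighten hD ha hc hz fun hK => hB ?_
    exact ProfileFunction.mem_backward (ha.range c hc z (ball_subset_fibre
      (DiscFamily.isClockwise hc).norm_eq_one (mem_ball_zero_iff.2 hz))) hK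
  isCompact i := isCompact_Icc.image_of_continuousOn (continuousOn_chordLimit (hγ i).1 (α i))
  tendsto i := (he.isEnd i c hc).tendsto_nhdsSet (DiscFamily.isClockwise hc).norm_eq_one
    fun t₀ ht₀ => tendsto_straighten ha hc (hlim i t₀ ht₀)

theorem IsSolution.exists_straighten_eq (hu : IsSolution Ω h W inputs α F e D c u)
    (hc : c ∈ 𝒮.configs) {z : ℂ} (hz : z ∈ fibre c) (h1 : ‖z‖ = 1) :
    ∃ w ∈ Prod.fst '' ⋃ i, W i, straighten h (a c) u z = h.φ (-(a c z)) w := by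
  obtain ⟨i, hi⟩ := (DiscFamily.isClockwise hc).exists_mem_clockwiseArc hz h1
  exact ⟨_, ⟨u z, mem_iUnion.2 ⟨i, hu.boundary i z hi⟩, rfl⟩, rfl⟩

/-- The limit of the straightened map along an end either meets the region swept out by `K`, or lies
on the curve swept out by the boundary conditions. -/
theorem chordLimit_mem_or [FiniteDimensional ℝ E]
    (hD : IsPerturbationDatum 𝒮 Ω h W inputs α F e a D) {i : Fin (k + 1)} {γ : ℝ → ℂ × M}
    (hγ : γ ∈ chords Ω (F i).H (startOf W inputs i) (endOf W inputs i)) {t : ℝ}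
    (ht : t ∈ Icc (0 : ℝ) 1) :
    chordLimit h (α i) γ t ∈ h.backward D.K ∨ ∃ w ∈ Prod.fst '' ⋃ i, W i,
      ∃ s ∈ Icc (0 : ℝ) 1, chordLimit h (α i) γ t = h.φ (-s) w := by
  rcases chordLimit_eq_or (F i) hγ.1 ht with ⟨t', ht', hK, heq⟩ | heq
  · left
    rw [heq]
    exact ProfileFunction.mem_backward (orient_mem ht') (hD.K_supset i hK)
  · right
    exact ⟨_, ⟨γ 1, endOf_subset i hγ.2.2, rfl⟩, _, orient_mem (by simp), heq⟩

/-- A chord that avoids the region swept out by `K` has a constant straightened projection, and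
this constant lies on the undisplaced and on the fully displaced boundary condition. -/
theorem exists_chordLimit_eq [FiniteDimensional ℝ E]
    (hD : IsPerturbationDatum 𝒮 Ω h W inputs α F e a D) {i : Fin (k + 1)} {γ : ℝ → ℂ × M}
    (hγ : γ ∈ chords Ω (F i).H (startOf W inputs i) (endOf W inputs i))
    (hB : ∀ t ∈ Icc (0 : ℝ) 1, chordLimit h (α i) γ t ∉ h.backward D.K) :
    ∃ p : ℂ, (∀ t ∈ Icc (0 : ℝ) 1, chordLimit h (α i) γ t = p) ∧
      (∃ w ∈ Prod.fst '' ⋃ i, W i, p = h.φ (-0) w) ∧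
      ∃ w ∈ Prod.fst '' ⋃ i, W i, p = h.φ (-1) w := by
  have hconst : ∀ t ∈ Icc (0 : ℝ) 1, chordLimit h (α i) γ t = chordLimit h (α i) γ 1 := by
    intro t ht
    refine (chordLimit_eq_or (F i) hγ.1 ht).resolve_left ?_
    rintro ⟨t', ht', hK, -⟩
    exact hB t' ht' (ProfileFunction.mem_backward (orient_mem ht') (hD.K_supset i hK))
  have h0 := (hconst 0 (by simp)).symm
  have hs : (γ 0).1 ∈ Prod.fst '' ⋃ i, W i := ⟨γ 0, startOf_subset i hγ.2.1, rfl⟩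
  have ht : (γ 1).1 ∈ Prod.fst '' ⋃ i, W i := ⟨γ 1, endOf_subset i hγ.2.2, rfl⟩
  refine ⟨_, hconst, ?_⟩
  by_cases hα : α i = 1
  · exact ⟨⟨_, hs, by rw [h0]; simp [chordLimit, orient, hα]⟩, _, ht, by
      simp [chordLimit, orient, hα]⟩
  · exact ⟨⟨_, ht, by simp [chordLimit, orient, hα]⟩, _, hs, by
      rw [h0]; simp [chordLimit, orient, hα]⟩

/-- A half-plane above or below `B` and all the boundary values is unbounded and convex, hence not
entered. -/
theorem IsHolomorphicOff.abs_im_le {v : ℂ → ℂ} {B : Set ℂ} {Λ : Fin (k + 1) → Set ℂ}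
    (hv : IsHolomorphicOff c v B Λ) {R : ℝ} (hB : ∀ p ∈ B, |p.im| ≤ R)
    (hbd : ∀ z ∈ fibre c, ‖z‖ = 1 → |(v z).im| ≤ R) (hΛ : ∀ i, ∀ p ∈ Λ i, |p.im| ≤ R) :
    ∀ z ∈ fibre c, |(v z).im| ≤ R := by
  have key : ∀ S : Set ℝ, IsOpen S → Convex ℝ S → S.Nonempty → (∀ y ∈ S, R < |y|) →
      ∀ z ∈ fibre c, v z ∉ Complex.im ⁻¹' S := by
    rintro S hS hSc ⟨y₀, hy₀⟩ hSR
    refine hv.notMem_of_unbounded (hS.preimage Complex.continuous_im)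
      (hSc.linear_preimage Complex.imLm).isPreconnected ?_ ?_ ?_ ?_
    · intro hb
      obtain ⟨r, hr⟩ := hb.exists_norm_le
      have h1 := (Complex.re_le_norm (⟨r + 1, y₀⟩ : ℂ)).trans (hr _ hy₀)
      simp only at h1
      linarith
    · exact disjoint_left.2 fun p hp hpB => (hSR _ hp).not_ge (hB p hpB)
    · exact fun z hz h1 hp => (hSR _ hp).not_ge (hbd z hz h1)
    · exact fun i => disjoint_left.2 fun p hp hpΛ => (hSR _ hp).not_ge (hΛ i p hpΛ)
  intro z hz
  by_contra! hlt
  rcases lt_abs.1 hlt with h1 | h1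
  · exact key (Ioi R) isOpen_Ioi (convex_Ioi R) nonempty_Ioi
      (fun y hy => lt_abs.2 (.inl hy)) z hz h1
  · exact key (Iio (-R)) isOpen_Iio (convex_Iio _) nonempty_Iio
      (fun y hy => lt_abs.2 (.inr (lt_neg.1 hy))) z hz (lt_neg.1 h1)

/-- The straightened map of a solution stays in the strip between the two bottlenecks, provided that on
some end the transition function is `t` for an output and `1 - t` for an input. -/
theorem IsSolution.straighten_re_mem [FiniteDimensional ℝ E]
    (hu : IsSolution Ω h W inputs α F e D c u) (he : IsStripLikeEnds 𝒮 inputs e)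
    (ha : IsTransitionFunction 𝒮 inputs α e a)
    (hD : IsPerturbationDatum 𝒮 Ω h W inputs α F e a D) (hc : c ∈ 𝒮.configs)
    (hP : IsCylindrical (Prod.fst '' ⋃ i, W i)) {i : Fin (k + 1)} (hi : α i = kappa inputs i)
    (hγ : ∀ i, γ i ∈ chords Ω (F i).H (startOf W inputs i) (endOf W inputs i))
    (hlim : ∀ i, ∀ t₀ ∈ Icc (0 : ℝ) 1, Tendsto (fun q : ℝ × ℝ => u (e i c ⟨q.1, q.2⟩))
      (endFilter (kappa inputs i) ×ˢ 𝓝[Icc 0 1] t₀) (𝓝 (γ i t₀))) {z : ℂ} (hz : z ∈ fibre c) :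
    (straighten h (a c) u z).re ∈ Icc (-(3 / 2) : ℝ) (5 / 2) := by
  obtain ⟨η, hη, hη4, hB⟩ := h.exists_margin hD.K_compact hD.K_subset
  have key : ∀ {σ x₀ : ℝ} {S : Set ℝ} {H : ℝ → ℝ}, h.IsEnd σ x₀ S H →
      (∀ p ∈ h.backward D.K, σ * (p.re - x₀) ≤ -η) →
      σ * ((straighten h (a c) u z).re - x₀) ≤ 0 := fun hs hBs =>
    hs.outward_nonpos hP (hu.isHolomorphicOff he ha hD hc hγ hlim) hη hη4 hBs (ha.range c hc)
      (fun z hz h1 => hu.exists_straighten_eq hc hz h1)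
      (by rintro j _ ⟨t, ht, rfl⟩; exact chordLimit_mem_or hD (hγ j) ht)
      (he.isEnd i c hc) (fun w hw hw1 => hi ▸ ha.far c hc i w hw hw1)
      (fun t₀ ht₀ => tendsto_straighten ha hc (hlim i t₀ ht₀))
      (exists_chordLimit_eq hD (hγ i)) z hz
  have h1 := key h.isEnd_minus fun p hp => by linarith [(hB p hp).1]
  have h2 := key h.isEnd_plus fun p hp => by linarith [(hB p hp).2]
  exact ⟨by linarith, by linarith⟩

end Confinement

end CobFloer

theorem mainTheorem2 {E : Type*} [NormedAddCommGroup E] [NormedSpace ℝ E] [FiniteDimensional ℝ E]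
    {M : Type*} [TopologicalSpace M] [CompactSpace M] [T2Space M] [ChartedSpace E M]
    [IsManifold 𝓘(ℝ, E) ∞ M] (Ω : CobFloer.SymplecticForm E M) (h : CobFloer.ProfileFunction)
    {k : ℕ} (𝒮 : CobFloer.DiscFamily k) (W : Fin (k + 1) → Set (ℂ × M))
    (hW : ∀ i, CobFloer.IsLagrangianCobordism Ω (W i))
    (inputs : Finset (Fin (k + 1))) (α : Fin (k + 1) → ℤˣ)
    (hα : CobFloer.Compatible inputs α)
    (F : ∀ i, CobFloer.FloerDatum Ω h (CobFloer.startOf W inputs i) (CobFloer.endOf W inputs i)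
      (α i))
    (D : CobFloer.PerturbationPair E M k) :
    ∃ C : ℝ, 0 < C ∧
      ∀ (e : Fin (k + 1) → CobFloer.Config k → ℂ → ℂ) (a : CobFloer.Config k → ℂ → ℝ),
        CobFloer.IsStripLikeEnds 𝒮 inputs e →
        CobFloer.IsTransitionFunction 𝒮 inputs α e a →
        CobFloer.IsPerturbationDatum 𝒮 Ω h W inputs α F e a D →
        ∀ c ∈ 𝒮.configs, ∀ u : ℂ → ℂ × M,
          CobFloer.IsSolution Ω h W inputs α F e D c u →
          ∀ z ∈ CobFloer.fibre c,
            (u z).1.re ∈ Icc (-(3 / 2) : ℝ) (5 / 2) ∧ (u z).1.im ∈ Icc (-C) C := by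
  -- The compactness of `D.K` is part of the hypothesis on `(e, a)`, but `C` has to be found before.
  by_cases hK : IsCompact D.K
  swap
  · exact ⟨1, one_pos, fun e a _ _ hD => absurd hD.K_compact hK⟩
  choose R hR using fun i => (hW i).exists_abs_im_le
  obtain ⟨R₁, hR₁⟩ := (finite_range R).bddAbove
  obtain ⟨R₂, hR₂⟩ := ((CobFloer.ProfileFunction.isCompact_backward (h := h) hK).image
    (continuous_abs.comp Complex.continuous_im)).bddAbove
  set R₃ := max (R₁ + 1) R₂
  have hP : CobFloer.IsCylindrical (Prod.fst '' ⋃ i, W i) := by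
    rintro _ ⟨p, hp, rfl⟩
    obtain ⟨i, hi⟩ := mem_iUnion.1 hp
    exact (hW i).isCylindrical _ ⟨p, hi, rfl⟩
  have hPR : ∀ w ∈ Prod.fst '' ⋃ i, W i, ∀ s ∈ Icc (0 : ℝ) 1, |(h.φ (-s) w).im| ≤ R₃ := by
    intro w hw s hs
    refine (CobFloer.ProfileFunction.abs_im_flow_le hP hw hs).trans ?_
    obtain ⟨p, hp, rfl⟩ := hw
    obtain ⟨i, hi⟩ := mem_iUnion.1 hp
    refine le_trans ?_ (le_max_left _ _)
    linarith [hR i p hi, hR₁ (mem_range_self i)]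
  have hBR : ∀ p ∈ h.backward D.K, |p.im| ≤ R₃ := fun p hp =>
    (hR₂ ⟨p, hp, rfl⟩).trans (le_max_right _ _)
  -- The flow moves the box in which the straightened maps take their values by a bounded amount.
  have hbox : IsCompact (Icc (-(3 / 2) : ℝ) (5 / 2) ×ℂ Icc (-R₃) R₃) :=
    isCompact_Icc.reProdIm isCompact_Icc
  obtain ⟨C, hC⟩ := (((isCompact_Icc (a := (0 : ℝ)) (b := 1)).prod hbox).image
    (continuous_abs.comp (Complex.continuous_im.comp
      (h.isFlow.continuous_uncurry h.contDiff_field)))).bddAbove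
  refine ⟨max C 1, lt_max_of_lt_right one_pos, fun e a he ha hD c hc u hu z hz => ?_⟩
  choose γ hγ hlim using hu.asymptotic
  obtain ⟨i, hi⟩ := hα.1
  have hre := hu.straighten_re_mem he ha hD hc hP hi hγ hlim hz
  have him := (hu.isHolomorphicOff he ha hD hc hγ hlim).abs_im_le hBR
    (fun z hz h1 => by
      obtain ⟨w, hw, hwz⟩ := hu.exists_straighten_eq (a := a) hc hz h1
      rw [hwz]
      exact hPR w hw _ (ha.range c hc z hz))
    (by
      rintro j _ ⟨t, ht, rfl⟩
      rcases CobFloer.chordLimit_mem_or hD (hγ j) ht with hB | ⟨w, hw, s, hs, heq⟩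
      · exact hBR _ hB
      · rw [heq]; exact hPR w hw s hs) z hz
  rw [← CobFloer.flow_straighten (h := h) (a c) u z]
  refine ⟨h.flow_re_mem _ hre, abs_le.1 (le_max_of_le_left (hC ⟨(a c z, _), ⟨ha.range c hc z hz,
    hre, abs_le.1 him⟩, rfl⟩))⟩
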